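/- There is a constant $\varepsilon_0>0$ such that the following holds for every integer $n\ge 3$. Let $T$ be a randomized relative-error $\varepsilon_0$-tester for halfspaces over $\{0,1\}^n$ that draws $s$ samples from $\mathrm{SAMP}(f)$ and then makes $q$ non-adaptive queries to $\mathrm{MQ}(f)$. Then $$s\ \ge\ \frac{0.05\,\log n}{\log\log n}\qquad\text{or}\qquad q\ \ge\ n^{0.01},$$ where $\log$ is the natural logarithm. Here $f:\{0,1\}^n\to\{0,1\}$ is the function being tested, with $f^{-1}(1)\neq\emptyset$. Each call to $\mathrm{SAMP}(f)$ returns an independent uniformly random element of $f^{-1}(1)$, and $\mathrm{MQ}(f)$ returns $f(y)$ on a query $y\in\{0,1\}^n$. The $q$ queries are chosen all at once; they may depend on the $s$ samples and on the internal randomness of $T$, but not on each other's answers. A halfspace is a function of the form $f(x)=1$ if $w\cdot x\ge\theta$ and $f(x)=0$ otherwise, with $w\in\mathbb{R}^n$ and $\theta\in\mathbb{R}$. The tester $T$ is a relative-error $\varepsilon$-tester for halfspaces if, for every $f$ with $f^{-1}(1)\neq\emptyset$, it outputs "yes" with probability at least $9/10$ whenever $f$ is a halfspace, and outputs "no" with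 probability at least $9/10$ whenever $$\frac{|f^{-1}(1)\,\triangle\,g^{-1}(1)|}{|f^{-1}(1)|}\ \ge\ \varepsilon\quad\text{for every halfspace } g \text{ over } \{0,1\}^n.$$ -/

import Mathlib

open scoped symmDiff

/-- The Boolean cube `{0,1}^n`. -/
abbrev Cube (n : ℕ) : Type := Fin n → Bool

/-- Boolean functions `{0,1}^n → {0,1}`. -/
abbrev BoolFn (n : ℕ) : Type := Cube n → Bool

/-- The set `f⁻¹(1)` of satisfying assignments of `f`. -/
def satSet {n : ℕ} (f : BoolFn n) : Finset (Cube n) :=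
  Finset.univ.filter fun x => f x = true

/-- The class of halfspaces (linear threshold functions) over `{0,1}^n`:
`f x = 1` if and only if `w · x ≥ θ`, with real weights `w` and a real threshold `θ`. -/
def halfspaces (n : ℕ) : Set (BoolFn n) :=
  {f | ∃ (w : Fin n → ℝ) (θ : ℝ), ∀ x : Cube n,
    f x = true ↔ θ ≤ ∑ i, w i * (if x i = true then 1 else 0)}

/-- The relative distance `|f⁻¹(1) ∆ g⁻¹(1)| / |f⁻¹(1)|`
(meaningful only when `f⁻¹(1)` is nonempty, which is assumed wherever it is used). -/
noncomputable def relDist {n : ℕ} (f g : BoolFn n) : ℝ :=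
  ((satSet f ∆ satSet g).card : ℝ) / ((satSet f).card : ℝ)

/-- `rel-dist(f, C) ≥ ε`, where `rel-dist(f, C)` is the minimum of `rel-dist(f, g)` over the
(finitely many) `g ∈ C`. -/
def IsRelFar {n : ℕ} (ε : ℝ) (f : BoolFn n) (C : Set (BoolFn n)) : Prop :=
  ∀ g ∈ C, ε ≤ relDist f g

/-- The oracle `SAMP(f)`: one uniformly random satisfying assignment of `f`. -/
noncomputable def samp {n : ℕ} (f : BoolFn n) (hf : (satSet f).Nonempty) : PMF (Cube n) :=
  PMF.uniformOfFinset (satSet f) hf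

/-- The law of `s` independent draws from `p`. -/
noncomputable def iidDraws {α : Type} [Fintype α] (p : PMF α) (s : ℕ) : PMF (Fin s → α) :=
  PMF.ofFintype (fun u => ∏ i, p (u i)) (by
    classical
    have h : ∑ a, p a = 1 := by simpa [tsum_fintype] using p.tsum_coe
    rw [← Fintype.piFinset_univ, Finset.sum_prod_piFinset]
    simp [h])

/-- A randomized tester that draws `s` samples and then makes `q` non-adaptive queries.
`queries u` is the law of the queries (all chosen in parallel) given the samples `u`; `verdict u y b`
is the law of the output (`true` is "yes", `false` is "no") given the samples `u`, the queries `y`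
and their answers `b`. Internal randomness shared by the two phases is covered: `verdict` is then
the conditional law of the output. There is no restriction on computational power. -/
structure NonadaptiveTester (n s q : ℕ) where
  queries : (Fin s → Cube n) → PMF (Fin q → Cube n)
  verdict : (Fin s → Cube n) → (Fin q → Cube n) → (Fin q → Bool) → PMF Bool

/-- The law of the output of `T` when run on `f`: draw `s` independent samples from `SAMP(f)`,
choose the queries, have each of them answered by `MQ(f)`, output a verdict. -/
noncomputable def NonadaptiveTester.run {n s q : ℕ} (T : NonadaptiveTester n s q)
    (f : BoolFn n) (hf : (satSet f).Nonempty) : PMF Bool :=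
  (iidDraws (samp f hf) s).bind fun u =>
    (T.queries u).bind fun y => T.verdict u y fun j => f (y j)

/-- `T` is a relative-error `ε`-tester for the class `C`. Only functions with at least one
satisfying assignment are considered, as `SAMP(f)` and `rel-dist(f, ·)` need one. -/
def NonadaptiveTester.IsRelErrorTester {n s q : ℕ} (T : NonadaptiveTester n s q)
    (ε : ℝ) (C : Set (BoolFn n)) : Prop :=
  ∀ (f : BoolFn n) (hf : (satSet f).Nonempty),
    (f ∈ C → 9 / 10 ≤ T.run f hf true) ∧
    (IsRelFar ε f C → 9 / 10 ≤ T.run f hf false)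

/-! The proof is a hidden-structure argument. A uniformly random labelling `σ` splits the `n = 7K +
w` coordinates, `w < 7`, into `w` padding coordinates and `K` blocks, each made of two counted
coordinates, a partner for each of them, and three special coordinates `e, c, d`. Put `θ = K / 2`.
The yes-function accepts when (number of ones among the counted coordinates) `+ x_e ≤ θ`, which is a
halfspace; the no-function has `x_c ⊕ x_d` in place of `x_e`. Slices of fixed weight at least double
in size up to the threshold, so the slice of weight `θ` carries a constant fraction of the accepted
points. On it the no-function is a negated exclusive-or, and a halfspace errs on every square in the
directions `c, d`. Hence the no-function is `1/8`-far (`isRelFar_hiddenFn_noSet`).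

Samples. Half of the points accepted by either function lie in the common core `x_e = x_c ⊕ x_d`.
Only a fraction `2^(-s)` of the sample tuples stays in a given core, but there are `K` cores to
average over. With `e` fixed and `(c, d)` taken from a random block, or conversely, the core events
are pairwise independent of probability one half, and a second-moment estimate
(`abs_sum_restrict_sub_le`) shows that conditioning on a random core changes acceptance
probabilities by at most `√(2^s / K)` on average. So the tester must tell the two functions apart on
samples drawn from the same core (`core_advantage_le`).

Queries. The two functions differ at `y` only if `y` has weight exactly `θ` and `y_e ≠ y_c ⊕ y_d`.
Given core samples `u`, the labelling is uniform on `compat`, so it suffices that for each `u` and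
`y` few compatible labellings make `y` bad (`card_bad_le`). Group coordinates into atoms by their
column of sample values. If `y` takes both values often on some atom, exchanging counted coordinates
with partners of the same column leaves the samples alone but moves the weight of `y`, and
Littlewood–Offord makes weight `θ` unlikely. Otherwise `y` is nearly a function `g` of the column.
If `g` breaks an integer relation `b₁ + b₄ = b₂ + b₃`, exchanging both pairs in blocks with these
columns keeps all sample weights and again moves that of `y`. If `g` respects all such relations and
`g 0 = 0`, then `g` is linear over xor and `y` inherits `y_e = y_c ⊕ y_d` from the samples. If `g 0
= 1`, then `g` can vanish only where some fixed sample is one, and `y` is too heavy. All this needs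
every four-column pattern to occur in many blocks (`IsRich`), which Chebyshev gives with high
probability (`card_not_isRich_le`).

With `A = n^(1/8)`, `300^s ≤ A` and `q ≤ A`, the errors stay below the required advantage once `A ≥
5000`. For smaller `n` the bounds leave only `s = 0` and `q ≤ 1`, which is refuted by pairing
functions with their complements (`false_of_small`). -/

/-! ### Anti-concentration: Littlewood–Offord via Sperner -/

/-- The central binomial coefficient is at most `2 ^ k / √k`. -/
theorem mul_choose_half_sq_le (k : ℕ) : k * (k.choose (k / 2)) ^ 2 ≤ 4 ^ k := by
  -- The factor `2m + 1` instead of `2m` makes the induction close, because `(2m + 1)(2m + 3) ≤ 4(m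
  -- + 1)²`; it also yields the odd case.
  have key : ∀ m : ℕ, (2 * m + 1) * (Nat.centralBinom m) ^ 2 ≤ 16 ^ m := by
    intro m
    induction m with
    | zero => simp
    | succ m ih =>
      have h := Nat.succ_mul_centralBinom_succ m
      have h2 : (m + 1) ^ 2 * ((2 * (m + 1) + 1) * (Nat.centralBinom (m + 1)) ^ 2)
          ≤ (m + 1) ^ 2 * 16 ^ (m + 1) := by
        calc (m + 1) ^ 2 * ((2 * (m + 1) + 1) * (Nat.centralBinom (m + 1)) ^ 2)
            = (2 * m + 3) * ((m + 1) * Nat.centralBinom (m + 1)) ^ 2 := by ring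
          _ = (2 * m + 3) * (2 * (2 * m + 1) * Nat.centralBinom m) ^ 2 := by rw [h]
          _ = 4 * ((2 * m + 1) * (2 * m + 3)) * ((2 * m + 1) * (Nat.centralBinom m) ^ 2) := by ring
          _ ≤ 4 * (4 * (m + 1) ^ 2) * 16 ^ m := by
              exact Nat.mul_le_mul (Nat.mul_le_mul_left 4 (by nlinarith)) ih
          _ = (m + 1) ^ 2 * 16 ^ (m + 1) := by ring
      exact Nat.le_of_mul_le_mul_left h2 (by positivity)
  rcases Nat.even_or_odd' k with ⟨m, rfl | rfl⟩
  · have := key m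
    rw [Nat.mul_div_cancel_left _ (by norm_num), ← Nat.centralBinom_eq_two_mul_choose,
      pow_mul]
    calc 2 * m * m.centralBinom ^ 2 ≤ (2 * m + 1) * m.centralBinom ^ 2 := by gcongr; omega
      _ ≤ _ := by simpa using this
  · have h1 : (2 * m + 1) / 2 = m := by omega
    rw [h1]
    have h2 : Nat.centralBinom (m + 1) = 2 * (2 * m + 1).choose m := by
      rw [Nat.centralBinom_eq_two_mul_choose, show 2 * (m + 1) = (2 * m + 1) + 1 by ring,
        Nat.choose_succ_succ]
      have : (2 * m + 1).choose (m + 1) = (2 * m + 1).choose m := by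
        rw [← Nat.choose_symm_of_eq_add]; omega
      simp only [Nat.succ_eq_add_one] at *
      omega
    have := key (m + 1)
    rw [h2] at this
    have h4 : 4 ^ (2 * m + 1) * 4 = 16 ^ (m + 1) := by
      rw [← pow_succ, show 2 * m + 1 + 1 = 2 * (m + 1) by ring, pow_mul]; norm_num
    nlinarith [sq_nonneg ((2 * m + 1).choose m)]

/-- Littlewood–Offord: subset sums of nonzero integers hit a given value rarely. -/
theorem card_sum_eq_le {α : Type*} [Fintype α] [DecidableEq α] (Δ : α → ℤ)
    (h : ∀ a, Δ a ≠ 0) (c : ℤ) :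
    (Finset.univ.filter fun F : Finset α => ∑ a ∈ F, Δ a = c).card ≤
      (Fintype.card α).choose (Fintype.card α / 2) := by
  -- Taking the symmetric difference with the negative indices turns all steps positive up to a
  -- constant shift. The sets with a prescribed sum then form an antichain.
  set N : Finset α := Finset.univ.filter fun a => Δ a < 0 with hN
  have key : ∀ F : Finset α, ∑ a ∈ F ∆ N, |Δ a| = ∑ a ∈ F, Δ a + ∑ a ∈ N, |Δ a| := by
    intro F
    have e : ∀ (X : Finset α) (f : α → ℤ), ∑ a ∈ X, f a = ∑ a, if a ∈ X then f a else 0 := by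
      intro X f; rw [Finset.sum_ite_mem, Finset.univ_inter]
    rw [e (F ∆ N), e F, e N, ← Finset.sum_add_distrib]
    refine Finset.sum_congr rfl fun a _ => ?_
    by_cases hF : a ∈ F <;> by_cases hn : Δ a < 0 <;>
      simp [Finset.mem_symmDiff, hF, hN, hn, abs_of_neg, abs_of_nonneg, not_lt.1]
  set 𝒜 := (Finset.univ.filter fun F : Finset α => ∑ a ∈ F, Δ a = c).image (· ∆ N) with h𝒜
  have hcard : 𝒜.card = (Finset.univ.filter fun F : Finset α => ∑ a ∈ F, Δ a = c).card :=
    Finset.card_image_of_injective _ (symmDiff_left_injective N)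
  rw [← hcard]
  apply IsAntichain.sperner
  intro X hX Y hY hne hsub
  simp only [h𝒜, Finset.coe_image, Set.mem_image, Finset.mem_coe, Finset.mem_filter,
    Finset.mem_univ, true_and] at hX hY
  obtain ⟨F, hF, rfl⟩ := hX
  obtain ⟨F', hF', rfl⟩ := hY
  apply hne
  have h1 := key F
  have h2 := key F'
  rw [hF] at h1
  rw [hF'] at h2
  have h3 : ∑ a ∈ (F' ∆ N) \ (F ∆ N), |Δ a| = 0 := by
    have := Finset.sum_sdiff (f := fun a => |Δ a|) hsub
    linarith
  have h4 : (F' ∆ N) \ (F ∆ N) = ∅ := by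
    by_contra hcon
    obtain ⟨a, ha⟩ := Finset.nonempty_iff_ne_empty.2 hcon
    have := (Finset.sum_eq_zero_iff_of_nonneg (fun a _ => abs_nonneg (Δ a))).1 h3 a ha
    exact h a (abs_eq_zero.1 this)
  exact Finset.Subset.antisymm hsub (Finset.sdiff_eq_empty_iff_subset.1 h4)

theorem card_powerset_sum_eq_le {α : Type*} [DecidableEq α] (A : Finset α) (Δ : α → ℤ)
    (h : ∀ a ∈ A, Δ a ≠ 0) (c : ℤ) :
    (A.powerset.filter fun F => ∑ a ∈ F, Δ a = c).card ≤ A.card.choose (A.card / 2) := by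
  have := card_sum_eq_le (fun a : A => Δ a) (fun a => h a a.2) c
  rw [Fintype.card_coe] at this
  refine le_trans ?_ this
  refine Finset.card_le_card_of_injOn (fun F => F.subtype (· ∈ A)) ?_ ?_
  · intro F hF
    simp only [Finset.coe_filter, Finset.mem_powerset, Set.mem_ofPred_eq] at hF
    simp only [Finset.coe_filter, Finset.mem_univ, true_and, Set.mem_ofPred_eq]
    rw [Finset.sum_subtype_of_mem (fun a => Δ a) (fun x hx => hF.1 hx)]
    exact hF.2
  · intro F hF F' hF' heq
    simp only [Finset.coe_filter, Finset.mem_powerset, Set.mem_ofPred_eq] at hF hF'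
    have := congrArg (Finset.map (Function.Embedding.subtype _)) heq
    simp only [Finset.subtype_map] at this
    rwa [Finset.filter_true_of_mem (fun x hx => hF.1 hx),
      Finset.filter_true_of_mem (fun x hx => hF'.1 hx)] at this

/-- Anti-concentration of a statistic that changes under many commuting flips. -/
theorem card_flip_le {Ω ι : Type*} [DecidableEq ι] (S : Finset Ω)
    (Act : Ω → Finset ι) (fl : Finset ι → Ω → Ω) (h : Ω → ℤ) (Δ : Ω → ι → ℤ)
    (hS : ∀ σ ∈ S, ∀ F ⊆ Act σ, fl F σ ∈ S) (hinv : ∀ σ ∈ S, ∀ F ⊆ Act σ, fl F (fl F σ) = σ)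
    (hAct : ∀ σ ∈ S, ∀ F ⊆ Act σ, Act (fl F σ) = Act σ)
    (hh : ∀ σ ∈ S, ∀ F ⊆ Act σ, h (fl F σ) = h σ + ∑ a ∈ F, Δ σ a)
    (hΔ : ∀ σ ∈ S, ∀ a ∈ Act σ, Δ σ a ≠ 0) (θ : ℤ) (N : ℝ) (hN : 0 < N) :
    ((S.filter fun σ => N ≤ (Act σ).card ∧ h σ = θ).card : ℝ) ≤ S.card / √N := by
  classical
  set S' := S.filter fun σ => N ≤ (Act σ).card with hS'
  have hsub : ∀ {σ}, σ ∈ S' → σ ∈ S := fun hσ => (Finset.mem_filter.1 hσ).1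
  set P : Finset (Σ _ : Ω, Finset ι) := S'.sigma fun σ => (Act σ).powerset with hP
  have e1 : ((S.filter fun σ => N ≤ (Act σ).card ∧ h σ = θ).card : ℝ)
      = ∑ p ∈ P, (if h p.1 = θ then (1 : ℝ) else 0) / 2 ^ (Act p.1).card := by
    rw [← Finset.filter_filter, ← hS', Finset.card_filter, hP, Finset.sum_sigma]
    push_cast
    refine Finset.sum_congr rfl fun σ _ => ?_
    change _ = ∑ _F ∈ (Act σ).powerset, (if h σ = θ then (1 : ℝ) else 0) / 2 ^ (Act σ).card
    rw [Finset.sum_const, Finset.card_powerset, nsmul_eq_mul]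
    push_cast
    field_simp
  -- The map `(σ, F) ↦ (fl F σ, F)` is an involution of `P` that preserves the weights, so `σ` may
  -- be replaced by its random flip.
  have e2 : ∑ p ∈ P, (if h p.1 = θ then (1 : ℝ) else 0) / 2 ^ (Act p.1).card
      = ∑ p ∈ P, (if h (fl p.2 p.1) = θ then (1 : ℝ) else 0) / 2 ^ (Act p.1).card := by
    have hmem : ∀ p ∈ P, p.1 ∈ S' ∧ p.2 ⊆ Act p.1 := by
      intro p hp
      simpa [hP] using hp
    have hmap : ∀ p ∈ P, (⟨fl p.2 p.1, p.2⟩ : Σ _ : Ω, Finset ι) ∈ P := by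
      intro p hp
      obtain ⟨h1, h2⟩ := hmem p hp
      simp only [hP, Finset.mem_sigma, Finset.mem_powerset, hS', Finset.mem_filter]
      rw [hAct _ (hsub h1) _ h2]
      exact ⟨⟨hS _ (hsub h1) _ h2, (Finset.mem_filter.1 h1).2⟩, h2⟩
    refine Finset.sum_nbij' (fun p => ⟨fl p.2 p.1, p.2⟩) (fun p => ⟨fl p.2 p.1, p.2⟩) hmap hmap
      ?_ ?_ ?_
    · rintro ⟨σ, F⟩ hp
      obtain ⟨h1, h2⟩ := hmem _ hp
      simp [hinv _ (hsub h1) _ h2]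
    · rintro ⟨σ, F⟩ hp
      obtain ⟨h1, h2⟩ := hmem _ hp
      simp [hinv _ (hsub h1) _ h2]
    · rintro ⟨σ, F⟩ hp
      obtain ⟨h1, h2⟩ := hmem _ hp
      simp only at h1 h2 ⊢
      rw [hinv _ (hsub h1) _ h2, hAct _ (hsub h1) _ h2]
  -- For fixed `σ` the only randomness left is `F`, a uniform subset of the active indices, and
  -- Littlewood–Offord applies.
  have e3 : ∑ p ∈ P, (if h (fl p.2 p.1) = θ then (1 : ℝ) else 0) / 2 ^ (Act p.1).card
      ≤ ∑ σ ∈ S', 1 / √N := by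
    rw [hP, Finset.sum_sigma]
    refine Finset.sum_le_sum fun σ hσ => ?_
    change ∑ F ∈ (Act σ).powerset, (if h (fl F σ) = θ then (1 : ℝ) else 0) / 2 ^ (Act σ).card ≤ _
    rw [← Finset.sum_div]
    have hc : ∑ F ∈ (Act σ).powerset, (if h (fl F σ) = θ then (1 : ℝ) else 0)
        ≤ (Act σ).card.choose ((Act σ).card / 2) := by
      rw [← Finset.sum_filter, Finset.sum_const, nsmul_eq_mul, mul_one]
      norm_cast
      refine le_trans (Finset.card_le_card ?_)
        (card_powerset_sum_eq_le (Act σ) (Δ σ) (hΔ σ (hsub hσ)) (θ - h σ))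
      intro F hF
      simp only [Finset.mem_filter, Finset.mem_powerset] at hF ⊢
      refine ⟨hF.1, ?_⟩
      have := hh σ (hsub hσ) F hF.1
      linarith [hF.2]
    have hk := mul_choose_half_sq_le (Act σ).card
    set k := (Act σ).card
    have hkN : N ≤ k := (Finset.mem_filter.1 hσ).2
    have hk' : (k : ℝ) * ((k.choose (k / 2) : ℕ) : ℝ) ^ 2 ≤ 4 ^ k := by exact_mod_cast hk
    have hb : √N * ((k.choose (k / 2) : ℕ) : ℝ) ≤ 2 ^ k := by
      refine (pow_le_pow_iff_left₀ (by positivity) (by positivity) two_ne_zero).1 ?_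
      rw [mul_pow, Real.sq_sqrt hN.le, ← pow_mul, mul_comm k 2, pow_mul]
      norm_num
      refine le_trans ?_ hk'
      gcongr
    rw [div_le_div_iff₀ (by positivity) (Real.sqrt_pos.2 hN)]
    calc _ ≤ ((k.choose (k / 2) : ℕ) : ℝ) * √N := by gcongr
      _ ≤ _ := by linarith
  rw [e1, e2]
  refine e3.trans ?_
  rw [Finset.sum_const, nsmul_eq_mul, mul_one_div]
  gcongr
  exact Finset.filter_subset _ _

/-! ### Second-moment estimates -/

/-- Chebyshev's inequality for a sum of nearly uncorrelated indicators. -/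
theorem card_few_events_le {Ω ι : Type*} [DecidableEq ι] (S : Finset Ω) (G : Finset ι)
    (E : ι → Ω → Prop) [∀ κ ω, Decidable (E κ ω)] (p η : ℝ) (hp : 0 < p) (hp1 : p ≤ 1)
    (h1 : ∀ κ ∈ G, ((S.filter (E κ)).card : ℝ) = p * S.card)
    (h2 : ∀ κ ∈ G, ∀ κ' ∈ G, κ ≠ κ' →
      ((S.filter fun ω => E κ ω ∧ E κ' ω).card : ℝ) ≤ p ^ 2 * (1 + η) * S.card)
    (hη : 0 ≤ η) (hηG : η * G.card ≤ 1) :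
    ((S.filter fun ω => ((G.filter fun κ => E κ ω).card : ℝ) < p * G.card / 2).card : ℝ)
      ≤ 8 / (p * G.card) * S.card := by
  rcases G.eq_empty_or_nonempty with rfl | hG
  · simp
  have hGpos : (0 : ℝ) < G.card := by exact_mod_cast hG.card_pos
  set μ : ℝ := p * G.card with hμ
  have hμpos : 0 < μ := mul_pos hp hGpos
  set N : Ω → ℝ := fun ω => ∑ κ ∈ G, if E κ ω then (1 : ℝ) else 0 with hN
  have hNc : ∀ ω, ((G.filter fun κ => E κ ω).card : ℝ) = N ω := by
    intro ω; simp [hN]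
  have s1 : ∑ ω ∈ S, N ω = μ * S.card := by
    rw [hN, Finset.sum_comm]
    calc _ = ∑ κ ∈ G, p * (S.card : ℝ) := by
          refine Finset.sum_congr rfl fun κ hκ => ?_
          rw [← h1 κ hκ]; simp
      _ = _ := by simp [hμ]; ring
  have s2 : ∑ ω ∈ S, N ω ^ 2 ≤ (μ + μ ^ 2 * (1 + η)) * S.card := by
    have : ∀ ω, N ω ^ 2 = ∑ κ ∈ G, ∑ κ' ∈ G, if E κ ω ∧ E κ' ω then (1 : ℝ) else 0 := by
      intro ω
      rw [sq, hN, Finset.sum_mul_sum]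
      refine Finset.sum_congr rfl fun κ _ => Finset.sum_congr rfl fun κ' _ => ?_
      by_cases a : E κ ω <;> by_cases b : E κ' ω <;> simp [a, b]
    simp_rw [this]
    rw [Finset.sum_comm]
    calc ∑ κ ∈ G, ∑ ω ∈ S, ∑ κ' ∈ G, (if E κ ω ∧ E κ' ω then (1 : ℝ) else 0)
        = ∑ κ ∈ G, ∑ κ' ∈ G, ((S.filter fun ω => E κ ω ∧ E κ' ω).card : ℝ) := by
          refine Finset.sum_congr rfl fun κ _ => ?_
          rw [Finset.sum_comm]
          refine Finset.sum_congr rfl fun κ' _ => ?_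
          simp
      _ ≤ ∑ κ ∈ G, ∑ κ' ∈ G, ((if κ = κ' then p * (S.card : ℝ) else 0)
            + p ^ 2 * (1 + η) * S.card) := by
          refine Finset.sum_le_sum fun κ hκ => Finset.sum_le_sum fun κ' hκ' => ?_
          by_cases hk : κ = κ'
          · subst hk
            simp only [and_self, if_true]
            have := h1 κ hκ
            have h0 : 0 ≤ p ^ 2 * (1 + η) * S.card := by positivity
            linarith
          · simpa [hk] using h2 κ hκ κ' hκ' hk
      _ = _ := by
          simp only [Finset.sum_add_distrib, Finset.sum_ite_eq, Finset.sum_const, nsmul_eq_mul]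
          rw [Finset.sum_congr rfl (fun κ hκ => if_pos hκ), Finset.sum_const, nsmul_eq_mul]
          rw [hμ]; ring
  -- The correlation excess adds `μ² η ≤ μ` to the variance, since `η |G| ≤ 1` and `p ≤ 1`. A
  -- variance of `2μ` and a deviation of `μ / 2` give the constant `8`.
  have s3 : ∑ ω ∈ S, (N ω - μ) ^ 2 ≤ 2 * μ * S.card := by
    have : ∑ ω ∈ S, (N ω - μ) ^ 2 = ∑ ω ∈ S, N ω ^ 2 - 2 * μ * ∑ ω ∈ S, N ω + μ ^ 2 * S.card := by
      rw [Finset.mul_sum, ← Finset.sum_sub_distrib]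
      have : μ ^ 2 * (S.card : ℝ) = ∑ ω ∈ S, μ ^ 2 := by simp; ring
      rw [this, ← Finset.sum_add_distrib]
      exact Finset.sum_congr rfl fun ω _ => by ring
    rw [this, s1]
    have hx : μ * η ≤ 1 := by
      calc μ * η = p * (η * G.card) := by rw [hμ]; ring
        _ ≤ 1 * 1 := by gcongr
        _ = 1 := by ring
    have : μ ^ 2 * η * S.card ≤ μ * S.card := by
      have : μ ^ 2 * η ≤ μ := by nlinarith
      gcongr
    linarith
  have s4 : ((S.filter fun ω => N ω < μ / 2).card : ℝ) * (μ ^ 2 / 4) ≤ ∑ ω ∈ S, (N ω - μ) ^ 2 := by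
    calc _ = ∑ ω ∈ S.filter (fun ω => N ω < μ / 2), μ ^ 2 / 4 := by simp
      _ ≤ ∑ ω ∈ S.filter (fun ω => N ω < μ / 2), (N ω - μ) ^ 2 := by
          refine Finset.sum_le_sum fun ω hω => ?_
          have := (Finset.mem_filter.1 hω).2
          nlinarith
      _ ≤ _ := Finset.sum_le_sum_of_subset_of_nonneg (Finset.filter_subset _ _)
          fun _ _ _ => sq_nonneg _
  simp only [hNc]
  rw [div_mul_eq_mul_div, le_div_iff₀ hμpos]
  have := s4.trans s3
  have h5 : ((S.filter fun ω => N ω < μ / 2).card : ℝ) * μ * μ ≤ 8 * S.card * μ := by nlinarith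
  exact le_of_mul_le_mul_right h5 hμpos

/-- Second-moment decoupling: the events `E κ` have probability one half on `V` and are pairwise
independent, so restricting a tuple to a random `E κ` hardly changes averages. -/
theorem abs_sum_restrict_sub_le {W : Type*} [Fintype W] [DecidableEq W] (V : Finset W) {K : ℕ}
    (hK : 0 < K) (E : Fin K → W → Prop) [∀ κ w, Decidable (E κ w)] (T : Fin K → W → W)
    (hTV : ∀ κ, ∀ w ∈ V, T κ w ∈ V) (hTT : ∀ κ, ∀ w ∈ V, T κ (T κ w) = w)
    (hTE : ∀ κ, ∀ w ∈ V, (E κ (T κ w) ↔ ¬ E κ w))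
    (hTE' : ∀ κ κ', κ ≠ κ' → ∀ w ∈ V, (E κ' (T κ w) ↔ E κ' w))
    (s : ℕ) (φ : (Fin s → W) → ℝ) (h0 : ∀ v, 0 ≤ φ v) (h1 : ∀ v, φ v ≤ 1) :
    |∑ κ, 2 ^ s * ∑ v ∈ Fintype.piFinset (fun _ : Fin s => V.filter (E κ)), φ v
      - K * ∑ v ∈ Fintype.piFinset (fun _ : Fin s => V), φ v|
      ≤ K * ((V.card : ℝ) ^ s * √(2 ^ s / K)) := by
  have half : ∀ (κ : Fin K) (Q : W → Prop) [DecidablePred Q], (∀ w ∈ V, (Q (T κ w) ↔ Q w)) →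
      (((V.filter fun w => E κ w ∧ Q w).card : ℕ) : ℝ) = (V.filter Q).card / 2 := by
    intro κ Q _ hQ
    have e : (V.filter fun w => E κ w ∧ Q w).card = (V.filter fun w => ¬ E κ w ∧ Q w).card := by
      refine Finset.card_nbij' (T κ) (T κ) ?_ ?_ ?_ ?_
      · intro w hw
        simp only [Finset.coe_filter, Set.mem_ofPred_eq] at hw ⊢
        exact ⟨hTV κ w hw.1, by rw [hTE κ w hw.1]; simpa using hw.2.1, (hQ w hw.1).2 hw.2.2⟩
      · intro w hw
        simp only [Finset.coe_filter, Set.mem_ofPred_eq] at hw ⊢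
        exact ⟨hTV κ w hw.1, (hTE κ w hw.1).2 hw.2.1, (hQ w hw.1).2 hw.2.2⟩
      · intro w hw
        exact hTT κ w (Finset.mem_filter.1 hw).1
      · intro w hw
        exact hTT κ w (Finset.mem_filter.1 hw).1
    have e2 := Finset.card_filter_add_card_filter_not (s := V.filter Q) (E κ)
    rw [Finset.filter_filter, Finset.filter_filter] at e2
    have c1 : (V.filter fun w => Q w ∧ E κ w) = V.filter fun w => E κ w ∧ Q w := by
      ext w; simp [and_comm]
    have c2 : (V.filter fun w => Q w ∧ ¬ E κ w) = V.filter fun w => ¬ E κ w ∧ Q w := by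
      ext w; simp [and_comm]
    rw [c1, c2, ← e] at e2
    rw [← e2]; push_cast; ring
  have hE1 : ∀ κ, ((V.filter (E κ)).card : ℝ) = V.card / 2 := by
    intro κ
    have := half κ (fun _ => True) (by simp)
    simpa using this
  have hE2 : ∀ κ κ', κ ≠ κ' → ((V.filter fun w => E κ w ∧ E κ' w).card : ℝ) = V.card / 4 := by
    intro κ κ' hne
    rw [half κ (E κ') (hTE' κ κ' hne), hE1]; ring
  set U := Fintype.piFinset (fun _ : Fin s => V) with hU
  have hUc : (U.card : ℝ) = (V.card : ℝ) ^ s := by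
    simp [hU]
  have hfil : ∀ (Q : W → Prop) [DecidablePred Q],
      Fintype.piFinset (fun _ : Fin s => V.filter Q) = U.filter fun v => ∀ t, Q (v t) := by
    intro Q _
    ext v
    simp [hU, Fintype.mem_piFinset, forall_and]
  -- The normalized indicators `ξ κ` have mean zero, are uncorrelated and have variance at most
  -- `2^s`. The claim is Cauchy–Schwarz for `φ` against their sum.
  set ξ : Fin K → (Fin s → W) → ℝ := fun κ v => 2 ^ s * (if ∀ t, E κ (v t) then 1 else 0) - 1
    with hξ
  have e1 : ∑ κ, 2 ^ s * ∑ v ∈ Fintype.piFinset (fun _ : Fin s => V.filter (E κ)), φ v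
      - K * ∑ v ∈ U, φ v = ∑ v ∈ U, φ v * ∑ κ, ξ κ v := by
    simp_rw [hξ, Finset.sum_sub_distrib, mul_sub, Finset.mul_sum, Finset.sum_sub_distrib]
    congr 1
    · rw [Finset.sum_comm]
      refine Finset.sum_congr rfl fun κ _ => ?_
      rw [hfil (E κ), ← Finset.mul_sum, Finset.sum_filter, Finset.mul_sum]
      refine Finset.sum_congr rfl fun v _ => ?_
      split_ifs <;> ring
    · refine Finset.sum_congr rfl fun v _ => ?_
      simp
  have hcard1 : ∀ κ, ∑ v ∈ U, (if ∀ t, E κ (v t) then (1 : ℝ) else 0) = (V.card / 2 : ℝ) ^ s := by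
    intro κ
    rw [← Finset.sum_filter, ← hfil (E κ), Finset.sum_const, Fintype.card_piFinset_const,
      nsmul_eq_mul, mul_one]
    push_cast
    rw [hE1]
  have hcard2 : ∀ κ κ', κ ≠ κ' → ∑ v ∈ U, ((if ∀ t, E κ (v t) then (1 : ℝ) else 0) *
      (if ∀ t, E κ' (v t) then (1 : ℝ) else 0)) = (V.card / 4 : ℝ) ^ s := by
    intro κ κ' hne
    have : ∀ v : Fin s → W, (if ∀ t, E κ (v t) then (1 : ℝ) else 0) *
      (if ∀ t, E κ' (v t) then (1 : ℝ) else 0) = if ∀ t, (E κ (v t) ∧ E κ' (v t)) then 1 else 0 := by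
      intro v
      have hiff : (∀ t, (E κ (v t) ∧ E κ' (v t))) ↔ (∀ t, E κ (v t)) ∧ ∀ t, E κ' (v t) := forall_and
      by_cases a : ∀ t, E κ (v t)
      · by_cases b : ∀ t, E κ' (v t)
        · rw [if_pos a, if_pos b, if_pos (hiff.2 ⟨a, b⟩), mul_one]
        · rw [if_neg b, if_neg fun h => b (hiff.1 h).2, mul_zero]
      · rw [if_neg a, if_neg fun h => a (hiff.1 h).1, zero_mul]
    simp_rw [this]
    rw [← Finset.sum_filter, ← hfil (fun w => E κ w ∧ E κ' w), Finset.sum_const,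
      Fintype.card_piFinset_const, nsmul_eq_mul, mul_one]
    push_cast
    rw [hE2 κ κ' hne]
  have hξξ : ∀ κ κ', ∑ v ∈ U, ξ κ v * ξ κ' v ≤ if κ = κ' then 2 ^ s * (V.card : ℝ) ^ s else 0 := by
    intro κ κ'
    have ex : ∀ v, ξ κ v * ξ κ' v = 4 ^ s * ((if ∀ t, E κ (v t) then (1 : ℝ) else 0) *
      (if ∀ t, E κ' (v t) then (1 : ℝ) else 0)) - 2 ^ s * (if ∀ t, E κ (v t) then (1 : ℝ) else 0)
      - 2 ^ s * (if ∀ t, E κ' (v t) then (1 : ℝ) else 0) + 1 := by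
      intro v
      simp only [hξ]
      rw [show (4 : ℝ) ^ s = 2 ^ s * 2 ^ s by rw [← mul_pow]; norm_num]
      ring
    simp_rw [ex, Finset.sum_add_distrib, Finset.sum_sub_distrib, ← Finset.mul_sum, hcard1]
    rw [Finset.sum_const, nsmul_eq_mul, mul_one, hUc]
    have q2 : (2 : ℝ) ^ s * (V.card / 2) ^ s = (V.card : ℝ) ^ s := by
      rw [← mul_pow]; congr 1; ring
    have q4 : (4 : ℝ) ^ s * (V.card / 4) ^ s = (V.card : ℝ) ^ s := by
      rw [← mul_pow]; congr 1; ring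
    by_cases hk : κ = κ'
    · subst hk
      have : ∀ v : Fin s → W, (if ∀ t, E κ (v t) then (1 : ℝ) else 0) *
          (if ∀ t, E κ (v t) then (1 : ℝ) else 0) = if ∀ t, E κ (v t) then (1 : ℝ) else 0 := by
        intro v; split_ifs <;> simp
      simp_rw [this, hcard1]
      simp only [if_true]
      rw [q2]
      have : (4 : ℝ) ^ s * (V.card / 2) ^ s = 2 ^ s * (V.card : ℝ) ^ s := by
        rw [← mul_pow, ← mul_pow]; congr 1; ring
      rw [this]
      have : (0 : ℝ) ≤ (V.card : ℝ) ^ s := by positivity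
      linarith
    · rw [hcard2 κ κ' hk, if_neg hk, q2, q4]; linarith
  have hsq : ∑ v ∈ U, (∑ κ, ξ κ v) ^ 2 ≤ K * (2 ^ s * (V.card : ℝ) ^ s) := by
    have : ∀ v, (∑ κ, ξ κ v) ^ 2 = ∑ κ, ∑ κ', ξ κ v * ξ κ' v := fun v => by
      rw [sq, Finset.sum_mul_sum]
    simp_rw [this]
    rw [Finset.sum_comm]
    calc _ = ∑ κ, ∑ κ', ∑ v ∈ U, ξ κ v * ξ κ' v :=
          Finset.sum_congr rfl fun κ _ => Finset.sum_comm
      _ ≤ ∑ κ : Fin K, ∑ κ', if κ = κ' then 2 ^ s * (V.card : ℝ) ^ s else 0 :=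
          Finset.sum_le_sum fun κ _ => Finset.sum_le_sum fun κ' _ => hξξ κ κ'
      _ = _ := by simp
  have hφ : ∑ v ∈ U, φ v ^ 2 ≤ (V.card : ℝ) ^ s := by
    rw [← hUc]
    calc _ ≤ ∑ v ∈ U, (1 : ℝ) := Finset.sum_le_sum fun v _ => pow_le_one₀ (h0 v) (h1 v)
      _ = _ := by simp
  have hKpos : (0 : ℝ) < K := by exact_mod_cast hK
  rw [e1]
  apply abs_le_of_sq_le_sq _ (by positivity)
  calc (∑ v ∈ U, φ v * ∑ κ, ξ κ v) ^ 2 ≤ (∑ v ∈ U, φ v ^ 2) * ∑ v ∈ U, (∑ κ, ξ κ v) ^ 2 :=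
        Finset.sum_mul_sq_le_sq_mul_sq _ _ _
    _ ≤ (V.card : ℝ) ^ s * (K * (2 ^ s * (V.card : ℝ) ^ s)) := by gcongr
    _ = (K * ((V.card : ℝ) ^ s * √(2 ^ s / K))) ^ 2 := by
        rw [mul_pow, mul_pow, Real.sq_sqrt (by positivity)]
        field_simp

/-! ### Patterns in a uniform subset of fixed size -/

/-- The number of `t`-subsets of `M` that contain `U` and avoid `W`. -/
theorem card_powersetCard_pattern {α : Type*} [DecidableEq α] (M U W : Finset α) (hU : U ⊆ M)
    (hW : W ⊆ M) (hUW : Disjoint U W) (t : ℕ) :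
    ((M.powersetCard t).filter fun X => U ⊆ X ∧ Disjoint W X).card *
      M.card.descFactorial (U.card + W.card)
      = M.card.choose t * (t.descFactorial U.card * (M.card - t).descFactorial W.card) := by
  by_cases htM : M.card < t
  · rw [Finset.powersetCard_eq_empty.2 htM, Nat.choose_eq_zero_of_lt htM]; simp
  push Not at htM
  by_cases hut : t < U.card
  · rw [Nat.descFactorial_eq_zero_iff_lt.2 hut, zero_mul, mul_zero]
    rw [Finset.filter_false_of_mem, Finset.card_empty, zero_mul]
    intro X hX hc
    have := Finset.card_le_card hc.1
    have := (Finset.mem_powersetCard.1 hX).2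
    omega
  push Not at hut
  have hUWM : U.card + W.card ≤ M.card := by
    rw [← Finset.card_union_of_disjoint hUW]
    exact Finset.card_le_card (Finset.union_subset hU hW)
  by_cases hwt : M.card - t < W.card
  · rw [Nat.descFactorial_eq_zero_iff_lt.2 hwt, mul_zero, mul_zero]
    rw [Finset.filter_false_of_mem, Finset.card_empty, zero_mul]
    intro X hX hc
    obtain ⟨hXM, hXc⟩ := Finset.mem_powersetCard.1 hX
    have h1 := Finset.card_le_card (Finset.union_subset hW hXM)
    rw [Finset.card_union_of_disjoint hc.2] at h1
    omega
  push Not at hwt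
  have hcount : ((M.powersetCard t).filter fun X => U ⊆ X ∧ Disjoint W X).card
      = (M.card - U.card - W.card).choose (t - U.card) := by
    have hc : (M \ (U ∪ W)).card = M.card - U.card - W.card := by
      rw [Finset.card_sdiff_of_subset (Finset.union_subset hU hW),
        Finset.card_union_of_disjoint hUW]; omega
    rw [← hc, ← Finset.card_powersetCard]
    refine Finset.card_nbij' (fun X => X \ U) (fun X => X ∪ U) ?_ ?_ ?_ ?_
    · intro X hX
      simp only [Finset.coe_filter, Finset.mem_powersetCard, Set.mem_ofPred_eq] at hX
      simp only [Finset.mem_coe, Finset.mem_powersetCard]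
      refine ⟨?_, by rw [Finset.card_sdiff_of_subset hX.2.1, hX.1.2]⟩
      intro x hx
      simp only [Finset.mem_sdiff, Finset.mem_union] at hx ⊢
      exact ⟨hX.1.1 hx.1, fun h => h.elim hx.2 fun h => Finset.disjoint_left.1 hX.2.2 h hx.1⟩
    · intro X hX
      simp only [Finset.mem_coe, Finset.mem_powersetCard] at hX
      simp only [Finset.coe_filter, Finset.mem_powersetCard, Set.mem_ofPred_eq]
      have hdis : Disjoint X U := Finset.disjoint_left.2 fun x hx hxU => by
        have := hX.1 hx
        simp [hxU] at this
      refine ⟨⟨Finset.union_subset (hX.1.trans Finset.sdiff_subset) hU, ?_⟩,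
        Finset.subset_union_right, ?_⟩
      · rw [Finset.card_union_of_disjoint hdis, hX.2]; omega
      · rw [Finset.disjoint_union_right]
        refine ⟨Finset.disjoint_left.2 fun x hx hxX => ?_, hUW.symm⟩
        have := hX.1 hxX
        simp [hx] at this
    · intro X hX
      simp only [Finset.coe_filter, Set.mem_ofPred_eq] at hX
      exact Finset.sdiff_union_of_subset hX.2.1
    · intro X hX
      simp only [Finset.mem_coe, Finset.mem_powersetCard] at hX
      have hdis : Disjoint X U := Finset.disjoint_left.2 fun x hx hxU => by
        have := hX.1 hx
        simp [hxU] at this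
      change (X ∪ U) \ U = X
      rw [Finset.union_sdiff_right, Finset.sdiff_eq_self_of_disjoint hdis]
  rw [hcount]
  have f1 := Nat.choose_mul_factorial_mul_factorial htM
  have f2 := Nat.choose_mul_factorial_mul_factorial
    (show t - U.card ≤ M.card - U.card - W.card by omega)
  have f3 := Nat.factorial_mul_descFactorial hut
  have f4 := Nat.factorial_mul_descFactorial hwt
  have f5 := Nat.factorial_mul_descFactorial hUWM
  have i1 : M.card - U.card - W.card - (t - U.card) = M.card - t - W.card := by omega
  have i2 : M.card - (U.card + W.card) = M.card - U.card - W.card := by omega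
  rw [i1] at f2
  rw [i2] at f5
  have hpos : 0 < (t - U.card).factorial * (M.card - t - W.card).factorial := by positivity
  apply Nat.eq_of_mul_eq_mul_right hpos
  generalize (M.card - U.card - W.card).choose (t - U.card) = c1 at *
  generalize M.card.choose t = c2 at *
  generalize (t - U.card).factorial = a1 at *
  generalize (M.card - t - W.card).factorial = a2 at *
  generalize (M.card - U.card - W.card).factorial = a3 at *
  generalize M.card.descFactorial (U.card + W.card) = d1 at *
  generalize t.descFactorial U.card = d2 at *
  generalize (M.card - t).descFactorial W.card = d3 at *
  calc c1 * d1 * (a1 * a2) = (c1 * a1 * a2) * d1 := by ring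
    _ = M.card.factorial := by rw [f2, f5]
    _ = c2 * (a1 * d2) * (a2 * d3) := by rw [f3, f4, f1]
    _ = _ := by ring

/-- The probability that a uniform `t`-subset of an `a`-set contains exactly those of two given
points which `x` and `z` prescribe. -/
noncomputable def pairProb (a t : ℕ) (x z : Bool) : ℝ :=
  (if x then (t : ℝ) else a - t) *
    (if z then (if x then (t : ℝ) - 1 else t) else (if x then (a : ℝ) - t else a - t - 1)) /
    (a * (a - 1))

theorem cast_descFactorial_two (t : ℕ) : ((t.descFactorial 2 : ℕ) : ℝ) = t * (t - 1) := by
  rw [Nat.cast_descFactorial_two]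

theorem cast_descFactorial_four (t : ℕ) :
    ((t.descFactorial 4 : ℕ) : ℝ) = t * (t - 1) * (t - 2) * (t - 3) := by
  rcases Nat.lt_or_ge t 4 with h | h
  · interval_cases t <;> simp [Nat.descFactorial]
  · simp only [Nat.descFactorial]
    push_cast [Nat.cast_sub (show 3 ≤ t by omega), Nat.cast_sub (show 2 ≤ t by omega),
      Nat.cast_sub (show 1 ≤ t by omega)]
    simp; ring

theorem card_pair_pattern {α : Type*} [DecidableEq α] (M : Finset α) (t : ℕ) (ht : t ≤ M.card)
    (hM : 2 ≤ M.card) (i j : α) (hi : i ∈ M) (hj : j ∈ M) (hij : i ≠ j) (x z : Bool) :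
    (((M.powersetCard t).filter fun X => decide (i ∈ X) = x ∧ decide (j ∈ X) = z).card : ℝ)
      = pairProb M.card t x z * (M.powersetCard t).card := by
  have hM' : (2 : ℝ) ≤ M.card := by exact_mod_cast hM
  have hden : (M.card : ℝ) * (M.card - 1) ≠ 0 := by
    apply mul_ne_zero <;> linarith
  have key : ∀ U W : Finset α, U ⊆ M → W ⊆ M → Disjoint U W → U.card + W.card = 2 →
      (((M.powersetCard t).filter fun X => U ⊆ X ∧ Disjoint W X).card : ℝ) *
        ((M.card : ℝ) * (M.card - 1)) = (M.powersetCard t).card *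
        (((t.descFactorial U.card : ℕ) : ℝ) * (((M.card - t).descFactorial W.card : ℕ) : ℝ)) := by
    intro U W hU hW hUW h2
    have := card_powersetCard_pattern M U W hU hW hUW t
    rw [h2] at this
    rw [← cast_descFactorial_two, Finset.card_powersetCard]
    exact_mod_cast this
  rw [pairProb, div_mul_eq_mul_div, eq_div_iff hden]
  cases x <;> cases z
  · have := key ∅ {i, j} (by simp) (by simp [Finset.insert_subset_iff, hi, hj]) (by simp)
      (by simp [hij])
    simp only [Finset.card_empty, Finset.card_pair hij, cast_descFactorial_two] at this
    rw [Finset.filter_congr (q := fun X => ∅ ⊆ X ∧ Disjoint {i, j} X)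
      (fun X _ => by simp), this, Nat.cast_sub ht]
    simp; ring
  · have := key {j} {i} (by simp [hj]) (by simp [hi]) (by simp [hij.symm]) (by simp)
    simp only [Finset.card_singleton] at this
    rw [Finset.filter_congr (q := fun X => {j} ⊆ X ∧ Disjoint {i} X)
      (fun X _ => by simp [and_comm]), this]
    simp [Nat.cast_sub ht]; ring
  · have := key {i} {j} (by simp [hi]) (by simp [hj]) (by simp [hij]) (by simp)
    simp only [Finset.card_singleton] at this
    rw [Finset.filter_congr (q := fun X => {i} ⊆ X ∧ Disjoint {j} X)
      (fun X _ => by simp), this]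
    simp [Nat.cast_sub ht]; ring
  · have := key {i, j} ∅ (by simp [Finset.insert_subset_iff, hi, hj]) (by simp) (by simp)
      (by simp [hij])
    simp only [Finset.card_empty, Finset.card_pair hij, cast_descFactorial_two] at this
    rw [Finset.filter_congr (q := fun X => {i, j} ⊆ X ∧ Disjoint ∅ X)
      (fun X _ => by simp [Finset.insert_subset_iff]), this]
    simp; ring

/-- Here the two pair events are negatively correlated: removing a pair lowers both remaining
ratios. The factor `1 + 4 / a²` is slack, kept to match the mixed pattern of `desc_two_two_le`. -/
theorem desc_four_le (a t : ℕ) (ht : t ≤ a) (ha : 6 ≤ a) :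
    (t : ℝ) * (t - 1) * (t - 2) * (t - 3) / (a * (a - 1) * (a - 2) * (a - 3))
      ≤ (t * (t - 1) / (a * (a - 1))) ^ 2 * (1 + 4 / a ^ 2) := by
  have ha' : (6 : ℝ) ≤ a := by exact_mod_cast ha
  have hta : (t : ℝ) ≤ a := by exact_mod_cast ht
  have hnn : (0 : ℝ) ≤ (t * (t - 1) / (a * (a - 1))) ^ 2 := sq_nonneg _
  have h4 : (0 : ℝ) ≤ 4 / (a : ℝ) ^ 2 := by positivity
  suffices h : (t : ℝ) * (t - 1) * (t - 2) * (t - 3) / (a * (a - 1) * (a - 2) * (a - 3))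
      ≤ (t * (t - 1) / (a * (a - 1))) ^ 2 by nlinarith
  rcases Nat.lt_or_ge t 3 with h | h
  · have : (t : ℝ) * (t - 1) * (t - 2) * (t - 3) = 0 := by interval_cases t <;> norm_num
    rw [this, zero_div]; exact hnn
  · have h3 : (3 : ℝ) ≤ t := by exact_mod_cast h
    have e : (t : ℝ) * (t - 1) * (t - 2) * (t - 3) / (a * (a - 1) * (a - 2) * (a - 3))
        = (t * (t - 1) / (a * (a - 1))) * (((t - 2) / (a - 2)) * ((t - 3) / (a - 3))) := by
      rw [div_mul_div_comm, div_mul_div_comm]; congr 1 <;> ring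
    rw [e, sq]
    have b1 : ((t : ℝ) - 2) / (a - 2) ≤ t / a := by
      rw [div_le_div_iff₀ (by linarith) (by linarith)]; nlinarith
    have b2 : ((t : ℝ) - 3) / (a - 3) ≤ (t - 1) / (a - 1) := by
      rw [div_le_div_iff₀ (by linarith) (by linarith)]; nlinarith
    have b3 : (t : ℝ) * (t - 1) / (a * (a - 1)) = (t / a) * ((t - 1) / (a - 1)) := by
      rw [div_mul_div_comm]
    have c0 : 0 ≤ (t : ℝ) * (t - 1) / (a * (a - 1)) := by
      apply div_nonneg <;> apply mul_nonneg <;> linarith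
    have c1 : 0 ≤ ((t : ℝ) - 3) / (a - 3) := by apply div_nonneg <;> linarith
    have c2 : 0 ≤ (t : ℝ) / a := by positivity
    refine mul_le_mul_of_nonneg_left ?_ c0
    rw [b3]
    exact mul_le_mul b1 b2 c1 c2

/-- The mixed pattern is positively correlated near `t = a / 2`, so the correction `4 / a²` is
needed. After clearing denominators the inequality is linear in `p = t (a - t)`, and the worst case
is `p = a² / 4`. What remains there is a multiple of `(a - 2)(a - 6)`, whence `6 ≤ a`. -/
theorem desc_two_two_le (a t : ℕ) (ht : t ≤ a) (ha : 6 ≤ a) :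
    (t : ℝ) * (t - 1) * ((a - t) * (a - t - 1)) / (a * (a - 1) * (a - 2) * (a - 3))
      ≤ (t * (a - t) / (a * (a - 1))) ^ 2 * (1 + 4 / a ^ 2) := by
  have ha' : (6 : ℝ) ≤ a := by exact_mod_cast ha
  obtain ⟨f, hf⟩ := Nat.exists_eq_add_of_le ht
  have hf' : (a : ℝ) - t = f := by rw [hf]; push_cast; ring
  rw [hf']
  have h0 : (0 : ℝ) ≤ (t * f / (a * (a - 1))) ^ 2 * (1 + 4 / (a : ℝ) ^ 2) := by positivity
  rcases Nat.eq_zero_or_pos t with h | h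
  · subst h; simp
  rcases Nat.eq_zero_or_pos f with h' | h'
  · subst h'; simp
  have ht1 : (1 : ℝ) ≤ t := by exact_mod_cast h
  have hf1 : (1 : ℝ) ≤ f := by exact_mod_cast h'
  have hsum : (t : ℝ) + f = a := by rw [hf]; push_cast; ring
  set p : ℝ := t * f with hp
  have hp4 : p ≤ a ^ 2 / 4 := by rw [← hsum, hp]; nlinarith [sq_nonneg ((t : ℝ) - f)]
  have hppos : 0 < p := by positivity
  have e1 : ((t : ℝ) - 1) * (f - 1) = p - a + 1 := by rw [← hsum, hp]; ring
  have main : (p - a + 1) * (a * (a - 1)) ≤ p * (1 + 4 / a ^ 2) * ((a - 2) * (a - 3)) := by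
    have : p * (1 + 4 / (a : ℝ) ^ 2) * ((a - 2) * (a - 3)) =
      p * (((a : ℝ) - 2) * (a - 3)) + 4 * p * ((a - 2) * (a - 3)) / a ^ 2 := by field_simp
    rw [this]
    have h5 : p * (4 * a - 6) * a ^ 2 ≤ ((a : ℝ) - 1) ^ 2 * a * a ^ 2 + 4 * p * ((a - 2) * (a - 3)) := by
      have hc : 0 ≤ (4 * (a : ℝ) - 6) * a ^ 2 - 4 * ((a - 2) * (a - 3)) := by nlinarith [sq_nonneg (a : ℝ)]
      have h6 := mul_le_mul_of_nonneg_right hp4 hc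
      have h7 : (a : ℝ) ^ 2 / 4 * ((4 * (a : ℝ) - 6) * a ^ 2 - 4 * ((a - 2) * (a - 3)))
          ≤ ((a : ℝ) - 1) ^ 2 * a * a ^ 2 := by
        have : ((a : ℝ) - 1) ^ 2 * a * a ^ 2 -
          (a : ℝ) ^ 2 / 4 * ((4 * (a : ℝ) - 6) * a ^ 2 - 4 * ((a - 2) * (a - 3)))
          = a ^ 2 * ((a - 2) * (a - 6) / 2) := by ring
        have h8 : (0 : ℝ) ≤ a ^ 2 * ((a - 2) * (a - 6) / 2) := by
          apply mul_nonneg (by positivity)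
          apply div_nonneg _ (by norm_num)
          apply mul_nonneg <;> linarith
        linarith
      linarith
    have h9 : p * (4 * a - 6) ≤ ((a : ℝ) - 1) ^ 2 * a + 4 * p * ((a - 2) * (a - 3)) / a ^ 2 := by
      have ha2 : (0 : ℝ) < a ^ 2 := by positivity
      rw [← sub_le_iff_le_add', le_div_iff₀ ha2]
      linarith
    nlinarith
  have e2 : (t : ℝ) * (t - 1) * (f * (f - 1)) = p * (p - a + 1) := by rw [← e1, hp]; ring
  rw [e2]
  have a1 : (0 : ℝ) < a * (a - 1) := by apply mul_pos <;> linarith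
  have a2 : (0 : ℝ) < (a - 2) * (a - 3) := by apply mul_pos <;> linarith
  rw [show (a : ℝ) * (a - 1) * (a - 2) * (a - 3) = (a * (a - 1)) * ((a - 2) * (a - 3)) by ring,
    div_pow, div_mul_eq_mul_div, div_le_div_iff₀ (by positivity) (by positivity)]
  calc p * (p - a + 1) * ((a : ℝ) * (a - 1)) ^ 2
      = p * (a * (a - 1)) * ((p - a + 1) * (a * (a - 1))) := by ring
    _ ≤ p * (a * (a - 1)) * (p * (1 + 4 / a ^ 2) * ((a - 2) * (a - 3))) := by
        apply mul_le_mul_of_nonneg_left main; positivity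
    _ = _ := by ring

/-- Second-moment input for Chebyshev: the excess `4 / |M|²` over independence is small enough to be
summed over `|M| / 2` disjoint pairs. -/
theorem card_two_pair_pattern_le {α : Type*} [DecidableEq α] (M : Finset α) (t : ℕ)
    (ht : t ≤ M.card) (hM : 6 ≤ M.card) (i j i' j' : α) (hi : i ∈ M) (hj : j ∈ M) (hi' : i' ∈ M)
    (hj' : j' ∈ M) (hij : i ≠ j) (hij' : i' ≠ j') (hii : i ≠ i') (hjj : j ≠ j') (h1 : i ≠ j')
    (h2 : i' ≠ j) (x z : Bool) :
    (((M.powersetCard t).filter fun X => (decide (i ∈ X) = x ∧ decide (j ∈ X) = z) ∧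
      (decide (i' ∈ X) = x ∧ decide (j' ∈ X) = z)).card : ℝ)
      ≤ pairProb M.card t x z ^ 2 * (1 + 4 / (M.card : ℝ) ^ 2) * (M.powersetCard t).card := by
  have hM' : (6 : ℝ) ≤ M.card := by exact_mod_cast hM
  have hden : (0 : ℝ) < (M.card : ℝ) * (M.card - 1) * (M.card - 2) * (M.card - 3) := by
    refine mul_pos (mul_pos (mul_pos ?_ ?_) ?_) ?_ <;> linarith
  have key : ∀ U W : Finset α, U ⊆ M → W ⊆ M → Disjoint U W → U.card + W.card = 4 →
      (((M.powersetCard t).filter fun X => U ⊆ X ∧ Disjoint W X).card : ℝ)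
       = (((t.descFactorial U.card : ℕ) : ℝ) * (((M.card - t).descFactorial W.card : ℕ) : ℝ)) /
        ((M.card : ℝ) * (M.card - 1) * (M.card - 2) * (M.card - 3)) * (M.powersetCard t).card := by
    intro U W hU hW hUW h2
    have := card_powersetCard_pattern M U W hU hW hUW t
    rw [h2] at this
    rw [div_mul_eq_mul_div, eq_div_iff hden.ne', ← cast_descFactorial_four,
      Finset.card_powersetCard, mul_comm (_ * _) (((M.card.choose t : ℕ) : ℝ))]
    exact_mod_cast this
  have c4 : ({i, j, i', j'} : Finset α).card = 4 := by
    rw [Finset.card_insert_of_notMem, Finset.card_insert_of_notMem, Finset.card_pair hij'] <;>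
      simp [*, h2.symm]
  have hpos : (0 : ℝ) ≤ (M.powersetCard t).card := by positivity
  cases x <;> cases z
  · have := key ∅ {i, j, i', j'} (by simp) (by simp [Finset.insert_subset_iff, *]) (by simp)
      (by simp [c4])
    rw [Finset.filter_congr (q := fun X => ∅ ⊆ X ∧ Disjoint {i, j, i', j'} X)
      (fun X _ => by simp [and_assoc]), this]
    refine mul_le_mul_of_nonneg_right ?_ hpos
    rw [c4, cast_descFactorial_four, Finset.card_empty]
    have hb := desc_four_le M.card (M.card - t) (by omega) hM
    rw [Nat.cast_sub ht] at hb ⊢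
    simpa [pairProb] using hb
  · have := key {j, j'} {i, i'} (by simp [Finset.insert_subset_iff, *])
      (by simp [Finset.insert_subset_iff, *]) (by simp [*, Ne.symm])
      (by simp [hii, hjj])
    rw [Finset.filter_congr (q := fun X => {j, j'} ⊆ X ∧ Disjoint {i, i'} X)
      (fun X _ => by simp [Finset.insert_subset_iff]; tauto), this]
    refine mul_le_mul_of_nonneg_right ?_ hpos
    rw [Finset.card_pair hii, Finset.card_pair hjj, cast_descFactorial_two,
      cast_descFactorial_two, Nat.cast_sub ht]
    have hb := desc_two_two_le M.card t ht hM
    simpa [pairProb, mul_comm ((M.card : ℝ) - t) t] using hb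
  · have := key {i, i'} {j, j'} (by simp [Finset.insert_subset_iff, *])
      (by simp [Finset.insert_subset_iff, *]) (by simp [*, Ne.symm])
      (by simp [hii, hjj])
    rw [Finset.filter_congr (q := fun X => {i, i'} ⊆ X ∧ Disjoint {j, j'} X)
      (fun X _ => by simp [Finset.insert_subset_iff]; tauto), this]
    refine mul_le_mul_of_nonneg_right ?_ hpos
    rw [Finset.card_pair hii, Finset.card_pair hjj, cast_descFactorial_two,
      cast_descFactorial_two, Nat.cast_sub ht]
    have hb := desc_two_two_le M.card t ht hM
    simpa [pairProb] using hb
  · have := key {i, j, i', j'} ∅ (by simp [Finset.insert_subset_iff, *]) (by simp) (by simp)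
      (by simp [c4])
    rw [Finset.filter_congr (q := fun X => {i, j, i', j'} ⊆ X ∧ Disjoint ∅ X)
      (fun X _ => by simp [Finset.insert_subset_iff, and_assoc]), this]
    refine mul_le_mul_of_nonneg_right ?_ hpos
    rw [c4, cast_descFactorial_four, Finset.card_empty]
    have hb := desc_four_le M.card t ht hM
    simpa [pairProb] using hb

/-- A uniform subset separates a constant fraction of the expected number of disjoint pairs. -/
theorem card_few_separated_pairs_le {α ι : Type*} [DecidableEq α] [DecidableEq ι] (M : Finset α)
    (t : ℕ) (ht0 : 0 < t) (ht : t < M.card) (hM : 6 ≤ M.card) (G : Finset ι) (i j : ι → α)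
    (hi : ∀ κ ∈ G, i κ ∈ M) (hj : ∀ κ ∈ G, j κ ∈ M) (hij : ∀ κ κ', i κ ≠ j κ')
    (hii : Function.Injective i) (hjj : Function.Injective j) (hG : 2 * G.card ≤ M.card) (p : ℝ)
    (hp : p = t * (M.card - t) / (M.card * (M.card - 1))) :
    (((M.powersetCard t).filter fun X =>
      ((G.filter fun κ => i κ ∉ X ∧ j κ ∈ X).card : ℝ) < p * G.card / 2).card : ℝ)
      ≤ 8 / (p * G.card) * (M.powersetCard t).card := by
  have hM' : (6 : ℝ) ≤ M.card := by exact_mod_cast hM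
  have ht0' : (1 : ℝ) ≤ t := by exact_mod_cast ht0
  have ht' : (t : ℝ) + 1 ≤ M.card := by exact_mod_cast ht
  have hpp : p = pairProb M.card t false true := by
    rw [hp, pairProb]; simp [mul_comm]
  have hden : (0 : ℝ) < M.card * (M.card - 1) := by apply mul_pos <;> linarith
  refine card_few_events_le (M.powersetCard t) G (fun κ X => i κ ∉ X ∧ j κ ∈ X) p
    (4 / (M.card : ℝ) ^ 2) ?_ ?_ ?_ ?_ (by positivity) ?_
  · rw [hp]; apply div_pos _ hden; apply mul_pos <;> linarith
  · rw [hp, div_le_one hden]; nlinarith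
  · intro κ hκ
    have := card_pair_pattern M t ht.le (by omega) (i κ) (j κ) (hi κ hκ) (hj κ hκ) (hij κ κ)
      false true
    rw [hpp, ← this]
    simp
  · intro κ hκ κ' hκ' hne
    have := card_two_pair_pattern_le M t ht.le hM (i κ) (j κ) (i κ') (j κ') (hi κ hκ) (hj κ hκ)
      (hi κ' hκ') (hj κ' hκ') (hij _ _) (hij _ _) (hii.ne hne) (hjj.ne hne) (hij _ _) (hij _ _)
      false true
    rw [hpp]
    refine le_trans (le_of_eq ?_) this
    simp
  · have : (G.card : ℝ) ≤ M.card / 2 := by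
      have : (2 : ℝ) * G.card ≤ M.card := by exact_mod_cast hG
      linarith
    rw [div_mul_eq_mul_div, div_le_one (by positivity)]
    nlinarith

/-- A statistic valued in the `t`-subsets of `M` which is equivariant under the permutations of `M`
is uniformly distributed. -/
theorem card_equivariant_mul {Ω α : Type*} [Fintype α] [DecidableEq α] (S : Finset Ω)
    (Y : Ω → Finset α) (M : Finset α) (t : ℕ) (hY : ∀ ω ∈ S, Y ω ∈ M.powersetCard t)
    (act : Equiv.Perm α → Ω → Ω) (hinj : ∀ ρ, Function.Injective (act ρ))
    (hact : ∀ ρ : Equiv.Perm α, (∀ x, x ∉ M → ρ x = x) → ∀ ω ∈ S,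
      act ρ ω ∈ S ∧ Y (act ρ ω) = (Y ω).map ρ.toEmbedding)
    (Q : Finset α → Prop) [DecidablePred Q] :
    (S.filter fun ω => Q (Y ω)).card * (M.powersetCard t).card
      = S.card * ((M.powersetCard t).filter Q).card := by
  classical
  have hle : ∀ X ∈ M.powersetCard t, ∀ X' ∈ M.powersetCard t,
      (S.filter fun ω => Y ω = X).card ≤ (S.filter fun ω => Y ω = X').card := by
    intro X hX X' hX'
    obtain ⟨hXM, hXc⟩ := Finset.mem_powersetCard.1 hX
    obtain ⟨hXM', hXc'⟩ := Finset.mem_powersetCard.1 hX'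
    have hc : Fintype.card {m : M // (m : α) ∈ X} = Fintype.card {m : M // (m : α) ∈ X'} := by
      have : ∀ X ⊆ M, Fintype.card {m : M // (m : α) ∈ X} = X.card := by
        intro X hX
        rw [← Fintype.card_coe X]
        refine Fintype.card_congr ⟨fun m => ⟨m.1.1, m.2⟩, fun x => ⟨⟨x.1, hX x.2⟩, x.2⟩, ?_, ?_⟩
        · intro _; rfl
        · intro _; rfl
      rw [this X hXM, this X' hXM', hXc, hXc']
    -- Two subsets of `M` of equal size are related by a permutation of `M`, so by equivariance all
    -- fibres of `Y` have the same size.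
    let e : {m : M // (m : α) ∈ X} ≃ {m : M // (m : α) ∈ X'} := Fintype.equivOfCardEq hc
    let π : Equiv.Perm M := e.extendSubtype
    let ρ : Equiv.Perm α := Equiv.Perm.ofSubtype π
    have hρ : ∀ x, x ∉ M → ρ x = x := fun x hx => Equiv.Perm.ofSubtype_apply_of_not_mem π hx
    have hρX : X.map ρ.toEmbedding = X' := by
      refine Finset.eq_of_subset_of_card_le ?_ (by rw [Finset.card_map]; omega)
      intro x hx
      obtain ⟨x0, hx0, rfl⟩ := Finset.mem_map.1 hx
      have : ρ x0 = π ⟨x0, hXM hx0⟩ := Equiv.Perm.ofSubtype_apply_of_mem π (hXM hx0)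
      rw [Equiv.coe_toEmbedding, this]
      exact e.extendSubtype_mem ⟨x0, hXM hx0⟩ hx0
    refine Finset.card_le_card_of_injOn (act ρ) ?_ (hinj ρ).injOn
    intro ω hω
    obtain ⟨h1, h2⟩ := Finset.mem_filter.1 hω
    obtain ⟨h3, h4⟩ := hact ρ hρ ω h1
    exact Finset.mem_coe.2 (Finset.mem_filter.2 ⟨h3, by rw [h4, h2, hρX]⟩)
  rcases (M.powersetCard t).eq_empty_or_nonempty with hemp | ⟨X₀, hX₀⟩
  · have : S = ∅ := Finset.eq_empty_of_forall_notMem fun ω hω => by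
      have := hY ω hω; rw [hemp] at this; simp at this
    simp [hemp, this]
  have heq : ∀ X ∈ M.powersetCard t,
      (S.filter fun ω => Y ω = X).card = (S.filter fun ω => Y ω = X₀).card :=
    fun X hX => le_antisymm (hle X hX X₀ hX₀) (hle X₀ hX₀ X hX)
  have hS : S.card = (M.powersetCard t).card * (S.filter fun ω => Y ω = X₀).card := by
    rw [Finset.card_eq_sum_card_fiberwise (f := Y) (t := M.powersetCard t)
      (fun ω hω => hY ω hω), Finset.sum_congr rfl heq]; simp
  have hSQ : (S.filter fun ω => Q (Y ω)).card
      = ((M.powersetCard t).filter Q).card * (S.filter fun ω => Y ω = X₀).card := by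
    rw [Finset.card_eq_sum_card_fiberwise (f := Y) (t := (M.powersetCard t).filter Q)
      (fun ω hω => by
        have := Finset.mem_filter.1 (Finset.mem_coe.1 hω)
        exact Finset.mem_coe.2 (Finset.mem_filter.2 ⟨hY ω this.1, this.2⟩))]
    rw [Finset.sum_congr rfl (g := fun _ => (S.filter fun ω => Y ω = X₀).card)]
    · simp
    · intro X hX
      obtain ⟨h1, h2⟩ := Finset.mem_filter.1 hX
      rw [← heq X h1, Finset.filter_filter]
      congr 1
      refine Finset.filter_congr fun ω _ => ?_
      constructor
      · exact fun h => h.2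
      · exact fun h => ⟨h ▸ h2, h⟩
  rw [hS, hSQ]; ring

/-! ### Labels, block flips and their effect on the weight -/

/-- Coordinate labels: counted coordinates, their partners, and the remaining ones. -/
abbrev Lab (T Z : Type) : Type := (T × Bool) ⊕ ((T × Bool) ⊕ Z)

section Labels

variable {T Z C : Type}

/-- The number of ones among the counted coordinates. -/
def weight [Fintype T] (w : Lab T Z → Bool) : ℕ := ∑ j : T × Bool, (w (Sum.inl j)).toNat

/-- Assignments satisfying both the halfspace `weight + x_e ≤ θ` and the exclusive-or function
`weight + (x_c ⊕ x_d) ≤ θ`, with `x_e = x_c ⊕ x_d`. -/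
def coreSet (T : Type) {Z : Type} [Fintype T] [DecidableEq T] [Fintype Z] [DecidableEq Z]
    (θ : ℕ) (e c d : Z) : Finset (Lab T Z → Bool) :=
  Finset.univ.filter fun w => weight w + (w (Sum.inr (Sum.inr e))).toNat ≤ θ ∧
    w (Sum.inr (Sum.inr e)) = xor (w (Sum.inr (Sum.inr c))) (w (Sum.inr (Sum.inr d)))

/-- Exchange the counted coordinates in `F` with their partners. -/
def flipFun [DecidableEq T] (F : Finset (T × Bool)) : Lab T Z → Lab T Z
  | Sum.inl j => if j ∈ F then Sum.inr (Sum.inl j) else Sum.inl j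
  | Sum.inr (Sum.inl j) => if j ∈ F then Sum.inl j else Sum.inr (Sum.inl j)
  | Sum.inr (Sum.inr z) => Sum.inr (Sum.inr z)

theorem flipFun_involutive [DecidableEq T] (F : Finset (T × Bool)) :
    Function.Involutive (flipFun (Z := Z) F) := by
  rintro (j | j | z)
  · by_cases h : j ∈ F <;> simp [flipFun, h]
  · by_cases h : j ∈ F <;> simp [flipFun, h]
  · rfl

/-- `flipFun` as a permutation. -/
def flipPerm [DecidableEq T] (F : Finset (T × Bool)) : Equiv.Perm (Lab T Z) := (flipFun_involutive F).toPerm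

theorem flipPerm_apply [DecidableEq T] (F : Finset (T × Bool)) (i : Lab T Z) : flipPerm F i = flipFun F i := rfl

/-- The difference between partner and counted coordinates in block `κ`. -/
def blockDiff (E : Finset Bool) (w : Lab T Z → Bool) (κ : T) : ℤ :=
  ∑ x ∈ E, ((w (Sum.inr (Sum.inl (κ, x)))).toNat : ℤ) - ∑ x ∈ E, ((w (Sum.inl (κ, x))).toNat : ℤ)

/-- Blocks occupy disjoint coordinates, so the effects of their flips add. The set `E` selects which
of the two counted/partner pairs of a block are exchanged: `{false}` serves queries that split an
atom, `Finset.univ` those that break an additive relation. -/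
theorem weight_flip [Fintype T] [DecidableEq T] (E : Finset Bool) (F : Finset T) (w : Lab T Z → Bool) :
    (weight (fun i => w (flipPerm (F ×ˢ E) i)) : ℤ) = weight w + ∑ κ ∈ F, blockDiff E w κ := by
  have h1 : ∀ j : T × Bool, ((w (flipPerm (F ×ˢ E) (Sum.inl j))).toNat : ℤ)
      = (w (Sum.inl j)).toNat + if j ∈ F ×ˢ E then
        ((w (Sum.inr (Sum.inl j))).toNat : ℤ) - (w (Sum.inl j)).toNat else 0 := by
    intro j
    rw [flipPerm_apply]
    by_cases h : j ∈ F ×ˢ E <;> simp only [flipFun, h, if_true, if_false] <;> ring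
  unfold weight
  push_cast
  rw [Finset.sum_congr rfl fun j _ => h1 j, Finset.sum_add_distrib]
  congr 1
  rw [Finset.sum_ite_mem, Finset.univ_inter, Finset.sum_product]
  refine Finset.sum_congr rfl fun κ _ => ?_
  rw [blockDiff, Finset.sum_sub_distrib]

/-- Blocks that can be flipped without changing the weight of any sample, while changing the
weight of the query. -/
def active [Fintype T] {s : ℕ} (E : Finset Bool) (u : Fin s → C → Bool) (y : C → Bool) (σ : Lab T Z ≃ C) :
    Finset T :=
  Finset.univ.filter fun κ => (∀ t, blockDiff E (fun i => u t (σ i)) κ = 0) ∧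
    blockDiff E (fun i => y (σ i)) κ ≠ 0

theorem mem_active [Fintype T] {s : ℕ} (E : Finset Bool) (u : Fin s → C → Bool) (y : C → Bool)
    (σ : Lab T Z ≃ C) (κ : T) : κ ∈ active E u y σ ↔
      (∀ t, blockDiff E (fun i => u t (σ i)) κ = 0) ∧ blockDiff E (fun i => y (σ i)) κ ≠ 0 := by
  simp [active]

/-- Labellings compatible with the samples `u`. -/
def compat [Fintype T] [DecidableEq T] [Fintype Z] [DecidableEq Z] [Fintype C]
    [DecidableEq C] {s : ℕ} (V : Finset (Lab T Z → Bool)) (u : Fin s → C → Bool) : Finset (Lab T Z ≃ C) :=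
  Finset.univ.filter fun σ => ∀ t, (fun i => u t (σ i)) ∈ V

/-- A flip only changes signs, so it preserves which blocks are active; this makes the flips of
active blocks commuting involutions on the compatible labellings. -/
theorem blockDiff_flip [DecidableEq T] (E : Finset Bool) (F : Finset T) (w : Lab T Z → Bool) (κ : T) :
    blockDiff E (fun i => w (flipPerm (F ×ˢ E) i)) κ
      = if κ ∈ F then - blockDiff E w κ else blockDiff E w κ := by
  simp only [blockDiff, flipPerm_apply, flipFun, Finset.mem_product]
  by_cases h : κ ∈ F
  · simp only [h, true_and, if_true]
    have h1 : ∑ x ∈ E, ((w (if x ∈ E then Sum.inl (κ, x) else Sum.inr (Sum.inl (κ, x)))).toNat : ℤ)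
        = ∑ x ∈ E, ((w (Sum.inl (κ, x))).toNat : ℤ) :=
      Finset.sum_congr rfl fun x hx => by rw [if_pos hx]
    have h2 : ∑ x ∈ E, ((w (if x ∈ E then Sum.inr (Sum.inl (κ, x)) else Sum.inl (κ, x))).toNat : ℤ)
        = ∑ x ∈ E, ((w (Sum.inr (Sum.inl (κ, x)))).toNat : ℤ) :=
      Finset.sum_congr rfl fun x hx => by rw [if_pos hx]
    rw [h1, h2]
    ring
  · simp [h]

/-- The query hits the threshold weight rarely when there are many active blocks. -/
theorem card_active_weight_eq_le [Fintype T] [DecidableEq T] [Fintype Z] [DecidableEq Z]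
    [Fintype C] [DecidableEq C] {s : ℕ} (θ : ℕ) (e c d : Z) (E : Finset Bool)
    (u : Fin s → C → Bool) (y : C → Bool) (N : ℝ) (hN : 0 < N) :
    (((compat (coreSet T θ e c d) u).filter fun σ => N ≤ (active E u y σ).card ∧
      weight (fun i => y (σ i)) = θ).card : ℝ) ≤ (compat (coreSet T θ e c d) u).card / √N := by
  have := card_flip_le (compat (coreSet T θ e c d) u) (active E u y)
    (fun F σ => (flipPerm (F ×ˢ E)).trans σ) (fun σ => (weight (fun i => y (σ i)) : ℤ))
    (fun σ => blockDiff E (fun i => y (σ i))) ?_ ?_ ?_ ?_ ?_ θ N hN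
  · simpa using this
  · intro σ hσ F hF
    simp only [compat, coreSet, Finset.mem_filter, Finset.mem_univ, true_and] at hσ ⊢
    intro t
    have hw := weight_flip E F (fun i => u t (σ i))
    rw [Finset.sum_eq_zero (fun κ hκ => (Finset.mem_filter.1 (hF hκ)).2.1 t), add_zero] at hw
    have hw' : weight (fun i => u t (((flipPerm (F ×ˢ E)).trans σ) i))
      = weight (fun i => u t (σ i)) := by exact_mod_cast hw
    rw [hw']
    exact hσ t
  · intro σ hσ F hF
    ext i
    simp [flipPerm_apply, flipFun_involutive _ _]
  · intro σ hσ F hF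
    ext κ
    rw [mem_active, mem_active]
    simp only [Equiv.trans_apply]
    have h1 := fun t => blockDiff_flip E F (fun i => u t (σ i)) κ
    have h2 := blockDiff_flip E F (fun i => y (σ i)) κ
    simp only [h1, h2]
    split_ifs <;> simp
  · intro σ hσ F hF
    exact weight_flip E F (fun i => y (σ i))
  · intro σ hσ κ hκ
    exact (Finset.mem_filter.1 hκ).2.2

end Labels

/-! ### The posterior of the labelling given the samples -/

section Posterior

variable {T Z C : Type} [Fintype T] [DecidableEq T] [Fintype Z] [DecidableEq Z] [Fintype C]
  [DecidableEq C] {s : ℕ}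

/-- The blocks whose four coordinates have the prescribed sample columns. -/
def blocksWith {Z : Type} (v : Fin s → Lab T Z → Bool) (b₀ b₁ b₂ b₃ : Fin s → Bool) : Finset T :=
  Finset.univ.filter fun κ => ∀ t, (v t (Sum.inl (κ, false)) = b₀ t ∧
    v t (Sum.inl (κ, true)) = b₂ t) ∧ (v t (Sum.inr (Sum.inl (κ, false))) = b₁ t ∧
    v t (Sum.inr (Sum.inl (κ, true))) = b₃ t)

/-- Every column pattern occurs in at least `Γ` blocks. -/
def IsRich {Z : Type} (Γ : ℝ) (v : Fin s → Lab T Z → Bool) : Prop :=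
  ∀ b₀ b₁ b₂ b₃, Γ ≤ (blocksWith v b₀ b₁ b₂ b₃).card

/-- Labellings under which the samples `u` read as `v`. -/
def labellings (u : Fin s → C → Bool) (v : Fin s → Lab T Z → Bool) : Finset (Lab T Z ≃ C) :=
  Finset.univ.filter fun σ => ∀ t i, u t (σ i) = v t i

/-- The compatible labellings are partitioned by the pattern `v` that the samples show through them,
each class being all of `labellings u v`. A bound that holds in each relevant class therefore adds
up. -/
theorem card_filter_le_of_labellings (V : Finset (Lab T Z → Bool)) (u : Fin s → C → Bool)
    (R : (Lab T Z ≃ C) → Prop) [DecidablePred R] (G : (Fin s → Lab T Z → Bool) → Prop) (δ : ℝ)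
    (hδ : 0 ≤ δ)
    (hv : ∀ v, G v → (((labellings u v).filter R).card : ℝ) ≤ δ * (labellings u v).card)
    (hR : ∀ σ ∈ compat V u, R σ → G fun t i => u t (σ i)) :
    (((compat V u).filter R).card : ℝ) ≤ δ * (compat V u).card := by
  classical
  set f : (Lab T Z ≃ C) → (Fin s → Lab T Z → Bool) := fun σ t i => u t (σ i) with hf
  rw [Finset.card_eq_sum_card_fiberwise (f := f) (s := (compat V u).filter R) (t := Finset.univ)
    (fun _ _ => by simp), Finset.card_eq_sum_card_fiberwise (f := f) (s := compat V u)
    (t := Finset.univ) (fun _ _ => by simp)]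
  push_cast
  rw [Finset.mul_sum]
  refine Finset.sum_le_sum fun v _ => ?_
  by_cases hemp : (((compat V u).filter R).filter fun σ => f σ = v) = ∅
  · rw [hemp]; simp; positivity
  obtain ⟨σ₀, hσ₀⟩ := Finset.nonempty_iff_ne_empty.2 hemp
  simp only [Finset.mem_filter] at hσ₀
  obtain ⟨⟨h1, h2⟩, h3⟩ := hσ₀
  have hG : G v := h3 ▸ hR σ₀ h1 h2
  have hlab : ∀ σ, f σ = v ↔ σ ∈ labellings u v := by
    intro σ
    simp only [labellings, Finset.mem_filter, Finset.mem_univ, true_and, hf]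
    exact ⟨fun h t i => congrFun (congrFun h t) i, fun h => funext fun t => funext fun i => h t i⟩
  have hmem : ∀ σ, f σ = v → σ ∈ compat V u := by
    intro σ hσ
    simp only [compat, Finset.mem_filter, Finset.mem_univ, true_and] at h1 ⊢
    intro t
    have := h1 t
    have e : f σ t = f σ₀ t := by rw [hσ, h3]
    rw [hf] at e
    simp only at e
    rwa [e]
  have e1 : ((compat V u).filter R).filter (fun σ => f σ = v) = (labellings u v).filter R := by
    ext σ
    simp only [Finset.mem_filter, ← hlab]
    exact ⟨fun h => ⟨h.2, h.1.2⟩, fun h => ⟨⟨hmem σ h.1, h.2⟩, h.1⟩⟩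
  have e2 : (compat V u).filter (fun σ => f σ = v) = labellings u v := by
    ext σ
    simp only [Finset.mem_filter, ← hlab]
    exact ⟨fun h => h.2, fun h => ⟨hmem σ h, h⟩⟩
  rw [e1, e2]
  exact hv v hG

/-- The coordinates whose sample column is `b`. -/
def atom (u : Fin s → C → Bool) (b : Fin s → Bool) : Finset C :=
  Finset.univ.filter fun x => ∀ t, u t x = b t

/-- A labelling in `labellings u v` carries each atom of `v` bijectively onto the atom of `u` with
the same column. -/
theorem card_atom_of_labellings (u : Fin s → C → Bool) (v : Fin s → Lab T Z → Bool)
    (σ : Lab T Z ≃ C) (hσ : σ ∈ labellings u v) (b : Fin s → Bool) (Q : C → Prop)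
    [DecidablePred Q] :
    ((atom v b).filter fun i => Q (σ i)).card = ((atom u b).filter Q).card := by
  have hσ' : ∀ t i, u t (σ i) = v t i := (Finset.mem_filter.1 hσ).2
  rw [← Finset.card_map σ.toEmbedding]
  congr 1
  ext x
  simp only [atom, Finset.mem_map, Finset.mem_filter, Finset.mem_univ, true_and,
    Equiv.coe_toEmbedding]
  constructor
  · rintro ⟨i, ⟨h1, h2⟩, rfl⟩
    exact ⟨fun t => by rw [hσ', h1], h2⟩
  · rintro ⟨h1, h2⟩
    refine ⟨σ.symm x, ⟨fun t => ?_, by simpa using h2⟩, by simp⟩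
    rw [← hσ', Equiv.apply_symm_apply, h1]

omit [DecidableEq T] [DecidableEq Z] in
theorem le_card_atom {Γ : ℝ} {v : Fin s → Lab T Z → Bool} (hv : IsRich Γ v) (b : Fin s → Bool) :
    Γ ≤ (atom v b).card := by
  refine (hv b b b b).trans ?_
  norm_cast
  refine Finset.card_le_card_of_injOn (fun κ => Sum.inl (κ, false)) ?_ ?_
  · intro κ hκ
    have := (Finset.mem_filter.1 (Finset.mem_coe.1 hκ)).2
    exact Finset.mem_coe.2 (Finset.mem_filter.2 ⟨Finset.mem_univ _, fun t => (this t).1.1⟩)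
  · intro κ _ κ' _ h
    simpa using h

/-- A given label rarely falls into a small set of exceptional coordinates. -/
theorem card_label_mem_le {Γ P : ℝ} (hΓ : 0 < Γ) (u : Fin s → C → Bool)
    (v : Fin s → Lab T Z → Bool) (hv : IsRich Γ v) (X : Finset C)
    (hX : ∀ b, (((atom u b).filter (· ∈ X)).card : ℝ) ≤ P) (z : Lab T Z) :
    (((labellings u v).filter fun σ => σ z ∈ X).card : ℝ) ≤ P / Γ * (labellings u v).card := by
  set b : Fin s → Bool := fun t => v t z with hb
  set M := atom v b with hM
  -- Swapping `z` with a label of the same column preserves `labellings u v`, so `z` is no likelier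
  -- to land in `X` than an average label of its atom.
  have hconst : ∀ i ∈ M, ((labellings u v).filter fun σ => σ z ∈ X).card
      ≤ ((labellings u v).filter fun σ => σ i ∈ X).card := by
    intro i hi
    have hi' : ∀ t, v t i = v t z := (Finset.mem_filter.1 hi).2
    refine Finset.card_le_card_of_injOn (fun σ => (Equiv.swap z i).trans σ) ?_ ?_
    · intro σ hσ
      simp only [labellings, Finset.coe_filter, Set.mem_ofPred_eq, Finset.mem_univ,
        true_and, Finset.mem_filter] at hσ ⊢
      refine ⟨fun t j => ?_, by simpa using hσ.2⟩
      rw [Equiv.trans_apply, hσ.1]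
      rcases eq_or_ne j z with rfl | h1
      · rw [Equiv.swap_apply_left, hi']
      rcases eq_or_ne j i with rfl | h2
      · rw [Equiv.swap_apply_right, hi']
      rw [Equiv.swap_apply_of_ne_of_ne h1 h2]
    · intro σ _ σ' _ h
      ext j
      have := congrArg (fun e => e ((Equiv.swap z i) j)) h
      simpa using this
  have hsum : ∑ i ∈ M, (((labellings u v).filter fun σ => σ i ∈ X).card : ℝ)
      ≤ P * (labellings u v).card := by
    have : ∑ i ∈ M, (((labellings u v).filter fun σ => σ i ∈ X).card : ℝ)
        = ∑ σ ∈ labellings u v, ((M.filter fun i => σ i ∈ X).card : ℝ) := by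
      simp only [Finset.card_filter]
      push_cast
      exact Finset.sum_comm
    rw [this]
    calc _ ≤ ∑ σ ∈ labellings u v, P := by
          refine Finset.sum_le_sum fun σ hσ => ?_
          rw [hM, card_atom_of_labellings u v σ hσ b (· ∈ X)]
          exact hX b
      _ = _ := by simp; ring
  have h2 : (M.card : ℝ) * ((labellings u v).filter fun σ => σ z ∈ X).card
      ≤ P * (labellings u v).card := by
    refine le_trans ?_ hsum
    rw [← nsmul_eq_mul, ← Finset.sum_const]
    exact Finset.sum_le_sum fun i hi => by exact_mod_cast hconst i hi
  have h3 : Γ ≤ M.card := le_card_atom hv b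
  rw [div_mul_eq_mul_div, le_div_iff₀ hΓ]
  calc _ ≤ (((labellings u v).filter fun σ => σ z ∈ X).card : ℝ) * M.card := by gcongr
    _ ≤ _ := by linarith

/-- If a query splits an atom, then there are usually many active blocks. -/
theorem card_few_active_le {Γ P N : ℝ} (hΓ : 6 ≤ Γ) (hP : 0 < P) (u : Fin s → C → Bool)
    (y : C → Bool) (b : Fin s → Bool) (h1 : P ≤ (((atom u b).filter fun x => y x = true).card : ℝ))
    (h0 : P ≤ (((atom u b).filter fun x => y x = false).card : ℝ))
    (hN : N ≤ Γ * P / (4 * Fintype.card C)) (v : Fin s → Lab T Z → Bool) (hv : IsRich Γ v) :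
    (((labellings u v).filter fun σ => ((active {false} u y σ).card : ℝ) < N).card : ℝ)
      ≤ 16 * Fintype.card C / (P * Γ) * (labellings u v).card := by
  classical
  rcases (labellings u v).eq_empty_or_nonempty with hemp | ⟨σ₀, hσ₀⟩
  · simp [hemp]
  set M := atom v b with hM
  set t := ((atom u b).filter fun x => y x = true).card with ht
  -- `Y σ` is where the query is one inside the atom. Permuting the atom preserves the posterior, so
  -- `Y` is a uniform `t`-subset. A block of `G` is active as soon as its counted label avoids `Y`
  -- and its partner lies in it.
  set Y : (Lab T Z ≃ C) → Finset (Lab T Z) := fun σ => M.filter fun i => y (σ i) = true with hY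
  have hYm : ∀ σ i, i ∈ Y σ ↔ i ∈ M ∧ y (σ i) = true := fun σ i => Finset.mem_filter
  set G := blocksWith v b b b b with hG
  have hYc : ∀ σ ∈ labellings u v, Y σ ∈ M.powersetCard t := by
    intro σ hσ
    rw [Finset.mem_powersetCard]
    exact ⟨Finset.filter_subset _ _, card_atom_of_labellings u v σ hσ b (fun x => y x = true)⟩
  have hMt : M.card = t + ((atom u b).filter fun x => y x = false).card := by
    have e1 := card_atom_of_labellings u v σ₀ hσ₀ b (fun x => y x = true)
    have e2 := card_atom_of_labellings u v σ₀ hσ₀ b (fun x => y x = false)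
    rw [ht, ← e1, ← e2, ← Finset.card_filter_add_card_filter_not (s := M)
      (fun i => y (σ₀ i) = true)]
    simp [hM]
  have hMr : (M.card : ℝ) = t + ((atom u b).filter fun x => y x = false).card := by
    exact_mod_cast hMt
  set t0 := ((atom u b).filter fun x => y x = false).card
  have htpos : 0 < t := by
    have : (0 : ℝ) < t := hP.trans_le h1
    exact_mod_cast this
  have ht0pos : 0 < t0 := by
    have : (0 : ℝ) < t0 := hP.trans_le h0
    exact_mod_cast this
  have hMΓ : Γ ≤ M.card := le_card_atom hv b
  have hM6 : 6 ≤ M.card := by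
    have : (6 : ℝ) ≤ M.card := hΓ.trans hMΓ
    exact_mod_cast this
  have hMC : (M.card : ℝ) ≤ Fintype.card C := by
    have : M.card ≤ Fintype.card (Lab T Z) := Finset.card_le_univ M
    rw [Fintype.card_congr σ₀] at this
    exact_mod_cast this
  have hGmem : ∀ κ ∈ G, ∀ t, (v t (Sum.inl (κ, false)) = b t ∧ v t (Sum.inl (κ, true)) = b t) ∧
      (v t (Sum.inr (Sum.inl (κ, false))) = b t ∧ v t (Sum.inr (Sum.inl (κ, true))) = b t) :=
    fun κ hκ => (Finset.mem_filter.1 hκ).2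
  have hi : ∀ κ ∈ G, (Sum.inl (κ, false) : Lab T Z) ∈ M := fun κ hκ =>
    Finset.mem_filter.2 ⟨Finset.mem_univ _, fun t => (hGmem κ hκ t).1.1⟩
  have hj : ∀ κ ∈ G, (Sum.inr (Sum.inl (κ, false)) : Lab T Z) ∈ M := fun κ hκ =>
    Finset.mem_filter.2 ⟨Finset.mem_univ _, fun t => (hGmem κ hκ t).2.1⟩
  have hii : Function.Injective fun κ : T => (Sum.inl (κ, false) : Lab T Z) := by
    intro κ κ' h; simpa using h
  have hjj : Function.Injective fun κ : T => (Sum.inr (Sum.inl (κ, false)) : Lab T Z) := by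
    intro κ κ' h; simpa using h
  have h2G : 2 * G.card ≤ M.card := by
    have hd : Disjoint (G.map ⟨_, hii⟩) (G.map ⟨_, hjj⟩) := by
      rw [Finset.disjoint_left]
      intro x hx hx'
      obtain ⟨κ, _, rfl⟩ := Finset.mem_map.1 hx
      obtain ⟨κ', _, h⟩ := Finset.mem_map.1 hx'
      simp at h
    have := Finset.card_le_card (s := (G.map ⟨_, hii⟩) ∪ (G.map ⟨_, hjj⟩)) (t := M) ?_
    · rw [Finset.card_union_of_disjoint hd, Finset.card_map, Finset.card_map] at this
      omega
    · intro x hx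
      rcases Finset.mem_union.1 hx with hx | hx
      · obtain ⟨κ, hκ, rfl⟩ := Finset.mem_map.1 hx
        exact hi κ hκ
      · obtain ⟨κ, hκ, rfl⟩ := Finset.mem_map.1 hx
        exact hj κ hκ
  have htM : t < M.card := by omega
  set p : ℝ := t * (M.card - t) / (M.card * (M.card - 1)) with hp
  have hGΓ : Γ ≤ G.card := hv b b b b
  have hM6' : (6 : ℝ) ≤ M.card := by exact_mod_cast hM6
  have hpP : P / (2 * Fintype.card C) ≤ p := by
    have e : (M.card : ℝ) - t = t0 := by rw [hMr]; ring
    -- Both parts of the atom have at least `P` elements and the larger one has at least half of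
    -- `M`.
    have hprod : P * M.card / 2 ≤ (t : ℝ) * t0 := by
      rw [hMr]
      rcases le_total (t : ℝ) t0 with h | h <;> nlinarith
    rw [hp, e]
    calc P / (2 * Fintype.card C) ≤ P / (2 * M.card) := by gcongr
      _ = (P * M.card / 2) / (M.card * M.card) := by field_simp
      _ ≤ (t * t0) / (M.card * M.card) := by gcongr
      _ ≤ _ := by
          apply div_le_div_of_nonneg_left (by positivity)
          · apply mul_pos <;> linarith
          · apply mul_le_mul_of_nonneg_left <;> linarith
  have hCpos : (0 : ℝ) < Fintype.card C := by linarith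
  have hppos : 0 < p := lt_of_lt_of_le (by positivity) hpP
  have hpG : P * Γ / (2 * Fintype.card C) ≤ p * G.card := by
    calc _ = P / (2 * Fintype.card C) * Γ := by ring
      _ ≤ _ := by gcongr
  have hcheb := card_few_separated_pairs_le M t htpos htM hM6 G
    (fun κ => (Sum.inl (κ, false) : Lab T Z)) (fun κ => Sum.inr (Sum.inl (κ, false)))
    hi hj (by simp) hii hjj h2G p hp
  have hequi := card_equivariant_mul (labellings u v) Y M t hYc (fun ρ σ => ρ.symm.trans σ)
    (fun ρ σ σ' h => by
      ext j
      have := congrArg (fun e => e (ρ j)) h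
      simpa using this)
    (fun ρ hρ σ hσ => by
      have hσ' : ∀ t i, u t (σ i) = v t i := (Finset.mem_filter.1 hσ).2
      have hρM : ∀ i ∈ M, ρ.symm i ∈ M := by
        intro i hi
        by_contra hc
        have := hρ _ hc
        rw [Equiv.apply_symm_apply] at this
        exact hc (this ▸ hi)
      have hρM' : ∀ i ∈ M, ρ i ∈ M := by
        intro i hi
        by_contra hc
        have h := hρ _ hc
        exact hc ((ρ.injective h).symm ▸ hi)
      have hρ' : ∀ i, i ∉ M → ρ.symm i = i := by
        intro i hi
        rw [Equiv.symm_apply_eq]; exact (hρ i hi).symm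
      constructor
      · refine Finset.mem_filter.2 ⟨Finset.mem_univ _, fun t i => ?_⟩
        rw [Equiv.trans_apply, hσ']
        by_cases hiM : i ∈ M
        · rw [(Finset.mem_filter.1 hiM).2 t, (Finset.mem_filter.1 (hρM i hiM)).2 t]
        · rw [hρ' i hiM]
      · ext i
        rw [Finset.mem_map, hYm]
        constructor
        · rintro ⟨a1, a2⟩
          exact ⟨ρ.symm i, (hYm _ _).2 ⟨hρM i a1, a2⟩, by simp⟩
        · rintro ⟨j, hj', rfl⟩
          obtain ⟨a1, a2⟩ := (hYm _ _).1 hj'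
          exact ⟨hρM' j a1, by simpa using a2⟩)
    (fun X => ((G.filter fun κ => (Sum.inl (κ, false) : Lab T Z) ∉ X ∧
      (Sum.inr (Sum.inl (κ, false)) : Lab T Z) ∈ X).card : ℝ) < p * G.card / 2)
  have hpc : (0 : ℝ) < (M.powersetCard t).card := by
    rw [Finset.card_powersetCard]
    exact_mod_cast Nat.choose_pos htM.le
  have hfin : (((labellings u v).filter fun σ =>
      ((G.filter fun κ => (Sum.inl (κ, false) : Lab T Z) ∉ Y σ ∧
      (Sum.inr (Sum.inl (κ, false)) : Lab T Z) ∈ Y σ).card : ℝ) < p * G.card / 2).card : ℝ)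
      ≤ 8 / (p * G.card) * (labellings u v).card := by
    have hequi' := congrArg (fun n : ℕ => (n : ℝ)) hequi
    simp only [Nat.cast_mul] at hequi'
    refine le_of_mul_le_mul_right ?_ hpc
    rw [hequi']
    calc _ ≤ ((labellings u v).card : ℝ) * (8 / (p * G.card) * (M.powersetCard t).card) := by
          gcongr
      _ = _ := by ring
  calc _ ≤ (((labellings u v).filter fun σ =>
      ((G.filter fun κ => (Sum.inl (κ, false) : Lab T Z) ∉ Y σ ∧
      (Sum.inr (Sum.inl (κ, false)) : Lab T Z) ∈ Y σ).card : ℝ) < p * G.card / 2).card : ℝ) := by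
        norm_cast
        refine Finset.card_le_card fun σ hσ => ?_
        obtain ⟨a1, a2⟩ := Finset.mem_filter.1 hσ
        refine Finset.mem_filter.2 ⟨a1, lt_of_le_of_lt ?_ (a2.trans_le ?_)⟩
        · norm_cast
          refine Finset.card_le_card fun κ hκ => ?_
          obtain ⟨b1, b2, b3⟩ := Finset.mem_filter.1 hκ
          have hσ' : ∀ t i, u t (σ i) = v t i := (Finset.mem_filter.1 a1).2
          have c1 : y (σ (Sum.inl (κ, false))) ≠ true := fun h =>
            b2 (Finset.mem_filter.2 ⟨hi κ b1, h⟩)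
          have c2 := (Finset.mem_filter.1 b3).2
          rw [mem_active]
          refine ⟨fun t => ?_, ?_⟩
          · simp [blockDiff, hσ', hGmem κ b1 t]
          · simp [blockDiff, c2, c1]
        · refine hN.trans ?_
          calc _ = P * Γ / (2 * Fintype.card C) / 2 := by ring
            _ ≤ _ := by gcongr
    _ ≤ 8 / (p * G.card) * (labellings u v).card := hfin
    _ ≤ _ := by
        refine mul_le_mul_of_nonneg_right ?_ (Nat.cast_nonneg _)
        calc 8 / (p * G.card) ≤ 8 / (P * Γ / (2 * Fintype.card C)) := by gcongr
          _ = _ := by field_simp; norm_num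

end Posterior

/-! ### Boolean functions that respect integer additive relations -/

section Affine

variable {s : ℕ}

/-- `g` respects all additive relations `b₁ + b₄ = b₂ + b₃` between Boolean vectors. -/
def RespectsSums (g : (Fin s → Bool) → Bool) : Prop :=
  ∀ b₁ b₂ b₃ b₄ : Fin s → Bool,
    (∀ t, (b₁ t).toNat + (b₄ t).toNat = (b₂ t).toNat + (b₃ t).toNat) →
    (g b₁).toNat + (g b₄).toNat = (g b₂).toNat + (g b₃).toNat

/-- As integer vectors, `b + b' = (b ∨ b') + (b ∧ b')` and `b ∨ b' = (b ⊕ b') + (b ∧ b')`. These two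
relations determine `g (b ⊕ b')`. -/
theorem RespectsSums.map_xor {g : (Fin s → Bool) → Bool} (hg : RespectsSums g)
    (h0 : g (fun _ => false) = false) (b b' : Fin s → Bool) :
    g (fun t => xor (b t) (b' t)) = xor (g b) (g b') := by
  have h1 := hg b (fun t => b t || b' t) (fun t => b t && b' t) b'
    (fun t => by cases b t <;> cases b' t <;> rfl)
  have h2 := hg (fun t => b t || b' t) (fun t => xor (b t) (b' t)) (fun t => b t && b' t)
    (fun _ => false) (fun t => by cases b t <;> cases b' t <;> rfl)
  rw [h0] at h2
  revert h1 h2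
  cases g b <;> cases g b' <;> cases g (fun t => b t || b' t) <;> cases g (fun t => b t && b' t) <;>
    cases g (fun t => xor (b t) (b' t)) <;> decide

/-- Split a unit vector `1_t` off a minimal zero of `g`: minimality forces `g 1_t = 0`. If `g c = 0`
with `c t = 0`, the relation `c + 1_t = (c ∨ 1_t) + 0` would read `0 + 0 = g (c ∨ 1_t) + 1`. -/
theorem RespectsSums.exists_coord {g : (Fin s → Bool) → Bool} (hg : RespectsSums g)
    (h0 : g (fun _ => false) = true) :
    (∀ b, g b = true) ∨ ∃ t, ∀ b, g b = false → b t = true := by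
  by_cases hall : ∀ b, g b = true
  · exact Or.inl hall
  right
  push Not at hall
  obtain ⟨b₀, hb₀⟩ := hall
  obtain ⟨b, hb, hmin⟩ := Finset.exists_min_image
    (Finset.univ.filter fun b : Fin s → Bool => g b = false)
    (fun b => (Finset.univ.filter fun t => b t = true).card) ⟨b₀, by simpa using hb₀⟩
  have hbf : g b = false := (Finset.mem_filter.1 hb).2
  have hne : ∃ t, b t = true := by
    by_contra hcon
    push Not at hcon
    have : b = fun _ => false := funext fun t => by simpa using hcon t
    rw [this, h0] at hbf
    exact absurd hbf (by decide)
  obtain ⟨t, ht⟩ := hne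
  have h1 := hg b (fun r => decide (r = t)) (fun r => b r && !decide (r = t)) (fun _ => false)
    (fun r => by
      by_cases h : r = t
      · subst h; simp [ht]
      · simp [h])
  have hb' : g (fun r => b r && !decide (r = t)) = true := by
    by_contra hcon
    have hcon' : g (fun r => b r && !decide (r = t)) = false := by simpa using hcon
    have := hmin _ (Finset.mem_filter.2 ⟨Finset.mem_univ _, hcon'⟩)
    refine absurd this (not_le.2 (Finset.card_lt_card ?_))
    rw [Finset.ssubset_iff_of_subset]
    · exact ⟨t, by simp [ht], by simp⟩
    · intro r hr
      simp only [Finset.mem_filter, Finset.mem_univ, true_and, Bool.and_eq_true] at hr ⊢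
      exact hr.1
  rw [hbf, h0, hb'] at h1
  have het : g (fun r => decide (r = t)) = false := by
    revert h1; cases g (fun r => decide (r = t)) <;> simp
  refine ⟨t, fun c hc => ?_⟩
  by_contra hct
  have hct' : c t = false := by simpa using hct
  have h2 := hg c (fun r => c r || decide (r = t)) (fun _ => false) (fun r => decide (r = t))
    (fun r => by
      by_cases h : r = t
      · subst h; simp [hct']
      · simp [h])
  rw [hc, het, h0] at h2
  simp at h2

end Affine

/-! ### Bad labellings are rare for every query -/

section Bad

variable {T Z C : Type} [Fintype T] [DecidableEq T] [Fintype Z] [DecidableEq Z] [Fintype C]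
  [DecidableEq C] {s : ℕ}

/-- Under `σ`, the query `y` has threshold weight and violates `x_e = x_c ⊕ x_d`. -/
def IsBad (θ : ℕ) (e c d : Z) (y : C → Bool) (σ : Lab T Z ≃ C) : Prop :=
  weight (fun i => y (σ i)) = θ ∧ y (σ (Sum.inr (Sum.inr e))) ≠
    xor (y (σ (Sum.inr (Sum.inr c)))) (y (σ (Sum.inr (Sum.inr d))))

theorem card_le_of_atoms {P : ℝ} (u : Fin s → C → Bool) (X : Finset C)
    (hX : ∀ b, (((atom u b).filter (· ∈ X)).card : ℝ) ≤ P) : (X.card : ℝ) ≤ 2 ^ s * P := by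
  rw [Finset.card_eq_sum_card_fiberwise (f := fun x => fun t => u t x) (t := Finset.univ)
    (fun _ _ => by simp)]
  push_cast
  calc _ ≤ ∑ b : Fin s → Bool, P := by
        refine Finset.sum_le_sum fun b _ => le_trans ?_ (hX b)
        norm_cast
        refine Finset.card_le_card fun x hx => ?_
        obtain ⟨h1, h2⟩ := Finset.mem_filter.1 hx
        exact Finset.mem_filter.2 ⟨Finset.mem_filter.2 ⟨Finset.mem_univ _,
          fun t => congrFun h2 t⟩, h1⟩
    _ = _ := by simp

/-- Apart from the exceptional set, at most `2^s P` coordinates, `y` vanishes at a counted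
coordinate only where one fixed sample is one. That sample lies in the core, so this happens at most
`θ` times; the remaining counted coordinates are ones of `y`, and there are more than `θ` of them.
-/
theorem lt_weight_of_respectsSums {θ : ℕ} {e c d : Z} {P : ℝ} (u : Fin s → C → Bool)
    (y : C → Bool) (g : (Fin s → Bool) → Bool) (hg : RespectsSums g)
    (h0 : g (fun _ => false) = true) (X : Finset C)
    (hXg : ∀ x, x ∉ X → y x = g (fun t => u t x))
    (hX : ∀ b, (((atom u b).filter (· ∈ X)).card : ℝ) ≤ P)
    (hθ : 2 ^ s * P + 2 * θ < 2 * Fintype.card T) (σ : Lab T Z ≃ C)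
    (hσ : σ ∈ compat (coreSet T θ e c d) u) : θ < weight (fun i => y (σ i)) := by
  have hXc := card_le_of_atoms u X hX
  set J := (Finset.univ : Finset (T × Bool)) with hJ
  set A := J.filter fun j => g (fun t => u t (σ (Sum.inl j))) = false with hA
  set B := J.filter fun j => σ (Sum.inl j) ∈ X with hB
  set D := J.filter fun j => y (σ (Sum.inl j)) = true with hD
  have hAθ : A.card ≤ θ := by
    rcases hg.exists_coord h0 with hall | ⟨t, ht⟩
    · rw [hA, Finset.filter_false_of_mem (fun j _ => by simp [hall])]; simp
    · have hσt := (Finset.mem_filter.1 hσ).2 t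
      have h1 := (Finset.mem_filter.1 hσt).2.1
      refine le_trans ?_ ((Nat.le_add_right _ _).trans h1)
      rw [weight]
      have : ∀ j : T × Bool, (u t (σ (Sum.inl j))).toNat
          = if u t (σ (Sum.inl j)) = true then 1 else 0 := by
        intro j; cases u t (σ (Sum.inl j)) <;> rfl
      simp_rw [this]
      rw [← Finset.card_filter]
      refine Finset.card_le_card fun j hj => ?_
      obtain ⟨_, h2⟩ := Finset.mem_filter.1 hj
      exact Finset.mem_filter.2 ⟨Finset.mem_univ _, ht _ h2⟩
  have hBX : B.card ≤ X.card := by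
    refine Finset.card_le_card_of_injOn (fun j => σ (Sum.inl j)) ?_ ?_
    · intro j hj
      exact (Finset.mem_filter.1 (Finset.mem_coe.1 hj)).2
    · intro j _ j' _ h
      simpa using h
  have hcov : J ⊆ A ∪ B ∪ D := by
    intro j hj
    by_cases h1 : σ (Sum.inl j) ∈ X
    · simp [hB, hj, h1]
    · have h2 := hXg _ h1
      cases h3 : g (fun t => u t (σ (Sum.inl j)))
      · simp [hA, hj, h3]
      · simp [hD, hj, h2, h3]
  have hcard : J.card ≤ A.card + B.card + D.card :=
    (Finset.card_le_card hcov).trans ((Finset.card_union_le _ _).trans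
      (Nat.add_le_add_right (Finset.card_union_le _ _) _))
  have hJc : J.card = 2 * Fintype.card T := by
    rw [hJ, Finset.card_univ, Fintype.card_prod, Fintype.card_bool, mul_comm]
  have hDw : D.card = weight (fun i => y (σ i)) := by
    rw [hD, Finset.card_filter, weight]
    refine Finset.sum_congr rfl fun j _ => ?_
    cases y (σ (Sum.inl j)) <;> rfl
  rw [hJc, hDw] at hcard
  have hcard' : (2 : ℝ) * Fintype.card T ≤ A.card + B.card + weight (fun i => y (σ i)) := by
    exact_mod_cast hcard
  have h1 : (A.card : ℝ) ≤ θ := by exact_mod_cast hAθ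
  have h2 : (B.card : ℝ) ≤ X.card := by exact_mod_cast hBX
  have : (θ : ℝ) < weight (fun i => y (σ i)) := by linarith
  exact_mod_cast this

-- Use blocks whose counted columns are `b₁, b₄` and whose partner columns are `b₂, b₃`. Exchanging
-- both pairs preserves every sample weight by `hb` and changes the weight of `y` by `hgb`, unless
-- one of the four coordinates is exceptional; each of the four positions excludes at most `P`
-- blocks.
omit [Fintype Z] [DecidableEq Z] in
theorem le_card_active_of_quad {P Γ : ℝ} (u : Fin s → C → Bool) (y : C → Bool)
    (g : (Fin s → Bool) → Bool) (X : Finset C) (hXg : ∀ x, x ∉ X → y x = g (fun t => u t x))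
    (hX : ∀ b, (((atom u b).filter (· ∈ X)).card : ℝ) ≤ P) (b₁ b₂ b₃ b₄ : Fin s → Bool)
    (hb : ∀ t, (b₁ t).toNat + (b₄ t).toNat = (b₂ t).toNat + (b₃ t).toNat)
    (hgb : (g b₁).toNat + (g b₄).toNat ≠ (g b₂).toNat + (g b₃).toNat) (σ : Lab T Z ≃ C)
    (hσ : IsRich Γ fun t i => u t (σ i)) :
    Γ - 4 * P ≤ (active Finset.univ u y σ).card := by
  have hrich := hσ b₁ b₂ b₄ b₃
  set v : Fin s → Lab T Z → Bool := fun t i => u t (σ i) with hv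
  set G := blocksWith v b₁ b₂ b₄ b₃ with hG
  have hGm : ∀ κ ∈ G, ∀ t, (u t (σ (Sum.inl (κ, false))) = b₁ t ∧
      u t (σ (Sum.inl (κ, true))) = b₄ t) ∧ (u t (σ (Sum.inr (Sum.inl (κ, false)))) = b₂ t ∧
      u t (σ (Sum.inr (Sum.inl (κ, true)))) = b₃ t) := fun κ hκ => (Finset.mem_filter.1 hκ).2
  have hexc : ∀ (f : T → Lab T Z) (b : Fin s → Bool), Function.Injective f →
      (∀ κ ∈ G, ∀ t, u t (σ (f κ)) = b t) → ((G.filter fun κ => σ (f κ) ∈ X).card : ℝ) ≤ P := by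
    intro f b hf hfb
    refine le_trans ?_ (hX b)
    norm_cast
    refine Finset.card_le_card_of_injOn (fun κ => σ (f κ)) ?_ ?_
    · intro κ hκ
      obtain ⟨h1, h2⟩ := Finset.mem_filter.1 (Finset.mem_coe.1 hκ)
      exact Finset.mem_coe.2 (Finset.mem_filter.2 ⟨Finset.mem_filter.2 ⟨Finset.mem_univ _,
        hfb κ h1⟩, h2⟩)
    · intro κ _ κ' _ h
      exact hf (σ.injective h)
  have e1 := hexc (fun κ => Sum.inl (κ, false)) b₁ (fun κ κ' h => by simpa using h)
    fun κ hκ t => (hGm κ hκ t).1.1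
  have e4 := hexc (fun κ => Sum.inl (κ, true)) b₄ (fun κ κ' h => by simpa using h)
    fun κ hκ t => (hGm κ hκ t).1.2
  have e2 := hexc (fun κ => Sum.inr (Sum.inl (κ, false))) b₂ (fun κ κ' h => by simpa using h)
    fun κ hκ t => (hGm κ hκ t).2.1
  have e3 := hexc (fun κ => Sum.inr (Sum.inl (κ, true))) b₃ (fun κ κ' h => by simpa using h)
    fun κ hκ t => (hGm κ hκ t).2.2
  set G1 := G.filter fun κ => σ (Sum.inl (κ, false)) ∈ X
  set G4 := G.filter fun κ => σ (Sum.inl (κ, true)) ∈ X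
  set G2 := G.filter fun κ => σ (Sum.inr (Sum.inl (κ, false))) ∈ X
  set G3 := G.filter fun κ => σ (Sum.inr (Sum.inl (κ, true))) ∈ X
  have hcov : G ⊆ G1 ∪ G4 ∪ G2 ∪ G3 ∪ active Finset.univ u y σ := by
    intro κ hκ
    by_cases h1 : σ (Sum.inl (κ, false)) ∈ X
    · simp [G1, hκ, h1]
    by_cases h4 : σ (Sum.inl (κ, true)) ∈ X
    · simp [G4, hκ, h4]
    by_cases h2 : σ (Sum.inr (Sum.inl (κ, false))) ∈ X
    · simp [G2, hκ, h2]
    by_cases h3 : σ (Sum.inr (Sum.inl (κ, true))) ∈ X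
    · simp [G3, hκ, h3]
    refine Finset.mem_union_right _ ((mem_active _ _ _ _ _).2 ⟨fun t => ?_, ?_⟩)
    · have hbt := hb t
      have := hGm κ hκ t
      simp only [blockDiff, Fintype.sum_bool, this]
      omega
    · have f1 : (fun t => u t (σ (Sum.inl (κ, false)))) = b₁ := funext fun t => (hGm κ hκ t).1.1
      have f4 : (fun t => u t (σ (Sum.inl (κ, true)))) = b₄ := funext fun t => (hGm κ hκ t).1.2
      have f2 : (fun t => u t (σ (Sum.inr (Sum.inl (κ, false))))) = b₂ :=
        funext fun t => (hGm κ hκ t).2.1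
      have f3 : (fun t => u t (σ (Sum.inr (Sum.inl (κ, true))))) = b₃ :=
        funext fun t => (hGm κ hκ t).2.2
      have k1 := hXg _ h1
      have k2 := hXg _ h2
      have k3 := hXg _ h3
      have k4 := hXg _ h4
      rw [f1] at k1
      rw [f2] at k2
      rw [f3] at k3
      rw [f4] at k4
      simp only [blockDiff, Fintype.sum_bool]
      rw [k1, k2, k3, k4]
      omega
  have hcard : G.card ≤ G1.card + G4.card + G2.card + G3.card
      + (active Finset.univ u y σ).card := by
    refine (Finset.card_le_card hcov).trans ((Finset.card_union_le _ _).trans ?_)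
    refine Nat.add_le_add_right ((Finset.card_union_le _ _).trans ?_) _
    refine Nat.add_le_add_right ((Finset.card_union_le _ _).trans ?_) _
    exact Nat.add_le_add_right (Finset.card_union_le _ _) _
  have hcard' : (G.card : ℝ) ≤ G1.card + G4.card + G2.card + G3.card
      + (active Finset.univ u y σ).card := by exact_mod_cast hcard
  linarith

open scoped Classical in
/-- For given samples and a given query, bad labellings are rare. -/
theorem card_bad_le {θ : ℕ} {e c d : Z} {Γ P N : ℝ} (hΓ : 6 ≤ Γ) (hP : 0 < P) (hN : 0 < N)
    (hN1 : N ≤ Γ * P / (4 * Fintype.card C)) (hN2 : N ≤ Γ - 4 * P)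
    (hθ : 2 ^ s * P + 2 * θ < 2 * Fintype.card T) (u : Fin s → C → Bool) (y : C → Bool) :
    (((compat (coreSet T θ e c d) u).filter fun σ => (IsRich Γ fun t i => u t (σ i)) ∧
      IsBad θ e c d y σ).card : ℝ) ≤ (1 / √N + 16 * Fintype.card C / (P * Γ) + 3 * (P / Γ)) *
      (compat (coreSet T θ e c d) u).card := by
  set S := compat (coreSet T θ e c d) u with hS
  have hsqrt : 0 < √N := Real.sqrt_pos.2 hN
  have hΓ0 : 0 < Γ := by linarith
  have t1 : 0 ≤ 1 / √N := by positivity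
  have t2 : 0 ≤ 16 * (Fintype.card C : ℝ) / (P * Γ) := by positivity
  have t3 : 0 ≤ 3 * (P / Γ) := by positivity
  have hS0 : (0 : ℝ) ≤ S.card := by positivity
  -- First case: the query takes both values often on one atom.
  by_cases hsplit : ∃ b, P ≤ (((atom u b).filter fun x => y x = true).card : ℝ) ∧
      P ≤ (((atom u b).filter fun x => y x = false).card : ℝ)
  · obtain ⟨b, h1, h0⟩ := hsplit
    have hflip := card_active_weight_eq_le (T := T) θ e c d {false} u y N hN
    have hfew := card_filter_le_of_labellings (coreSet T θ e c d) u
      (fun σ : Lab T Z ≃ C => (IsRich Γ fun t i => u t (σ i)) ∧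
        ((active {false} u y σ).card : ℝ) < N)
      (IsRich Γ) (16 * Fintype.card C / (P * Γ)) t2 (fun v hv => by
        refine le_trans ?_ (card_few_active_le hΓ hP u y b h1 h0 hN1 v hv)
        norm_cast
        refine Finset.card_le_card fun σ hσ => ?_
        obtain ⟨a1, a2⟩ := Finset.mem_filter.1 hσ
        exact Finset.mem_filter.2 ⟨a1, a2.2⟩) (fun σ _ h => h.1)
    rw [← hS] at hflip hfew
    have hsub : (S.filter fun σ : Lab T Z ≃ C => (IsRich Γ fun t i => u t (σ i)) ∧ IsBad θ e c d y σ) ⊆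
        (S.filter fun σ => N ≤ (active {false} u y σ).card ∧ weight (fun i => y (σ i)) = θ) ∪
        (S.filter fun σ : Lab T Z ≃ C => (IsRich Γ fun t i => u t (σ i)) ∧
          ((active {false} u y σ).card : ℝ) < N) := by
      intro σ hσ
      obtain ⟨a1, a2, a3⟩ := Finset.mem_filter.1 hσ
      rcases le_or_gt N ((active {false} u y σ).card : ℝ) with h | h
      · exact Finset.mem_union_left _ (Finset.mem_filter.2 ⟨a1, h, a3.1⟩)
      · exact Finset.mem_union_right _ (Finset.mem_filter.2 ⟨a1, a2, h⟩)
    have hcard := (Finset.card_le_card hsub).trans (Finset.card_union_le _ _)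
    have hcard' : (((S.filter fun σ : Lab T Z ≃ C => (IsRich Γ fun t i => u t (σ i)) ∧
        IsBad θ e c d y σ).card : ℕ) : ℝ) ≤ S.card / √N +
        16 * Fintype.card C / (P * Γ) * S.card := by
      refine le_trans (Nat.cast_le.2 hcard) ?_
      push_cast
      exact add_le_add hflip hfew
    refine hcard'.trans ?_
    have : (S.card : ℝ) / √N = 1 / √N * S.card := by ring
    rw [this]
    nlinarith [mul_nonneg t3 hS0]
  push Not at hsplit
  -- `g` is the dominant value of `y` on each atom. When both values occur fewer than `P` times it
  -- defaults to `true`, which still leaves at most `P` exceptions.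
  set g : (Fin s → Bool) → Bool := fun b =>
    decide ((((atom u b).filter fun x => y x = false).card : ℝ) < P) with hg
  set X : Finset C := Finset.univ.filter fun x => y x ≠ g (fun t => u t x) with hX
  have hXg : ∀ x, x ∉ X → y x = g (fun t => u t x) := by
    intro x hx
    by_contra hcon
    exact hx (Finset.mem_filter.2 ⟨Finset.mem_univ _, hcon⟩)
  have hXP : ∀ b, (((atom u b).filter (· ∈ X)).card : ℝ) ≤ P := by
    intro b
    have hmem : ∀ x ∈ (atom u b).filter (· ∈ X), x ∈ atom u b ∧ y x ≠ g b := by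
      intro x hx
      obtain ⟨a1, a2⟩ := Finset.mem_filter.1 hx
      have : (fun t => u t x) = b := funext (Finset.mem_filter.1 a1).2
      have a3 := (Finset.mem_filter.1 a2).2
      rw [this] at a3
      exact ⟨a1, a3⟩
    by_cases hb : (((atom u b).filter fun x => y x = false).card : ℝ) < P
    · have hgb : g b = true := by simp [hg, hb]
      refine le_trans ?_ hb.le
      norm_cast
      refine Finset.card_le_card fun x hx => ?_
      obtain ⟨a1, a2⟩ := hmem x hx
      exact Finset.mem_filter.2 ⟨a1, by rw [hgb] at a2; simpa using a2⟩
    · have hgb : g b = false := by simp [hg, not_lt.1 hb]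
      have h1 : (((atom u b).filter fun x => y x = true).card : ℝ) < P := by
        by_contra hcon
        exact hb (hsplit b (not_lt.1 hcon))
      refine le_trans ?_ h1.le
      norm_cast
      refine Finset.card_le_card fun x hx => ?_
      obtain ⟨a1, a2⟩ := hmem x hx
      exact Finset.mem_filter.2 ⟨a1, by rw [hgb] at a2; simpa using a2⟩
  -- Second case, treated first: `g` breaks an additive relation.
  by_cases hresp : RespectsSums g
  swap
  · unfold RespectsSums at hresp
    push Not at hresp
    obtain ⟨b₁, b₂, b₃, b₄, hb, hgb⟩ := hresp
    have hflip := card_active_weight_eq_le (T := T) θ e c d Finset.univ u y N hN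
    rw [← hS] at hflip
    have hsub : (S.filter fun σ : Lab T Z ≃ C => (IsRich Γ fun t i => u t (σ i)) ∧ IsBad θ e c d y σ) ⊆
        (S.filter fun σ => N ≤ (active Finset.univ u y σ).card ∧
          weight (fun i => y (σ i)) = θ) := by
      intro σ hσ
      obtain ⟨a1, a2, a3⟩ := Finset.mem_filter.1 hσ
      exact Finset.mem_filter.2 ⟨a1, hN2.trans (le_card_active_of_quad u y g X hXg hXP b₁ b₂ b₃ b₄
        hb hgb σ a2), a3.1⟩
    refine le_trans (Nat.cast_le.2 (Finset.card_le_card hsub)) (hflip.trans ?_)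
    have : (S.card : ℝ) / √N = 1 / √N * S.card := by ring
    rw [this]
    nlinarith [mul_nonneg t3 hS0, mul_nonneg t2 hS0]
  -- Third case: `g` is compatible with xor if `g 0 = 0`, so a violation at `e, c, d` needs one of
  -- these labels to be exceptional. If `g 0 = 1`, the weight of `y` exceeds `θ`.
  cases h0 : g (fun _ => false)
  · have hz : ∀ z : Z, ((S.filter fun σ : Lab T Z ≃ C => (IsRich Γ fun t i => u t (σ i)) ∧
        σ (Sum.inr (Sum.inr z)) ∈ X).card : ℝ) ≤ P / Γ * S.card := by
      intro z
      refine card_filter_le_of_labellings (coreSet T θ e c d) u _ (IsRich Γ) (P / Γ)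
        (by positivity) (fun v hv => ?_) (fun σ _ h => h.1)
      refine le_trans ?_ (card_label_mem_le hΓ0 u v hv X hXP (Sum.inr (Sum.inr z)))
      norm_cast
      refine Finset.card_le_card fun σ hσ => ?_
      obtain ⟨a1, a2⟩ := Finset.mem_filter.1 hσ
      exact Finset.mem_filter.2 ⟨a1, a2.2⟩
    have hsub : (S.filter fun σ : Lab T Z ≃ C => (IsRich Γ fun t i => u t (σ i)) ∧ IsBad θ e c d y σ) ⊆
        ((S.filter fun σ : Lab T Z ≃ C => (IsRich Γ fun t i => u t (σ i)) ∧ σ (Sum.inr (Sum.inr e)) ∈ X) ∪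
        (S.filter fun σ : Lab T Z ≃ C => (IsRich Γ fun t i => u t (σ i)) ∧ σ (Sum.inr (Sum.inr c)) ∈ X)) ∪
        (S.filter fun σ : Lab T Z ≃ C => (IsRich Γ fun t i => u t (σ i)) ∧ σ (Sum.inr (Sum.inr d)) ∈ X) := by
      intro σ hσ
      obtain ⟨a1, a2, a3⟩ := Finset.mem_filter.1 hσ
      by_cases he : σ (Sum.inr (Sum.inr e)) ∈ X
      · exact Finset.mem_union_left _ (Finset.mem_union_left _ (Finset.mem_filter.2 ⟨a1, a2, he⟩))
      by_cases hc : σ (Sum.inr (Sum.inr c)) ∈ X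
      · exact Finset.mem_union_left _ (Finset.mem_union_right _ (Finset.mem_filter.2 ⟨a1, a2, hc⟩))
      by_cases hd : σ (Sum.inr (Sum.inr d)) ∈ X
      · exact Finset.mem_union_right _ (Finset.mem_filter.2 ⟨a1, a2, hd⟩)
      exfalso
      apply a3.2
      rw [hXg _ he, hXg _ hc, hXg _ hd, ← hresp.map_xor h0]
      congr 1
      funext t
      exact (Finset.mem_filter.1 ((Finset.mem_filter.1 a1).2 t)).2.2
    have hcard := (Finset.card_le_card hsub).trans ((Finset.card_union_le _ _).trans
      (Nat.add_le_add_right (Finset.card_union_le _ _) _))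
    refine le_trans (Nat.cast_le.2 hcard) ?_
    push_cast
    have h1 := hz e
    have h2 := hz c
    have h3 := hz d
    nlinarith [mul_nonneg t1 hS0, mul_nonneg t2 hS0]
  · rw [Finset.filter_false_of_mem]
    · simp only [Finset.card_empty, Nat.cast_zero]
      positivity
    · rintro σ hσ ⟨_, hbad⟩
      have := lt_weight_of_respectsSums u y g hresp h0 X hXg hXP hθ σ hσ
      exact absurd hbad.1 this.ne'

end Bad

/-! ### Core samples are rich with high probability -/

theorem card_fun_pattern_mul {ι : Type*} [Fintype ι] [DecidableEq ι] (A : Finset ι) (f : ι → Bool) :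
    (Finset.univ.filter fun p : ι → Bool => ∀ i ∈ A, p i = f i).card * 2 ^ A.card
      = 2 ^ Fintype.card ι := by
  have : (Finset.univ.filter fun p : ι → Bool => ∀ i ∈ A, p i = f i)
      = Fintype.piFinset fun i => if i ∈ A then {f i} else Finset.univ := by
    ext p
    simp only [Finset.mem_filter, Finset.mem_univ, true_and, Fintype.mem_piFinset]
    refine forall_congr' fun i => ?_
    by_cases h : i ∈ A <;> simp [h]
  rw [this, Fintype.card_piFinset]
  have h2 : ∀ i, (if i ∈ A then ({f i} : Finset Bool) else Finset.univ).card
      = if i ∈ A then 1 else 2 := by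
    intro i; split_ifs <;> simp
  simp_rw [h2]
  rw [Finset.prod_ite]
  simp only [Finset.prod_const_one, one_mul, Finset.prod_const]
  rw [← pow_add]
  congr 1
  have := Finset.card_filter_add_card_filter_not (s := (Finset.univ : Finset ι)) (· ∈ A)
  rw [Finset.card_univ, Finset.filter_mem_eq_inter, Finset.univ_inter] at this
  omega

theorem pow_one_add_le {x : ℝ} (hx : 0 ≤ x) (s : ℕ) (hs : s * x ≤ 1 / 2) :
    (1 + x) ^ s ≤ 1 + 2 * (s * x) := by
  induction s with
  | zero => simp
  | succ s ih =>
    push_cast at hs ⊢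
    have hs' : (s : ℝ) * x ≤ 1 / 2 := by nlinarith
    have h0 : 0 ≤ (s : ℝ) * x := by positivity
    have := ih hs'
    rw [pow_succ]
    calc (1 + x) ^ s * (1 + x) ≤ (1 + 2 * (s * x)) * (1 + x) := by gcongr
      _ = 1 + 2 * (s * x) + x + 2 * (s * x) * x := by ring
      _ ≤ _ := by nlinarith

section Rich

variable {T Z : Type} [Fintype T] [DecidableEq T] [Fintype Z] [DecidableEq Z] {s : ℕ}

/-- The elements of `coreSet` of weight `a`. -/
def coreSlice (T : Type) {Z : Type} [Fintype T] [DecidableEq T] [Fintype Z] [DecidableEq Z]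
    (θ : ℕ) (e c d : Z) (a : ℕ) : Finset (Lab T Z → Bool) :=
  (coreSet T θ e c d).filter fun w => weight w = a

/-- The restrictions of elements of `coreSlice` to the uncounted, unpartnered coordinates. -/
def coreTail (θ : ℕ) (e c d : Z) (a : ℕ) : Finset (Z → Bool) :=
  Finset.univ.filter fun z => a + (z e).toNat ≤ θ ∧ z e = xor (z c) (z d)

omit [Fintype Z] [DecidableEq Z] in
theorem weight_sumElim (X : Finset (T × Bool)) (r : (T × Bool) ⊕ Z → Bool) :
    weight (Sum.elim (fun j => decide (j ∈ X)) r) = X.card := by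
  have : ∀ j : T × Bool, (decide (j ∈ X)).toNat = if j ∈ X then 1 else 0 := by
    intro j; by_cases h : j ∈ X <;> simp [h]
  simp only [weight, Sum.elim_inl, this]
  rw [Finset.sum_ite_mem, Finset.univ_inter, Finset.sum_const, smul_eq_mul, mul_one]

/-- Once the weight is fixed, the three groups of coordinates are independent: the ones among the
counted coordinates form a uniform `a`-subset, the partners are free, and the core condition
concerns only the tail. -/
theorem card_coreSlice_filter (θ : ℕ) (e c d : Z) (a : ℕ) (Q : Finset (T × Bool) → Prop)
    (R : (T × Bool → Bool) → Prop) [DecidablePred Q] [DecidablePred R] :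
    ((coreSlice T θ e c d a).filter fun w =>
      Q (Finset.univ.filter fun j => w (Sum.inl j) = true) ∧
      R (fun j => w (Sum.inr (Sum.inl j)))).card
      = (((Finset.univ : Finset (T × Bool)).powersetCard a).filter Q).card *
        ((Finset.univ.filter R).card * (coreTail θ e c d a).card) := by
  rw [← Finset.card_product, ← Finset.card_product]
  have hones : ∀ w : Lab T Z → Bool,
      Sum.elim (fun j => decide (j ∈ Finset.univ.filter fun j => w (Sum.inl j) = true))
        (Sum.elim (fun j => w (Sum.inr (Sum.inl j))) (fun z => w (Sum.inr (Sum.inr z)))) = w := by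
    intro w
    funext i
    rcases i with j | j | z <;> simp
  have hw : ∀ w : Lab T Z → Bool,
      (Finset.univ.filter fun j => w (Sum.inl j) = true).card = weight w := by
    intro w
    conv_rhs => rw [← hones w]
    rw [weight_sumElim]
  refine Finset.card_nbij' (fun w => (Finset.univ.filter fun j => w (Sum.inl j) = true,
      (fun j => w (Sum.inr (Sum.inl j))), fun z => w (Sum.inr (Sum.inr z))))
    (fun x => Sum.elim (fun j => decide (j ∈ x.1)) (Sum.elim x.2.1 x.2.2)) ?_ ?_ ?_ ?_
  · intro w h
    simp only [coreSlice, coreSet, Finset.coe_filter, Finset.mem_filter, Finset.mem_univ, true_and,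
      Set.mem_ofPred_eq] at h
    obtain ⟨⟨⟨h1, h2⟩, h3⟩, h4, h5⟩ := h
    simp only [Finset.coe_product, Set.mem_prod, Finset.mem_coe, Finset.mem_filter,
      Finset.mem_powersetCard, Finset.subset_univ, true_and, coreTail, Finset.mem_univ]
    exact ⟨⟨(hw w).trans h3, h4⟩, h5, h3 ▸ h1, h2⟩
  · rintro ⟨X, p, z⟩ h
    simp only [Finset.coe_product, Set.mem_prod, Finset.mem_coe, Finset.mem_filter,
      Finset.mem_powersetCard, Finset.subset_univ, true_and, coreTail, Finset.mem_univ] at h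
    obtain ⟨⟨h1, h2⟩, h3, h4, h5⟩ := h
    simp only [coreSlice, coreSet, Finset.coe_filter, Finset.mem_filter, Finset.mem_univ, true_and,
      Set.mem_ofPred_eq, weight_sumElim, Sum.elim_inl, Sum.elim_inr, decide_eq_true_eq,
      Finset.filter_univ_mem]
    exact ⟨⟨⟨h1 ▸ h4, h5⟩, h1⟩, h2, h3⟩
  · intro w _
    exact hones w
  · rintro ⟨X, p, z⟩ _
    simp

theorem card_coreSlice (θ : ℕ) (e c d : Z) (a : ℕ) : (coreSlice T θ e c d a).card
    = (2 * Fintype.card T).choose a *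
      (2 ^ (2 * Fintype.card T) * (coreTail θ e c d a).card) := by
  have := card_coreSlice_filter (T := T) θ e c d a (fun _ => True) (fun _ => True)
  simpa [Finset.card_powersetCard, Fintype.card_prod, mul_comm (Fintype.card T) 2] using this

/-- The four coordinates of block `κ` carry the given values. -/
def blockEq (x₀ x₁ x₂ x₃ : Bool) (κ : T) (w : Lab T Z → Bool) : Prop :=
  (w (Sum.inl (κ, false)) = x₀ ∧ w (Sum.inl (κ, true)) = x₂) ∧
    (w (Sum.inr (Sum.inl (κ, false))) = x₁ ∧ w (Sum.inr (Sum.inl (κ, true))) = x₃)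

instance (x₀ x₁ x₂ x₃ : Bool) (κ : T) (w : Lab T Z → Bool) :
    Decidable (blockEq x₀ x₁ x₂ x₃ κ w) := by unfold blockEq; infer_instance

theorem card_coreSlice_blockEq (θ : ℕ) (e c d : Z) (a : ℕ) (ha : a ≤ 2 * Fintype.card T)
    (hT : 3 ≤ Fintype.card T) (x₀ x₁ x₂ x₃ : Bool) (κ : T) :
    (((coreSlice T θ e c d a).filter (blockEq x₀ x₁ x₂ x₃ κ)).card : ℝ)
      = pairProb (2 * Fintype.card T) a x₀ x₂ / 4 * (coreSlice T θ e c d a).card := by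
  have hU : (Finset.univ : Finset (T × Bool)).card = 2 * Fintype.card T := by
    rw [Finset.card_univ, Fintype.card_prod, Fintype.card_bool, mul_comm]
  have h := card_coreSlice_filter (T := T) θ e c d a
    (fun X => decide ((κ, false) ∈ X) = x₀ ∧ decide ((κ, true) ∈ X) = x₂)
    (fun p => p (κ, false) = x₁ ∧ p (κ, true) = x₃)
  have h1 := card_pair_pattern (Finset.univ : Finset (T × Bool)) a (by omega) (by omega)
    (κ, false) (κ, true) (Finset.mem_univ _) (Finset.mem_univ _) (by simp) x₀ x₂
  have h2 := card_fun_pattern_mul ({(κ, false), (κ, true)} : Finset (T × Bool))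
    (fun j => if j.2 then x₃ else x₁)
  rw [Finset.card_pair (by simp)] at h2
  have e1 : ((coreSlice T θ e c d a).filter (blockEq x₀ x₁ x₂ x₃ κ)).card
      = ((coreSlice T θ e c d a).filter fun w =>
      (decide ((κ, false) ∈ Finset.univ.filter fun j => w (Sum.inl j) = true) = x₀ ∧
      decide ((κ, true) ∈ Finset.univ.filter fun j => w (Sum.inl j) = true) = x₂) ∧
      (w (Sum.inr (Sum.inl (κ, false))) = x₁ ∧ w (Sum.inr (Sum.inl (κ, true))) = x₃)).card := by
    congr 1
    refine Finset.filter_congr fun w _ => ?_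
    simp [blockEq]
  have e2 : (Finset.univ.filter fun p : T × Bool → Bool =>
      ∀ i ∈ ({(κ, false), (κ, true)} : Finset (T × Bool)), p i = if i.2 then x₃ else x₁)
      = Finset.univ.filter fun p => p (κ, false) = x₁ ∧ p (κ, true) = x₃ := by
    refine Finset.filter_congr fun p _ => ?_
    simp
  rw [e2] at h2
  rw [e1, h, card_coreSlice]
  rw [hU] at h1
  push_cast
  rw [h1, Finset.card_powersetCard, hU]
  have h2' : ((Finset.univ.filter fun p : T × Bool → Bool =>
      p (κ, false) = x₁ ∧ p (κ, true) = x₃).card : ℝ) = 2 ^ (2 * Fintype.card T) / 4 := by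
    rw [eq_div_iff (by norm_num)]
    rw [← Finset.card_univ, hU] at h2
    exact_mod_cast h2
  rw [h2']
  ring

theorem card_coreSlice_blockEq_two_le (θ : ℕ) (e c d : Z) (a : ℕ) (ha : a ≤ 2 * Fintype.card T)
    (hT : 3 ≤ Fintype.card T) (x₀ x₁ x₂ x₃ : Bool) (κ κ' : T) (hκ : κ ≠ κ') :
    (((coreSlice T θ e c d a).filter fun w => blockEq x₀ x₁ x₂ x₃ κ w ∧
      blockEq x₀ x₁ x₂ x₃ κ' w).card : ℝ)
      ≤ (pairProb (2 * Fintype.card T) a x₀ x₂ / 4) ^ 2 *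
        (1 + 4 / ((2 * Fintype.card T : ℕ) : ℝ) ^ 2) * (coreSlice T θ e c d a).card := by
  have hU : (Finset.univ : Finset (T × Bool)).card = 2 * Fintype.card T := by
    rw [Finset.card_univ, Fintype.card_prod, Fintype.card_bool, mul_comm]
  have h := card_coreSlice_filter (T := T) θ e c d a
    (fun X => (decide ((κ, false) ∈ X) = x₀ ∧ decide ((κ, true) ∈ X) = x₂) ∧
      (decide ((κ', false) ∈ X) = x₀ ∧ decide ((κ', true) ∈ X) = x₂))
    (fun p => (p (κ, false) = x₁ ∧ p (κ, true) = x₃) ∧ (p (κ', false) = x₁ ∧ p (κ', true) = x₃))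
  have h1 := card_two_pair_pattern_le (Finset.univ : Finset (T × Bool)) a (by omega) (by omega)
    (κ, false) (κ, true) (κ', false) (κ', true) (Finset.mem_univ _) (Finset.mem_univ _)
    (Finset.mem_univ _) (Finset.mem_univ _) (by simp) (by simp) (by simp [hκ]) (by simp [hκ])
    (by simp) (by simp) x₀ x₂
  have h2 := card_fun_pattern_mul
    ({(κ, false), (κ, true), (κ', false), (κ', true)} : Finset (T × Bool))
    (fun j => if j.2 then x₃ else x₁)
  have hc4 : ({(κ, false), (κ, true), (κ', false), (κ', true)} : Finset (T × Bool)).card = 4 := by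
    rw [Finset.card_insert_of_notMem, Finset.card_insert_of_notMem, Finset.card_pair] <;>
      simp [hκ]
  rw [hc4] at h2
  have e1 : ((coreSlice T θ e c d a).filter fun w => blockEq x₀ x₁ x₂ x₃ κ w ∧
      blockEq x₀ x₁ x₂ x₃ κ' w).card
      = ((coreSlice T θ e c d a).filter fun w =>
      ((decide ((κ, false) ∈ Finset.univ.filter fun j => w (Sum.inl j) = true) = x₀ ∧
      decide ((κ, true) ∈ Finset.univ.filter fun j => w (Sum.inl j) = true) = x₂) ∧
      (decide ((κ', false) ∈ Finset.univ.filter fun j => w (Sum.inl j) = true) = x₀ ∧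
      decide ((κ', true) ∈ Finset.univ.filter fun j => w (Sum.inl j) = true) = x₂)) ∧
      ((w (Sum.inr (Sum.inl (κ, false))) = x₁ ∧ w (Sum.inr (Sum.inl (κ, true))) = x₃) ∧
      (w (Sum.inr (Sum.inl (κ', false))) = x₁ ∧ w (Sum.inr (Sum.inl (κ', true))) = x₃))).card := by
    congr 1
    refine Finset.filter_congr fun w _ => ?_
    simp only [blockEq, Finset.mem_filter, Finset.mem_univ, true_and, Bool.decide_eq_true]
    tauto
  have e2 : (Finset.univ.filter fun p : T × Bool → Bool =>
      ∀ i ∈ ({(κ, false), (κ, true), (κ', false), (κ', true)} : Finset (T × Bool)),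
        p i = if i.2 then x₃ else x₁)
      = Finset.univ.filter fun p => (p (κ, false) = x₁ ∧ p (κ, true) = x₃) ∧
        (p (κ', false) = x₁ ∧ p (κ', true) = x₃) := by
    refine Finset.filter_congr fun p _ => ?_
    simp [and_assoc]
  rw [e2] at h2
  rw [e1, h, card_coreSlice]
  rw [hU] at h1
  have h2' : ((Finset.univ.filter fun p : T × Bool → Bool => (p (κ, false) = x₁ ∧
      p (κ, true) = x₃) ∧ (p (κ', false) = x₁ ∧ p (κ', true) = x₃)).card : ℝ)
      = 2 ^ (2 * Fintype.card T) / 16 := by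
    rw [eq_div_iff (by norm_num)]
    rw [← Finset.card_univ, hU] at h2
    norm_num at h2
    exact_mod_cast h2
  rw [Finset.card_powersetCard, hU] at h1
  rw [Nat.cast_mul, Nat.cast_mul, h2']
  calc _ ≤ (pairProb (2 * Fintype.card T) a x₀ x₂ ^ 2 *
        (1 + 4 / ((2 * Fintype.card T : ℕ) : ℝ) ^ 2) * ((2 * Fintype.card T).choose a : ℕ)) *
        (2 ^ (2 * Fintype.card T) / 16 * (coreTail θ e c d a).card) := by gcongr
    _ = _ := by push_cast; ring

/-- The rarest pattern is two ones, of probability about `(a / m)²`, and `(2 / 17)² > 1 / 75`. The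
two free partner bits cost another factor `4`, which is the origin of `300`. -/
theorem pairProb_ge {m a : ℕ} (hm : 300 ≤ m) (h1 : 2 * m ≤ 17 * a) (h2 : 4 * a ≤ m)
    (x z : Bool) : 1 / 75 ≤ pairProb m a x z := by
  have hm' : (300 : ℝ) ≤ m := by exact_mod_cast hm
  have h1' : (2 : ℝ) * m ≤ 17 * a := by exact_mod_cast h1
  have h2' : (4 : ℝ) * a ≤ m := by exact_mod_cast h2
  have hden : (0 : ℝ) < m * (m - 1) := by apply mul_pos <;> linarith
  rw [pairProb, div_le_div_iff₀ (by norm_num) hden]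
  cases x <;> cases z <;> simp <;> nlinarith

theorem pairProb_le_one {m a : ℕ} (hm : 300 ≤ m) (h1 : 2 * m ≤ 17 * a) (h2 : 4 * a ≤ m)
    (x z : Bool) : pairProb m a x z ≤ 1 := by
  have hm' : (300 : ℝ) ≤ m := by exact_mod_cast hm
  have h1' : (2 : ℝ) * m ≤ 17 * a := by exact_mod_cast h1
  have h2' : (4 : ℝ) * a ≤ m := by exact_mod_cast h2
  have hden : (0 : ℝ) < m * (m - 1) := by apply mul_pos <;> linarith
  rw [pairProb, div_le_one hden]
  cases x <;> cases z <;> simp <;> nlinarith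

end Rich

section RichProbability

variable {T Z : Type} [Fintype T] [DecidableEq T] [Fintype Z] [DecidableEq Z] {s : ℕ}

theorem card_piFinset_filter {W : Type*} [DecidableEq W] (V : Fin s → Finset W)
    (P : Fin s → W → Prop) [∀ t, DecidablePred (P t)] :
    ((Fintype.piFinset V).filter fun v => ∀ t, P t (v t)).card
      = ∏ t, ((V t).filter (P t)).card := by
  rw [← Fintype.card_piFinset]
  congr 1
  ext v
  simp only [Finset.mem_filter, Fintype.mem_piFinset]
  exact forall_and.symm

/-- Within fixed sample weights, every column pattern occurs in many blocks with high
probability. -/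
theorem card_few_blocks_le (θ : ℕ) (e c d : Z) (hT : 150 ≤ Fintype.card T)
    (hs : 2 * s ≤ Fintype.card T) (a : Fin s → ℕ) (ha1 : ∀ t, 4 * Fintype.card T ≤ 17 * a t)
    (ha2 : ∀ t, 2 * a t ≤ Fintype.card T) (b₀ b₁ b₂ b₃ : Fin s → Bool) :
    (((Fintype.piFinset fun t => coreSlice T θ e c d (a t)).filter fun v =>
      ((blocksWith v b₀ b₁ b₂ b₃).card : ℝ) < Fintype.card T / (2 * 300 ^ s)).card : ℝ)
      ≤ 8 * 300 ^ s / Fintype.card T *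
        (Fintype.piFinset fun t => coreSlice T θ e c d (a t)).card := by
  set K := Fintype.card T with hK
  have hK0 : (0 : ℝ) < K := by exact_mod_cast (by omega : 0 < K)
  set r : Fin s → ℝ := fun t => pairProb (2 * K) (a t) (b₀ t) (b₂ t) / 4 with hr
  have hr1 : ∀ t, 1 / 300 ≤ r t := by
    intro t
    have := pairProb_ge (m := 2 * K) (a := a t) (by omega) (by have := ha1 t; omega)
      (by have := ha2 t; omega) (b₀ t) (b₂ t)
    simp only [hr]; linarith
  have hr2 : ∀ t, r t ≤ 1 := by
    intro t
    have := pairProb_le_one (m := 2 * K) (a := a t) (by omega) (by have := ha1 t; omega)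
      (by have := ha2 t; omega) (b₀ t) (b₂ t)
    simp only [hr]; linarith
  have hr0 : ∀ t, 0 < r t := fun t => lt_of_lt_of_le (by norm_num) (hr1 t)
  set p : ℝ := ∏ t, r t with hp
  have hp0 : 0 < p := Finset.prod_pos fun t _ => hr0 t
  have hp1 : p ≤ 1 := Finset.prod_le_one (fun t _ => (hr0 t).le) fun t _ => hr2 t
  have hpl : 1 / 300 ^ s ≤ p := by
    have : ∏ _t : Fin s, (1 / 300 : ℝ) ≤ p :=
      Finset.prod_le_prod (fun _ _ => by norm_num) fun t _ => hr1 t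
    simpa using this
  set x : ℝ := 4 / ((2 * K : ℕ) : ℝ) ^ 2 with hx
  have hx' : x = 1 / (K : ℝ) ^ 2 := by
    rw [hx]; push_cast; field_simp; norm_num
  have hx0 : 0 ≤ x := by rw [hx']; positivity
  have hsK : (2 : ℝ) * s ≤ K := by exact_mod_cast hs
  have hK150 : (150 : ℝ) ≤ K := by exact_mod_cast hT
  have hsx : (s : ℝ) * x ≤ 1 / (2 * K) := by
    rw [hx', mul_one_div, div_le_div_iff₀ (by positivity) (by positivity)]
    nlinarith
  have hsx2 : (s : ℝ) * x ≤ 1 / 2 := by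
    refine hsx.trans ?_
    rw [div_le_div_iff₀ (by positivity) (by positivity)]
    linarith
  -- Samples of fixed weights are independent, so probabilities multiply over `t`. The per-sample
  -- excess `x = 1 / K²` accumulates to `(1 + x)^s - 1 ≤ 1 / K`.
  have key := card_few_events_le (Fintype.piFinset fun t => coreSlice T θ e c d (a t))
    (Finset.univ : Finset T)
    (fun κ v => ∀ t, blockEq (b₀ t) (b₁ t) (b₂ t) (b₃ t) κ (v t)) p ((1 + x) ^ s - 1)
    hp0 hp1 ?_ ?_ ?_ ?_
  · rw [Finset.card_univ] at key
    refine le_trans ?_ (key.trans ?_)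
    · refine Nat.cast_le.2 (Finset.card_le_card ?_)
      intro v hv
      rw [Finset.mem_filter] at hv ⊢
      refine ⟨hv.1, lt_of_lt_of_le hv.2 ?_⟩
      have : (K : ℝ) / (2 * 300 ^ s) = 1 / 300 ^ s * K / 2 := by field_simp
      rw [this]
      gcongr
    · refine mul_le_mul_of_nonneg_right ?_ (by positivity)
      rw [div_le_div_iff₀ (by positivity) hK0]
      have : 1 ≤ 300 ^ s * p := by
        rw [div_le_iff₀ (by positivity)] at hpl; linarith
      calc 8 * (K : ℝ) ≤ 8 * K * (300 ^ s * p) := le_mul_of_one_le_right (by positivity) this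
        _ = _ := by ring
  · intro κ _
    rw [card_piFinset_filter, Fintype.card_piFinset]
    push_cast
    rw [hp, ← Finset.prod_mul_distrib]
    refine Finset.prod_congr rfl fun t _ => ?_
    rw [card_coreSlice_blockEq θ e c d (a t) (by have := ha2 t; omega) (by omega)]
  · intro κ _ κ' _ hκ
    have : ((Fintype.piFinset fun t => coreSlice T θ e c d (a t)).filter fun v =>
        (∀ t, blockEq (b₀ t) (b₁ t) (b₂ t) (b₃ t) κ (v t)) ∧
        ∀ t, blockEq (b₀ t) (b₁ t) (b₂ t) (b₃ t) κ' (v t)).card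
        = ∏ t, ((coreSlice T θ e c d (a t)).filter fun w =>
          blockEq (b₀ t) (b₁ t) (b₂ t) (b₃ t) κ w ∧
          blockEq (b₀ t) (b₁ t) (b₂ t) (b₃ t) κ' w).card := by
      rw [← card_piFinset_filter]
      congr 1
      refine Finset.filter_congr fun v _ => forall_and.symm
    rw [this, Fintype.card_piFinset]
    push_cast
    have h2 : ∏ t, (r t ^ 2 * (1 + x) * ((coreSlice T θ e c d (a t)).card : ℝ))
        = p ^ 2 * (1 + ((1 + x) ^ s - 1)) * ∏ t, ((coreSlice T θ e c d (a t)).card : ℝ) := by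
      rw [Finset.prod_mul_distrib, Finset.prod_mul_distrib, Finset.prod_pow, ← hp]
      simp
    rw [← h2]
    refine Finset.prod_le_prod (fun _ _ => by positivity) fun t _ => ?_
    exact card_coreSlice_blockEq_two_le θ e c d (a t) (by have := ha2 t; omega) (by omega)
      _ _ _ _ κ κ' hκ
  · exact sub_nonneg.2 (one_le_pow₀ (by linarith))
  · rw [Finset.card_univ]
    have h1 := pow_one_add_le hx0 s hsx2
    have : ((1 + x) ^ s - 1) ≤ 1 / K := by
      calc ((1 + x) ^ s - 1) ≤ 2 * (s * x) := by linarith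
        _ ≤ 2 * (1 / (2 * K)) := by gcongr
        _ = _ := by field_simp
    calc ((1 + x) ^ s - 1) * (K : ℝ) ≤ 1 / K * K := by gcongr
      _ = 1 := by field_simp

/-- Below the threshold the tail does not depend on the weight, so the ratio of sizes is that of
consecutive binomials, `(2K - a) / (a + 1) ≥ 2`. The strict bound `a + 1 < θ` matters: at weight `θ`
the bit `x_e` is forced to zero. -/
theorem card_coreSlice_succ_ge {e c d : Z} {a : ℕ} {θ : ℕ} (hθ : 3 * θ ≤ 2 * Fintype.card T)
    (ha : a + 1 < θ) :
    2 * (coreSlice T θ e c d a).card ≤ (coreSlice T θ e c d (a + 1)).card := by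
  have htail : ∀ b, b < θ → coreTail θ e c d b
      = (Finset.univ.filter fun z => z e = xor (z c) (z d) : Finset (Z → Bool)) := by
    intro b hb
    refine Finset.filter_congr fun z _ => ?_
    have := Bool.toNat_le (z e)
    exact ⟨fun h => h.2, fun h => ⟨by omega, h⟩⟩
  rw [card_coreSlice, card_coreSlice, htail _ ha, htail _ (by omega), ← mul_assoc]
  refine Nat.mul_le_mul_right _ ?_
  have h := Nat.choose_succ_right_eq (2 * Fintype.card T) a
  have h2 : (2 * Fintype.card T).choose a * (2 * (a + 1))
      ≤ (2 * Fintype.card T).choose a * (2 * Fintype.card T - a) :=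
    Nat.mul_le_mul_left _ (by omega)
  have h3 : (2 * (2 * Fintype.card T).choose a) * (a + 1)
      ≤ (2 * Fintype.card T).choose (a + 1) * (a + 1) := by
    rw [h]; linarith
  exact Nat.le_of_mul_le_mul_right h3 (by omega)

theorem sum_card_coreSlice_le {e c d : Z} {θ : ℕ} (hθ : 3 * θ ≤ 2 * Fintype.card T) (j : ℕ)
    (hj : j < θ) :
    ∑ a ∈ Finset.range j, (coreSlice T θ e c d a).card ≤ (coreSlice T θ e c d j).card := by
  induction j with
  | zero => simp
  | succ j ih =>
    rw [Finset.sum_range_succ]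
    have := ih (by omega)
    have := card_coreSlice_succ_ge (e := e) (c := c) (d := d) hθ hj
    omega

theorem card_coreSet_filter_weight (e c d : Z) (θ : ℕ) (A : Finset ℕ) :
    ((coreSet T θ e c d).filter fun w => weight w ∈ A).card
      = ∑ a ∈ A, (coreSlice T θ e c d a).card := by
  rw [Finset.card_eq_sum_card_fiberwise (s := (coreSet T θ e c d).filter fun w => weight w ∈ A)
    (f := weight) (t := A)
    (fun w hw => Finset.mem_coe.2 (Finset.mem_filter.1 hw).2)]
  refine Finset.sum_congr rfl fun a ha => ?_
  rw [coreSlice, Finset.filter_filter]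
  congr 1
  refine Finset.filter_congr fun w _ => ⟨fun h => h.2, fun h => ⟨h ▸ ha, h⟩⟩

/-- Assignments of low weight are rare. -/
theorem card_low_weight_le {e c d : Z} {θ r : ℕ} (hθ : 3 * θ ≤ 2 * Fintype.card T) :
    (θ - r) * ((coreSet T θ e c d).filter fun w => weight w < r).card
      ≤ (coreSet T θ e c d).card := by
  have h1 := card_coreSet_filter_weight (T := T) e c d θ (Finset.range r)
  have h2 := card_coreSet_filter_weight (T := T) e c d θ (Finset.Ico r θ)
  simp only [Finset.mem_range] at h1
  rw [h1]
  -- By geometric growth, each of the `θ - r` slices from `r` to `θ - 1` outweighs everything below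
  -- `r`.
  calc (θ - r) * ∑ a ∈ Finset.range r, (coreSlice T θ e c d a).card
      = ∑ _j ∈ Finset.Ico r θ, ∑ a ∈ Finset.range r, (coreSlice T θ e c d a).card := by
        rw [Finset.sum_const, Nat.card_Ico, smul_eq_mul]
    _ ≤ ∑ j ∈ Finset.Ico r θ, (coreSlice T θ e c d j).card := by
        refine Finset.sum_le_sum fun j hj => ?_
        rw [Finset.mem_Ico] at hj
        exact (Finset.sum_le_sum_of_subset (Finset.range_mono hj.1)).trans
          (sum_card_coreSlice_le hθ j hj.2)
    _ ≤ _ := by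
        rw [← h2]
        exact Finset.card_le_card (Finset.filter_subset _ _)

theorem card_piFinset_filter_mem {W : Type*} [DecidableEq W] (V L : Finset W) (hL : L ⊆ V)
    (t : Fin s) {D : ℕ} (hD : D * L.card ≤ V.card) :
    D * ((Fintype.piFinset fun _ : Fin s => V).filter fun v => v t ∈ L).card
      ≤ V.card ^ s := by
  have : (Fintype.piFinset fun _ : Fin s => V).filter (fun v => v t ∈ L)
      = Fintype.piFinset (Function.update (fun _ => V) t L) := by
    ext v
    simp only [Finset.mem_filter, Fintype.mem_piFinset]
    constructor
    · rintro ⟨h1, h2⟩ i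
      by_cases hi : i = t
      · subst hi; simpa using h2
      · simpa [hi] using h1 i
    · intro h
      refine ⟨fun i => ?_, by simpa using h t⟩
      by_cases hi : i = t
      · subst hi; exact hL (by simpa using h i)
      · simpa [hi] using h i
  rw [this, Fintype.card_piFinset]
  have h1 : ∀ i, (Function.update (fun _ : Fin s => V) t L i).card
      = Function.update (fun _ : Fin s => V.card) t L.card i := by
    intro i
    by_cases hi : i = t
    · subst hi; simp
    · simp [hi]
  simp_rw [h1]
  rw [Finset.prod_update_of_mem (Finset.mem_univ t), ← mul_assoc]
  calc _ ≤ V.card * ∏ x ∈ Finset.univ \ {t}, V.card := Nat.mul_le_mul_right _ hD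
    _ = ∏ x : Fin s, Function.update (fun _ => V.card) t V.card x :=
      (Finset.prod_update_of_mem (Finset.mem_univ t) _ _).symm
    _ = _ := by simp

omit [DecidableEq T] [Fintype Z] [DecidableEq Z] in
theorem blocksWith_few_of_not_isRich {Γ : ℝ} {v : Fin s → Lab T Z → Bool} (h : ¬ IsRich Γ v) :
    ∃ b : ((Fin s → Bool) × (Fin s → Bool)) × ((Fin s → Bool) × (Fin s → Bool)),
      ((blocksWith v b.1.1 b.1.2 b.2.1 b.2.2).card : ℝ) < Γ := by
  simp only [IsRich, not_forall, not_le] at h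
  obtain ⟨b₀, b₁, b₂, b₃, h⟩ := h
  exact ⟨((b₀, b₁), (b₂, b₃)), h⟩

-- Union bound over two failures: some sample is too light, or all have weight of order `K` and one
-- of the `16^s` four-column patterns is scarce. The second is bounded after conditioning on the
-- vector of sample weights.
open scoped Classical in
theorem card_not_isRich_le (e c d : Z) (hT : 150 ≤ Fintype.card T)
    (hs : 2 * s ≤ Fintype.card T) :
    (((Fintype.piFinset fun _ : Fin s => coreSet T (Fintype.card T / 2) e c d).filter fun v =>
      ¬ IsRich (Fintype.card T / (2 * 300 ^ s)) v).card : ℝ)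
      ≤ (4 * s / Fintype.card T + 8 * 16 ^ s * 300 ^ s / Fintype.card T) *
        ((coreSet T (Fintype.card T / 2) e c d).card : ℝ) ^ s := by
  set K := Fintype.card T with hK
  set θ := K / 2 with hθ
  set V := coreSet T θ e c d with hV
  -- This is `⌈4K / 17⌉`: large enough for the pattern probabilities of `pairProb_ge`, and still at
  -- least `K / 4` below `θ`.
  set r := (4 * K + 16) / 17 with hr
  have hK0 : (0 : ℝ) < K := by exact_mod_cast (by omega : 0 < K)
  set Good := (Fintype.piFinset fun _ : Fin s => V).filter fun v => ∀ t, r ≤ weight (v t)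
    with hGood
  set Few := fun b : ((Fin s → Bool) × (Fin s → Bool)) × ((Fin s → Bool) × (Fin s → Bool)) =>
    Good.filter fun v => ((blocksWith v b.1.1 b.1.2 b.2.1 b.2.2).card : ℝ) < K / (2 * 300 ^ s)
    with hFew
  have hGc : (Good.card : ℝ) ≤ (V.card : ℝ) ^ s := by
    have : Good.card ≤ V.card ^ s := by
      refine (Finset.card_le_card (Finset.filter_subset _ _)).trans ?_
      simp
    exact_mod_cast this
  have hfew : ∀ b, ((Few b).card : ℝ) ≤ 8 * 300 ^ s / K * (V.card : ℝ) ^ s := by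
    intro b
    refine le_trans ?_ (mul_le_mul_of_nonneg_left hGc (by positivity))
    have hmaps : ∀ v ∈ Good, (fun t => weight (v t)) ∈
        Fintype.piFinset fun _ : Fin s => Finset.Icc r θ := by
      intro v hv
      rw [hGood, Finset.mem_filter, Fintype.mem_piFinset] at hv
      rw [Fintype.mem_piFinset]
      intro t
      have h1 := (Finset.mem_filter.1 (hv.1 t)).2.1
      exact Finset.mem_Icc.2 ⟨hv.2 t, by omega⟩
    have hfib : ∀ a ∈ Fintype.piFinset fun _ : Fin s => Finset.Icc r θ,
        Good.filter (fun v => (fun t => weight (v t)) = a)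
          = Fintype.piFinset fun t => coreSlice T θ e c d (a t) := by
      intro a ha
      rw [Fintype.mem_piFinset] at ha
      ext v
      simp only [hGood, Finset.mem_filter, Fintype.mem_piFinset, coreSlice]
      constructor
      · rintro ⟨⟨h1, _⟩, h3⟩ t
        exact ⟨h1 t, congrFun h3 t⟩
      · intro h
        exact ⟨⟨fun t => (h t).1, fun t => (h t).2 ▸ (Finset.mem_Icc.1 (ha t)).1⟩,
          funext fun t => (h t).2⟩
    rw [Finset.card_eq_sum_card_fiberwise (s := Few b) (f := fun v t => weight (v t))
      (t := Fintype.piFinset fun _ : Fin s => Finset.Icc r θ)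
      (fun v hv => hmaps v (Finset.mem_filter.1 hv).1),
      Finset.card_eq_sum_card_fiberwise (s := Good) (f := fun v t => weight (v t))
      (t := Fintype.piFinset fun _ : Fin s => Finset.Icc r θ)
      (fun v hv => hmaps v hv)]
    push_cast
    rw [Finset.mul_sum]
    refine Finset.sum_le_sum fun a ha => ?_
    rw [hFew]
    simp only
    rw [Finset.filter_comm, hfib a ha]
    rw [Fintype.mem_piFinset] at ha
    have ha' := fun t => Finset.mem_Icc.1 (ha t)
    exact card_few_blocks_le θ e c d hT hs a (fun t => by have := (ha' t).1; omega)
      (fun t => by have := (ha' t).2; omega) _ _ _ _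
  set Low := fun t : Fin s => (Fintype.piFinset fun _ : Fin s => V).filter fun v =>
    v t ∈ V.filter fun w => weight w < r with hLow
  have hlow : ∀ t, ((Low t).card : ℝ) ≤ 4 / K * (V.card : ℝ) ^ s := by
    intro t
    have h1 := card_piFinset_filter_mem V (V.filter fun w => weight w < r)
      (Finset.filter_subset _ _) t (card_low_weight_le (by omega))
    have h2 : ((θ - r : ℕ) : ℝ) * ((Low t).card : ℝ) ≤ (V.card : ℝ) ^ s := by exact_mod_cast h1
    have h3 : (K : ℝ) / 4 ≤ ((θ - r : ℕ) : ℝ) := by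
      rw [div_le_iff₀ (by norm_num)]
      exact_mod_cast (by omega : K ≤ (θ - r) * 4)
    have h4 : (K : ℝ) / 4 * (Low t).card ≤ (V.card : ℝ) ^ s :=
      (mul_le_mul_of_nonneg_right h3 (by positivity)).trans h2
    rw [div_mul_eq_mul_div, le_div_iff₀ hK0]
    linarith
  have hsub : ((Fintype.piFinset fun _ : Fin s => V).filter fun v =>
      ¬ IsRich (K / (2 * 300 ^ s)) v) ⊆ Finset.univ.biUnion Low ∪ Finset.univ.biUnion Few := by
    intro v hv
    rw [Finset.mem_filter] at hv
    rw [Finset.mem_union]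
    by_cases hg : ∀ t, r ≤ weight (v t)
    · right
      obtain ⟨b, hb⟩ := blocksWith_few_of_not_isRich hv.2
      rw [Finset.mem_biUnion]
      exact ⟨b, Finset.mem_univ _, Finset.mem_filter.2 ⟨Finset.mem_filter.2 ⟨hv.1, hg⟩, hb⟩⟩
    · left
      push Not at hg
      obtain ⟨t, ht⟩ := hg
      rw [Finset.mem_biUnion]
      exact ⟨t, Finset.mem_univ _, Finset.mem_filter.2 ⟨hv.1, Finset.mem_filter.2
        ⟨Fintype.mem_piFinset.1 hv.1 t, ht⟩⟩⟩
  have hb : Fintype.card (((Fin s → Bool) × (Fin s → Bool)) × ((Fin s → Bool) × (Fin s → Bool)))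
      = 16 ^ s := by
    simp only [Fintype.card_prod, Fintype.card_fun, Fintype.card_bool, Fintype.card_fin]
    rw [← mul_pow, ← mul_pow]
    norm_num
  calc _ ≤ (((Finset.univ.biUnion Low ∪ Finset.univ.biUnion Few).card : ℕ) : ℝ) := by
        exact_mod_cast Finset.card_le_card hsub
    _ ≤ ((∑ t, (Low t).card + ∑ b, (Few b).card : ℕ) : ℝ) := by
        exact_mod_cast (Finset.card_union_le _ _).trans
          (add_le_add Finset.card_biUnion_le Finset.card_biUnion_le)
    _ ≤ ∑ _t : Fin s, 4 / K * (V.card : ℝ) ^ s + ∑ _b : ((Fin s → Bool) × (Fin s → Bool)) ×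
          ((Fin s → Bool) × (Fin s → Bool)), 8 * 300 ^ s / K * (V.card : ℝ) ^ s := by
        push_cast
        exact add_le_add (Finset.sum_le_sum fun t _ => hlow t)
          (Finset.sum_le_sum fun b _ => hfew b)
    _ = _ := by
        rw [Finset.sum_const, Finset.sum_const, Finset.card_univ, Finset.card_univ, hb,
          Fintype.card_fin, nsmul_eq_mul, nsmul_eq_mul]
        push_cast
        ring

end RichProbability

/-! ### Acceptance probabilities as finite sums -/

section Run

variable {n s q : ℕ}

theorem sum_toReal_pmf {α : Type*} [Fintype α] (p : PMF α) : ∑ a, (p a).toReal = 1 := by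
  rw [← ENNReal.toReal_sum fun a _ => p.apply_ne_top a, ← tsum_fintype (L := .unconditional _),
    p.tsum_coe, ENNReal.toReal_one]

theorem toReal_pmf_le_one {α : Type*} (p : PMF α) (a : α) : (p a).toReal ≤ 1 := by
  have := ENNReal.toReal_mono ENNReal.one_ne_top (p.coe_le_one a)
  simpa using this

/-- The probability that `T` says "yes" on `f` given the samples `u`. -/
noncomputable def acceptProb (T : NonadaptiveTester n s q) (f : BoolFn n) (u : Fin s → Cube n) :
    ℝ :=
  ∑ y, (T.queries u y).toReal * (T.verdict u y (fun j => f (y j)) true).toReal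

theorem acceptProb_nonneg (T : NonadaptiveTester n s q) (f : BoolFn n) (u : Fin s → Cube n) :
    0 ≤ acceptProb T f u :=
  Finset.sum_nonneg fun _ _ => mul_nonneg ENNReal.toReal_nonneg ENNReal.toReal_nonneg

theorem acceptProb_le_one (T : NonadaptiveTester n s q) (f : BoolFn n) (u : Fin s → Cube n) :
    acceptProb T f u ≤ 1 := by
  rw [← sum_toReal_pmf (T.queries u)]
  exact Finset.sum_le_sum fun y _ =>
    mul_le_of_le_one_right ENNReal.toReal_nonneg (toReal_pmf_le_one _ _)

theorem toReal_run_mul (T : NonadaptiveTester n s q) (f : BoolFn n) (hf : (satSet f).Nonempty) :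
    (T.run f hf true).toReal * ((satSet f).card : ℝ) ^ s
      = ∑ u ∈ Fintype.piFinset (fun _ : Fin s => satSet f), acceptProb T f u := by
  have hM : ((satSet f).card : ℝ) ≠ 0 := by exact_mod_cast hf.card_pos.ne'
  have h1 : T.run f hf true = ∑ u, (∏ i, samp f hf (u i)) *
      ∑ y, T.queries u y * T.verdict u y (fun j => f (y j)) true := by
    rw [NonadaptiveTester.run, PMF.bind_apply, tsum_fintype]
    refine Finset.sum_congr rfl fun u _ => ?_
    rw [PMF.bind_apply, tsum_fintype]
    rfl
  have h2 : ∀ u, (∏ i, samp f hf (u i)).toReal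
      = if u ∈ Fintype.piFinset (fun _ : Fin s => satSet f) then
        (((satSet f).card : ℝ) ^ s)⁻¹ else 0 := by
    intro u
    rw [ENNReal.toReal_prod]
    simp only [samp, PMF.uniformOfFinset_apply]
    split_ifs with h
    · rw [Fintype.mem_piFinset] at h
      rw [Finset.prod_congr rfl fun i _ => by rw [if_pos (h i)]]
      simp
    · rw [Fintype.mem_piFinset, not_forall] at h
      obtain ⟨i, hi⟩ := h
      exact Finset.prod_eq_zero (Finset.mem_univ i) (by simp [hi])
  have h3 : ∀ u, (∑ y, T.queries u y * T.verdict u y (fun j => f (y j)) true).toReal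
      = acceptProb T f u := by
    intro u
    rw [ENNReal.toReal_sum fun y _ =>
      ENNReal.mul_ne_top (PMF.apply_ne_top _ _) (PMF.apply_ne_top _ _)]
    simp only [ENNReal.toReal_mul, acceptProb]
  have h4 : ∀ u ∈ (Finset.univ : Finset (Fin s → Cube n)), (∏ i, samp f hf (u i)) *
      ∑ y, T.queries u y * T.verdict u y (fun j => f (y j)) true ≠ ⊤ := by
    intro u _
    refine ENNReal.mul_ne_top (ENNReal.prod_ne_top fun i _ => PMF.apply_ne_top _ _) ?_
    exact ENNReal.sum_ne_top.2 fun y _ =>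
      ENNReal.mul_ne_top (PMF.apply_ne_top _ _) (PMF.apply_ne_top _ _)
  rw [h1, ENNReal.toReal_sum h4]
  simp only [ENNReal.toReal_mul, h2, h3, ite_mul, zero_mul]
  rw [Finset.sum_ite_mem, Finset.univ_inter, Finset.sum_mul]
  refine Finset.sum_congr rfl fun u _ => ?_
  field_simp

theorem NonadaptiveTester.IsRelErrorTester.le_sum_acceptProb {T : NonadaptiveTester n s q} {ε : ℝ}
    {C : Set (BoolFn n)} (hT : T.IsRelErrorTester ε C) {f : BoolFn n} (hf : (satSet f).Nonempty)
    (hC : f ∈ C) : 9 / 10 * ((satSet f).card : ℝ) ^ s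
      ≤ ∑ u ∈ Fintype.piFinset (fun _ : Fin s => satSet f), acceptProb T f u := by
  rw [← toReal_run_mul T f hf]
  have := ENNReal.toReal_mono (PMF.apply_ne_top _ _) ((hT f hf).1 hC)
  gcongr
  simpa using this

theorem NonadaptiveTester.IsRelErrorTester.sum_acceptProb_le {T : NonadaptiveTester n s q} {ε : ℝ}
    {C : Set (BoolFn n)} (hT : T.IsRelErrorTester ε C) {f : BoolFn n} (hf : (satSet f).Nonempty)
    (hC : IsRelFar ε f C) :
    ∑ u ∈ Fintype.piFinset (fun _ : Fin s => satSet f), acceptProb T f u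
      ≤ 1 / 10 * ((satSet f).card : ℝ) ^ s := by
  rw [← toReal_run_mul T f hf]
  have h1 := ENNReal.toReal_mono (PMF.apply_ne_top _ _) ((hT f hf).2 hC)
  have h2 := sum_toReal_pmf (T.run f hf)
  rw [Fintype.sum_bool] at h2
  gcongr
  have h3 : (9 / 10 : ENNReal).toReal = 9 / 10 := by simp
  linarith

open scoped Classical in
/-- Two functions are told apart only through a query on which they differ. -/
theorem acceptProb_sub_le (T : NonadaptiveTester n s q) (f g : BoolFn n) (u : Fin s → Cube n) :
    acceptProb T f u - acceptProb T g u
      ≤ ∑ y, (T.queries u y).toReal * ∑ j, if f (y j) ≠ g (y j) then (1 : ℝ) else 0 := by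
  rw [acceptProb, acceptProb, ← Finset.sum_sub_distrib]
  refine Finset.sum_le_sum fun y _ => ?_
  rw [← mul_sub]
  refine mul_le_mul_of_nonneg_left ?_ ENNReal.toReal_nonneg
  by_cases h : ∀ j, f (y j) = g (y j)
  · have : (fun j => f (y j)) = fun j => g (y j) := funext h
    rw [this, sub_self]
    exact Finset.sum_nonneg fun _ _ => by split_ifs <;> norm_num
  · push Not at h
    obtain ⟨j, hj⟩ := h
    have h1 := toReal_pmf_le_one (T.verdict u y fun j => f (y j)) true
    have h2 : 0 ≤ (T.verdict u y (fun j => g (y j)) true).toReal := ENNReal.toReal_nonneg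
    have h3 : (if f (y j) ≠ g (y j) then (1 : ℝ) else 0)
        ≤ ∑ j, if f (y j) ≠ g (y j) then (1 : ℝ) else 0 :=
      Finset.single_le_sum (f := fun j => if f (y j) ≠ g (y j) then (1 : ℝ) else 0)
        (fun _ _ => by split_ifs <;> norm_num) (Finset.mem_univ j)
    rw [if_pos hj] at h3
    linarith

end Run

/-! ### Averaging over the hidden labelling -/

section Hidden

variable {n s q : ℕ}

/-- Bayes' rule in counting form: a labelling together with core samples read through it is the same
as a sample tuple `u` together with a labelling compatible with `u`. -/
theorem sum_sum_relabel {T Z C : Type} [Fintype T] [DecidableEq T] [Fintype Z] [DecidableEq Z]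
    [Fintype C] [DecidableEq C] (V : Finset (Lab T Z → Bool))
    (g : (Lab T Z ≃ C) → (Fin s → C → Bool) → ℝ) :
    ∑ σ, ∑ v ∈ Fintype.piFinset (fun _ : Fin s => V), g σ (fun t i => v t (σ.symm i))
      = ∑ u, ∑ σ ∈ compat V u, g σ u := by
  rw [Finset.sum_comm' (s' := fun u => compat V u) (t' := Finset.univ)
    (s := Finset.univ) (t := fun σ => Finset.univ.filter fun u : Fin s → C → Bool =>
      ∀ t, (fun i => u t (σ i)) ∈ V) (by intro σ u; simp [compat])
    |>.symm]
  refine Finset.sum_congr rfl fun σ _ => ?_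
  refine Finset.sum_bij' (fun v _ => fun t i => v t (σ.symm i)) (fun u _ => fun t i => u t (σ i))
    ?_ ?_ ?_ ?_ ?_
  · intro v hv
    rw [Fintype.mem_piFinset] at hv
    simpa using hv
  · intro u hu
    rw [Fintype.mem_piFinset]
    simpa using hu
  · intro v _; simp
  · intro u _; simp
  · intro v _; rfl

open scoped Classical in
/-- Averaged over the hidden labelling, functions that differ only at bad queries are hard to
tell apart from rich samples. -/
theorem sum_acceptProb_sub_le {T Z : Type} [Fintype T] [DecidableEq T] [Fintype Z] [DecidableEq Z]
    (A : NonadaptiveTester n s q) (θ : ℕ) (e c d : Z) (f g : (Lab T Z ≃ Fin n) → BoolFn n)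
    (hfg : ∀ σ y, f σ y ≠ g σ y → IsBad θ e c d y σ) {Γ δ₁ δ₂ : ℝ}
    (h1 : ∀ (u : Fin s → Cube n) (y : Cube n), (((compat (coreSet T θ e c d) u).filter fun σ =>
      (IsRich Γ fun t i => u t (σ i)) ∧ IsBad θ e c d y σ).card : ℝ)
        ≤ δ₁ * (compat (coreSet T θ e c d) u).card)
    (h2 : (((Fintype.piFinset fun _ : Fin s => coreSet T θ e c d).filter fun v =>
      ¬ IsRich Γ v).card : ℝ) ≤ δ₂ * ((coreSet T θ e c d).card : ℝ) ^ s) :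
    ∑ σ, ∑ v ∈ Fintype.piFinset (fun _ : Fin s => coreSet T θ e c d),
      (acceptProb A (f σ) (fun t i => v t (σ.symm i))
        - acceptProb A (g σ) (fun t i => v t (σ.symm i)))
      ≤ (q * δ₁ + δ₂) * (Fintype.card (Lab T Z ≃ Fin n) * ((coreSet T θ e c d).card : ℝ) ^ s) := by
  set V := coreSet T θ e c d with hV
  set R : (Lab T Z ≃ Fin n) → (Fin s → Cube n) → Prop := fun σ u => IsRich Γ fun t i => u t (σ i)
    with hR
  set D : (Lab T Z ≃ Fin n) → (Fin s → Cube n) → ℝ := fun σ u =>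
    ∑ y, (A.queries u y).toReal * ∑ j, if R σ u ∧ IsBad θ e c d (y j) σ then (1 : ℝ) else 0
    with hD
  -- For rich samples only bad queries help; for the others the trivial bound `1` is paid.
  have hpt : ∀ σ u, acceptProb A (f σ) u - acceptProb A (g σ) u
      ≤ D σ u + if R σ u then 0 else 1 := by
    intro σ u
    by_cases hr : R σ u
    · rw [if_pos hr, add_zero]
      refine (acceptProb_sub_le A (f σ) (g σ) u).trans ?_
      refine Finset.sum_le_sum fun y _ => mul_le_mul_of_nonneg_left ?_ ENNReal.toReal_nonneg
      refine Finset.sum_le_sum fun j _ => ?_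
      by_cases h : f σ (y j) ≠ g σ (y j)
      · rw [if_pos h, if_pos ⟨hr, hfg σ _ h⟩]
      · rw [if_neg h]; split_ifs <;> norm_num
    · rw [if_neg hr]
      have h0 : 0 ≤ D σ u := Finset.sum_nonneg fun y _ => mul_nonneg ENNReal.toReal_nonneg
        (Finset.sum_nonneg fun _ _ => by split_ifs <;> norm_num)
      have := acceptProb_le_one A (f σ) u
      have := acceptProb_nonneg A (g σ) u
      linarith
  have hD1 : ∀ u, ∑ σ ∈ compat V u, D σ u ≤ q * δ₁ * (compat V u).card := by
    intro u
    simp only [hD]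
    rw [Finset.sum_comm]
    have : ∀ y : Fin q → Cube n, ∑ σ ∈ compat V u, (A.queries u y).toReal *
        ∑ j, (if R σ u ∧ IsBad θ e c d (y j) σ then (1 : ℝ) else 0)
        ≤ (A.queries u y).toReal * (q * δ₁ * (compat V u).card) := by
      intro y
      rw [← Finset.mul_sum]
      refine mul_le_mul_of_nonneg_left ?_ ENNReal.toReal_nonneg
      rw [Finset.sum_comm]
      calc _ ≤ ∑ _j : Fin q, δ₁ * ((compat V u).card : ℝ) := by
            refine Finset.sum_le_sum fun j _ => ?_
            rw [Finset.sum_boole]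
            exact h1 u (y j)
        _ = _ := by
            rw [Finset.sum_const, Finset.card_univ, Fintype.card_fin, nsmul_eq_mul]; ring
    refine (Finset.sum_le_sum fun y _ => this y).trans ?_
    rw [← Finset.sum_mul, sum_toReal_pmf, one_mul]
  have hcount : ∑ u : Fin s → Cube n, ((compat V u).card : ℝ)
      = Fintype.card (Lab T Z ≃ Fin n) * (V.card : ℝ) ^ s := by
    have := sum_sum_relabel (C := Fin n) V (s := s) (fun _ _ => 1)
    simp only [Finset.sum_const, nsmul_eq_mul, mul_one] at this
    rw [← this]
    simp [Finset.card_univ]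
  have hrich : ∑ σ : Lab T Z ≃ Fin n, ∑ v ∈ Fintype.piFinset (fun _ : Fin s => V),
      (if R σ (fun t i => v t (σ.symm i)) then (0 : ℝ) else 1)
      ≤ δ₂ * (Fintype.card (Lab T Z ≃ Fin n) * (V.card : ℝ) ^ s) := by
    have : ∀ σ : Lab T Z ≃ Fin n, ∑ v ∈ Fintype.piFinset (fun _ : Fin s => V),
      (if R σ (fun t i => v t (σ.symm i)) then (0 : ℝ) else 1) ≤ δ₂ * (V.card : ℝ) ^ s := by
      intro σ
      refine le_trans (le_of_eq ?_) h2
      rw [← Finset.sum_boole]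
      refine Finset.sum_congr rfl fun v _ => ?_
      simp only [hR, Equiv.symm_apply_apply]
      split_ifs <;> simp_all
    refine (Finset.sum_le_sum fun σ _ => this σ).trans (le_of_eq ?_)
    rw [Finset.sum_const, Finset.card_univ, nsmul_eq_mul]
    ring
  calc _ ≤ ∑ σ, ∑ v ∈ Fintype.piFinset (fun _ : Fin s => V),
        (D σ (fun t i => v t (σ.symm i)) + if R σ (fun t i => v t (σ.symm i)) then 0 else 1) :=
        Finset.sum_le_sum fun σ _ => Finset.sum_le_sum fun v _ => hpt σ _
    _ = (∑ u, ∑ σ ∈ compat V u, D σ u) + ∑ σ : Lab T Z ≃ Fin n,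
          ∑ v ∈ Fintype.piFinset (fun _ : Fin s => V),
          (if R σ (fun t i => v t (σ.symm i)) then (0 : ℝ) else 1) := by
        rw [← sum_sum_relabel V D, ← Finset.sum_add_distrib]
        refine Finset.sum_congr rfl fun σ _ => Finset.sum_add_distrib
    _ ≤ (∑ u : Fin s → Cube n, q * δ₁ * ((compat V u).card : ℝ))
          + δ₂ * (Fintype.card (Lab T Z ≃ Fin n) * (V.card : ℝ) ^ s) :=
        add_le_add (Finset.sum_le_sum fun u _ => hD1 u) hrich
    _ = _ := by
        rw [← Finset.mul_sum, hcount]; ring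

end Hidden

/-! ### The yes- and no-families and their common core -/

section Families

variable {T Z : Type} [Fintype T] [DecidableEq T] [Fintype Z] [DecidableEq Z]

/-- The assignments of `weight + x_e ≤ θ`. -/
def yesSet (T : Type) {Z : Type} [Fintype T] [DecidableEq T] [Fintype Z] [DecidableEq Z]
    (θ : ℕ) (e : Z) : Finset (Lab T Z → Bool) :=
  Finset.univ.filter fun w => weight w + (w (Sum.inr (Sum.inr e))).toNat ≤ θ

/-- The assignments of `weight + (x_c ⊕ x_d) ≤ θ`. -/
def noSet (T : Type) {Z : Type} [Fintype T] [DecidableEq T] [Fintype Z] [DecidableEq Z]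
    (θ : ℕ) (c d : Z) : Finset (Lab T Z → Bool) :=
  Finset.univ.filter fun w =>
    weight w + (xor (w (Sum.inr (Sum.inr c))) (w (Sum.inr (Sum.inr d)))).toNat ≤ θ

/-- The relation `x_e = x_c ⊕ x_d`. -/
def SumRel (e c d : Z) (w : Lab T Z → Bool) : Prop :=
  w (Sum.inr (Sum.inr e)) = xor (w (Sum.inr (Sum.inr c))) (w (Sum.inr (Sum.inr d)))

instance (e c d : Z) (w : Lab T Z → Bool) : Decidable (SumRel e c d w) := by
  unfold SumRel; infer_instance

theorem yesSet_filter (θ : ℕ) (e c d : Z) :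
    (yesSet T θ e).filter (SumRel e c d) = coreSet T θ e c d := by
  rw [yesSet, coreSet, Finset.filter_filter]
  rfl

theorem noSet_filter (θ : ℕ) (e c d : Z) :
    (noSet T θ c d).filter (SumRel e c d) = coreSet T θ e c d := by
  rw [noSet, coreSet, Finset.filter_filter]
  refine Finset.filter_congr fun w _ => ?_
  unfold SumRel
  constructor
  · rintro ⟨h1, h2⟩; exact ⟨h2 ▸ h1, h2⟩
  · rintro ⟨h1, h2⟩; exact ⟨h2 ▸ h1, h2⟩

/-- Flip one uncounted coordinate. -/
def flipBit (z : Z) (w : Lab T Z → Bool) : Lab T Z → Bool :=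
  Function.update w (Sum.inr (Sum.inr z)) (!w (Sum.inr (Sum.inr z)))

omit [Fintype T] [Fintype Z] in
theorem flipBit_self (z : Z) (w : Lab T Z → Bool) :
    flipBit z w (Sum.inr (Sum.inr z)) = !w (Sum.inr (Sum.inr z)) := by simp [flipBit]

omit [Fintype T] [Fintype Z] in
theorem flipBit_of_ne {z z' : Z} (h : z' ≠ z) (w : Lab T Z → Bool) :
    flipBit z w (Sum.inr (Sum.inr z')) = w (Sum.inr (Sum.inr z')) := by simp [flipBit, h]

omit [Fintype T] [Fintype Z] in
theorem flipBit_flipBit (z : Z) (w : Lab T Z → Bool) : flipBit z (flipBit z w) = w := by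
  simp [flipBit]

omit [Fintype Z] in
theorem weight_flipBit (z : Z) (w : Lab T Z → Bool) : weight (flipBit z w) = weight w := by
  simp [weight, flipBit]

theorem card_eq_two_mul_filter {W : Type*} [DecidableEq W] (V : Finset W) (E : W → Prop)
    [DecidablePred E] (t : W → W) (hV : ∀ w ∈ V, t w ∈ V) (ht : ∀ w, t (t w) = w)
    (hE : ∀ w, E (t w) ↔ ¬ E w) : V.card = 2 * (V.filter E).card := by
  have : (V.filter E).card = (V.filter fun w => ¬ E w).card := by
    refine Finset.card_nbij' t t ?_ ?_ (fun w _ => ht w) (fun w _ => ht w)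
    · intro w hw
      simp only [Finset.coe_filter, Set.mem_ofPred_eq] at hw ⊢
      exact ⟨hV w hw.1, by simpa [hE] using hw.2⟩
    · intro w hw
      simp only [Finset.coe_filter, Set.mem_ofPred_eq] at hw ⊢
      exact ⟨hV w hw.1, by simpa [hE] using hw.2⟩
  rw [← Finset.card_filter_add_card_filter_not (s := V) E]
  omega

theorem flipBit_mem_yesSet {θ : ℕ} {e z : Z} (h : e ≠ z) {w : Lab T Z → Bool}
    (hw : w ∈ yesSet T θ e) : flipBit z w ∈ yesSet T θ e := by
  simp only [yesSet, Finset.mem_filter, Finset.mem_univ, true_and] at hw ⊢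
  rwa [weight_flipBit, flipBit_of_ne h]

theorem flipBit_mem_noSet {θ : ℕ} {c d z : Z} (hc : c ≠ z) (hd : d ≠ z) {w : Lab T Z → Bool}
    (hw : w ∈ noSet T θ c d) : flipBit z w ∈ noSet T θ c d := by
  simp only [noSet, Finset.mem_filter, Finset.mem_univ, true_and] at hw ⊢
  rwa [weight_flipBit, flipBit_of_ne hc, flipBit_of_ne hd]

omit [Fintype T] [Fintype Z] in
theorem sumRel_flipBit_mid {e c d : Z} (hec : e ≠ c) (hdc : d ≠ c) (w : Lab T Z → Bool) :
    SumRel e c d (flipBit c w) ↔ ¬ SumRel e c d w := by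
  unfold SumRel
  rw [flipBit_self, flipBit_of_ne hec, flipBit_of_ne hdc]
  generalize w (Sum.inr (Sum.inr e)) = a
  generalize w (Sum.inr (Sum.inr c)) = b
  generalize w (Sum.inr (Sum.inr d)) = f
  revert a b f
  decide

omit [Fintype T] [Fintype Z] in
theorem sumRel_flipBit_left {e c d : Z} (hec : c ≠ e) (hde : d ≠ e) (w : Lab T Z → Bool) :
    SumRel e c d (flipBit e w) ↔ ¬ SumRel e c d w := by
  unfold SumRel
  rw [flipBit_self, flipBit_of_ne hec, flipBit_of_ne hde]
  generalize w (Sum.inr (Sum.inr e)) = a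
  generalize w (Sum.inr (Sum.inr c)) = b
  generalize w (Sum.inr (Sum.inr d)) = f
  revert a b f
  decide

omit [Fintype T] [Fintype Z] in
theorem sumRel_flipBit_of_ne {e c d z : Z} (he : e ≠ z) (hc : c ≠ z) (hd : d ≠ z)
    (w : Lab T Z → Bool) : SumRel e c d (flipBit z w) ↔ SumRel e c d w := by
  unfold SumRel
  rw [flipBit_of_ne he, flipBit_of_ne hc, flipBit_of_ne hd]

/-- Flipping `x_c` does not affect membership in `yesSet` and toggles the core relation. -/
theorem card_yesSet {e c d : Z} (θ : ℕ) (hec : e ≠ c) (hdc : d ≠ c) :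
    (yesSet T θ e).card = 2 * (coreSet T θ e c d).card := by
  rw [← yesSet_filter]
  exact card_eq_two_mul_filter _ _ (flipBit c) (fun w hw => flipBit_mem_yesSet hec hw)
    (flipBit_flipBit c) (sumRel_flipBit_mid hec hdc)

/-- Here `x_e` is the irrelevant bit whose flip toggles the relation. -/
theorem card_noSet {e c d : Z} (θ : ℕ) (hce : c ≠ e) (hde : d ≠ e) :
    (noSet T θ c d).card = 2 * (coreSet T θ e c d).card := by
  rw [← noSet_filter]
  exact card_eq_two_mul_filter _ _ (flipBit e) (fun w hw => flipBit_mem_noSet hce hde hw)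
    (flipBit_flipBit e) (sumRel_flipBit_left hce hde)

end Families

/-! ### Reduction to distinguishing within a common core -/

section Core

variable {n s q : ℕ}

/-- The function whose satisfying assignments, read through the labelling `σ`, are `S`. -/
def hiddenFn {L : Type} [Fintype L] (S : Finset (L → Bool)) (σ : L ≃ Fin n) : BoolFn n :=
  open scoped Classical in fun y => decide ((fun i => y (σ i)) ∈ S)

theorem mem_satSet_hiddenFn {L : Type} [Fintype L] (S : Finset (L → Bool)) (σ : L ≃ Fin n)
    (y : Cube n) : y ∈ satSet (hiddenFn S σ) ↔ (fun i => y (σ i)) ∈ S := by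
  simp [satSet, hiddenFn]

theorem card_satSet_hiddenFn {L : Type} [Fintype L] (S : Finset (L → Bool)) (σ : L ≃ Fin n) :
    (satSet (hiddenFn S σ)).card = S.card := by
  refine Finset.card_nbij' (fun y i => y (σ i)) (fun w i => w (σ.symm i)) ?_ ?_ ?_ ?_
  · intro y hy
    exact (mem_satSet_hiddenFn S σ y).1 hy
  · intro w hw
    rw [Finset.mem_coe, mem_satSet_hiddenFn]
    simpa using hw
  · intro y _; simp
  · intro w _; simp

theorem sum_satSet_hiddenFn {L : Type} [Fintype L] [DecidableEq L] (S : Finset (L → Bool))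
    (σ : L ≃ Fin n) (φ : (Fin s → Cube n) → ℝ) :
    ∑ u ∈ Fintype.piFinset (fun _ : Fin s => satSet (hiddenFn S σ)), φ u
      = ∑ v ∈ Fintype.piFinset (fun _ : Fin s => S), φ (fun t i => v t (σ.symm i)) := by
  refine Finset.sum_bij' (fun u _ => fun t i => u t (σ i)) (fun v _ => fun t i => v t (σ.symm i))
    ?_ ?_ ?_ ?_ ?_
  · intro u hu
    rw [Fintype.mem_piFinset] at hu ⊢
    exact fun t => (mem_satSet_hiddenFn S σ _).1 (hu t)
  · intro v hv
    rw [Fintype.mem_piFinset] at hv ⊢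
    intro t
    rw [mem_satSet_hiddenFn]
    simpa using hv t
  · intro u _; simp
  · intro v _; simp
  · intro u _; simp

/-- Three special coordinates for each block, and some padding. -/
abbrev Rest (K w : ℕ) : Type := (Fin K × Fin 3) ⊕ Fin w

/-- Both functions compare the same weight plus one bit with `θ`, so they differ only when the
weight is `θ` and the bits disagree. -/
theorem hiddenFn_ne_isBad {T Z : Type} [Fintype T] [DecidableEq T] [Fintype Z] [DecidableEq Z]
    (θ : ℕ) (e c d : Z) (σ : Lab T Z ≃ Fin n) (y : Cube n)
    (h : hiddenFn (yesSet T θ e) σ y ≠ hiddenFn (noSet T θ c d) σ y) : IsBad θ e c d y σ := by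
  simp only [hiddenFn, yesSet, noSet, Finset.mem_filter, Finset.mem_univ, true_and, ne_eq,
    decide_eq_decide] at h
  have h2 : y (σ (Sum.inr (Sum.inr e)))
      ≠ xor (y (σ (Sum.inr (Sum.inr c)))) (y (σ (Sum.inr (Sum.inr d)))) :=
    fun h' => h (by rw [h'])
  refine ⟨?_, h2⟩
  generalize y (σ (Sum.inr (Sum.inr e))) = a at h h2
  generalize xor (y (σ (Sum.inr (Sum.inr c)))) (y (σ (Sum.inr (Sum.inr d)))) = b at h h2
  cases a <;> cases b <;> simp at h h2 <;> omega

open scoped Classical in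
/-- A tester that accepts every `yesSet` function and rejects every `noSet` function must
distinguish them within their common core. -/
theorem core_advantage_le {K w : ℕ} (hK : 0 < K) (A : NonadaptiveTester n s q) (θ : ℕ)
    (hσ : Nonempty (Lab (Fin K) (Rest K w) ≃ Fin n))
    (hyes : ∀ (σ : Lab (Fin K) (Rest K w) ≃ Fin n) (κ' : Fin K),
      9 / 10 * ((yesSet (Fin K) θ (Sum.inl (κ', 0) : Rest K w)).card : ℝ) ^ s
        ≤ ∑ v ∈ Fintype.piFinset (fun _ : Fin s => yesSet (Fin K) θ (Sum.inl (κ', 0) : Rest K w)),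
          acceptProb A (hiddenFn (yesSet (Fin K) θ (Sum.inl (κ', 0))) σ)
            (fun t i => v t (σ.symm i)))
    (hno : ∀ (σ : Lab (Fin K) (Rest K w) ≃ Fin n) (κ : Fin K),
      ∑ v ∈ Fintype.piFinset (fun _ : Fin s =>
          noSet (Fin K) θ (Sum.inl (κ, 1) : Rest K w) (Sum.inl (κ, 2))),
          acceptProb A (hiddenFn (noSet (Fin K) θ (Sum.inl (κ, 1)) (Sum.inl (κ, 2))) σ)
            (fun t i => v t (σ.symm i))
        ≤ 1 / 10 * ((noSet (Fin K) θ (Sum.inl (κ, 1) : Rest K w) (Sum.inl (κ, 2))).card : ℝ) ^ s)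
    {Γ δ₁ δ₂ : ℝ}
    (h1 : ∀ (κ κ' : Fin K) (u : Fin s → Cube n) (y : Cube n),
      (((compat (coreSet (Fin K) θ (Sum.inl (κ', 0) : Rest K w) (Sum.inl (κ, 1))
        (Sum.inl (κ, 2))) u).filter fun σ =>
      (IsRich Γ fun t i => u t (σ i)) ∧
        IsBad θ (Sum.inl (κ', 0) : Rest K w) (Sum.inl (κ, 1)) (Sum.inl (κ, 2)) y σ).card : ℝ)
        ≤ δ₁ * (compat (coreSet (Fin K) θ (Sum.inl (κ', 0) : Rest K w) (Sum.inl (κ, 1))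
          (Sum.inl (κ, 2))) u).card)
    (h2 : ∀ κ κ' : Fin K, (((Fintype.piFinset fun _ : Fin s =>
        coreSet (Fin K) θ (Sum.inl (κ', 0) : Rest K w) (Sum.inl (κ, 1)) (Sum.inl (κ, 2))).filter
        fun v => ¬ IsRich Γ v).card : ℝ)
      ≤ δ₂ * ((coreSet (Fin K) θ (Sum.inl (κ', 0) : Rest K w) (Sum.inl (κ, 1))
        (Sum.inl (κ, 2))).card : ℝ) ^ s)
    : 8 / 10 - 2 * √(2 ^ s / K) ≤ q * δ₁ + δ₂ := by
  set e : Fin K → Rest K w := fun κ => Sum.inl (κ, 0) with he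
  set c : Fin K → Rest K w := fun κ => Sum.inl (κ, 1) with hc
  set d : Fin K → Rest K w := fun κ => Sum.inl (κ, 2) with hd
  have hec : ∀ κ κ', e κ ≠ c κ' := by intro κ κ'; simp [he, hc]
  have hed : ∀ κ κ', e κ ≠ d κ' := by intro κ κ'; simp [he, hd]
  have hcd : ∀ κ κ', c κ ≠ d κ' := by intro κ κ'; simp [hc, hd]
  set M : ℕ := (yesSet (Fin K) θ (e ⟨0, hK⟩)).card with hM
  have hN : ∀ κ, (noSet (Fin K) θ (c κ) (d κ)).card = M := by
    intro κ
    rw [card_noSet (e := e ⟨0, hK⟩) θ (hec _ _).symm (hed _ _).symm, hM,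
      card_yesSet (c := c κ) (d := d κ) θ (hec _ _) (hcd _ _).symm]
  have hV : ∀ κ κ', 2 * (coreSet (Fin K) θ (e κ') (c κ) (d κ)).card = M := by
    intro κ κ'
    rw [← hN κ, card_noSet (e := e κ') θ (hec _ _).symm (hed _ _).symm]
  have hY : ∀ κ', (yesSet (Fin K) θ (e κ')).card = M := by
    intro κ'
    rw [card_yesSet (c := c κ') (d := d κ') θ (hec _ _) (hcd _ _).symm, hV]
  have hM0 : 0 < M := by
    refine Finset.card_pos.2 ⟨fun _ => false, ?_⟩
    rw [yesSet, Finset.mem_filter]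
    simp [weight]
  set X := (M : ℝ) ^ s with hX
  have hX0 : 0 < X := by positivity
  have hVc : ∀ κ κ', 2 ^ s * ((coreSet (Fin K) θ (e κ') (c κ) (d κ)).card : ℝ) ^ s = X := by
    intro κ κ'
    rw [← mul_pow, hX, ← hV κ κ']
    push_cast; rfl
  set r := √(2 ^ s / (K : ℝ)) with hr
  have hK0 : (0 : ℝ) < K := by exact_mod_cast hK
  set V := fun κ κ' => Fintype.piFinset fun _ : Fin s =>
    coreSet (Fin K) θ (e κ') (c κ) (d κ) with hVdef
  set φ := fun (σ : Lab (Fin K) (Rest K w) ≃ Fin n) κ' (v : Fin s → Lab (Fin K) (Rest K w) → Bool) =>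
    acceptProb A (hiddenFn (yesSet (Fin K) θ (e κ')) σ) (fun t i => v t (σ.symm i)) with hφ
  set ψ := fun (σ : Lab (Fin K) (Rest K w) ≃ Fin n) κ (v : Fin s → Lab (Fin K) (Rest K w) → Bool) =>
    acceptProb A (hiddenFn (noSet (Fin K) θ (c κ) (d κ)) σ) (fun t i => v t (σ.symm i)) with hψ
  -- For the yes-function of block `κ'` the relevant bit `e κ'` is fixed, and the pairs `(c κ, d κ)`
  -- provide `K` pairwise independent core events, toggled by flipping `c κ`.
  have hlow : ∀ σ κ', K * X * (9 / 10 - r) ≤ ∑ κ, 2 ^ s * ∑ v ∈ V κ κ', φ σ κ' v := by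
    intro σ κ'
    have := abs_sum_restrict_sub_le (yesSet (Fin K) θ (e κ')) hK
      (fun κ => SumRel (e κ') (c κ) (d κ)) (fun κ => flipBit (c κ))
      (fun κ w hw => flipBit_mem_yesSet (hec _ _) hw) (fun κ w _ => flipBit_flipBit _ w)
      (fun κ w _ => sumRel_flipBit_mid (hec _ _) (hcd _ _).symm w)
      (fun κ κ'' hκ w _ => sumRel_flipBit_of_ne (hec _ _) (by simp [hc, hκ.symm])
        (hcd _ _).symm w) s (φ σ κ') (fun v => acceptProb_nonneg _ _ _)
      (fun v => acceptProb_le_one _ _ _)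
    simp only [yesSet_filter] at this
    rw [hY] at this
    have h3 := hyes σ κ'
    rw [hY] at h3
    have h4 := (abs_le.1 this).1
    have h5 : (K : ℝ) * (9 / 10 * X) ≤ K * ∑ v ∈ Fintype.piFinset
        (fun _ : Fin s => yesSet (Fin K) θ (e κ')), φ σ κ' v :=
      mul_le_mul_of_nonneg_left h3 hK0.le
    simp only [hVdef]
    linarith
  -- The roles are exchanged: `(c κ, d κ)` is fixed and the bits `e κ'` provide the events.
  have hhigh : ∀ σ κ, ∑ κ', 2 ^ s * ∑ v ∈ V κ κ', ψ σ κ v ≤ K * X * (1 / 10 + r) := by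
    intro σ κ
    have := abs_sum_restrict_sub_le (noSet (Fin K) θ (c κ) (d κ)) hK
      (fun κ' => SumRel (e κ') (c κ) (d κ)) (fun κ' => flipBit (e κ'))
      (fun κ w hw => flipBit_mem_noSet (hec _ _).symm (hed _ _).symm hw)
      (fun κ w _ => flipBit_flipBit _ w)
      (fun κ w _ => sumRel_flipBit_left (hec _ _).symm (hed _ _).symm w)
      (fun κ κ'' hκ w _ => sumRel_flipBit_of_ne (by simp [he, hκ.symm]) (hec _ _).symm
        (hed _ _).symm w) s (ψ σ κ) (fun v => acceptProb_nonneg _ _ _)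
      (fun v => acceptProb_le_one _ _ _)
    simp only [noSet_filter] at this
    rw [hN] at this
    have h3 := hno σ κ
    rw [hN] at h3
    have h4 := (abs_le.1 this).2
    have h5 : K * ∑ v ∈ Fintype.piFinset
        (fun _ : Fin s => noSet (Fin K) θ (c κ) (d κ)), ψ σ κ v ≤ (K : ℝ) * (1 / 10 * X) :=
      mul_le_mul_of_nonneg_left h3 hK0.le
    simp only [hVdef]
    linarith
  -- For a pair of blocks both functions are now run on samples from the same core, so only bad
  -- queries and samples that are not rich contribute.
  have hdiff : ∀ κ κ', ∑ σ, 2 ^ s * ∑ v ∈ V κ κ', (φ σ κ' v - ψ σ κ v)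
      ≤ (q * δ₁ + δ₂) * (Fintype.card (Lab (Fin K) (Rest K w) ≃ Fin n) * X) := by
    intro κ κ'
    have := sum_acceptProb_sub_le A θ (e κ') (c κ) (d κ)
      (fun σ => hiddenFn (yesSet (Fin K) θ (e κ')) σ)
      (fun σ => hiddenFn (noSet (Fin K) θ (c κ) (d κ)) σ)
      (fun σ y h => hiddenFn_ne_isBad θ _ _ _ σ y h) (h1 κ κ') (h2 κ κ')
    rw [← Finset.mul_sum, ← hVc κ κ']
    calc _ ≤ 2 ^ s * ((q * δ₁ + δ₂) * (Fintype.card (Lab (Fin K) (Rest K w) ≃ Fin n) *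
          ((coreSet (Fin K) θ (e κ') (c κ) (d κ)).card : ℝ) ^ s)) :=
          mul_le_mul_of_nonneg_left this (by positivity)
      _ = _ := by ring
  have hsplit : ∑ κ, ∑ κ', ∑ σ, 2 ^ s * ∑ v ∈ V κ κ', (φ σ κ' v - ψ σ κ v)
      = ∑ σ, ((∑ κ', ∑ κ, 2 ^ s * ∑ v ∈ V κ κ', φ σ κ' v)
        - ∑ κ, ∑ κ', 2 ^ s * ∑ v ∈ V κ κ', ψ σ κ v) := by
    have e1 : ∀ σ, (∑ κ', ∑ κ, 2 ^ s * ∑ v ∈ V κ κ', φ σ κ' v)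
        = ∑ κ, ∑ κ', 2 ^ s * ∑ v ∈ V κ κ', φ σ κ' v := fun σ => Finset.sum_comm
    simp only [e1, ← Finset.sum_sub_distrib, ← mul_sub]
    rw [Finset.sum_comm (γ := Lab (Fin K) (Rest K w) ≃ Fin n)]
    exact Finset.sum_congr rfl fun κ _ => Finset.sum_comm
  set N : ℝ := ((Fintype.card (Lab (Fin K) (Rest K w) ≃ Fin n) : ℕ) : ℝ) with hNdef
  have hN0 : 0 < N := by rw [hNdef]; exact_mod_cast Fintype.card_pos
  have hub : ∑ κ, ∑ κ', ∑ σ, 2 ^ s * ∑ v ∈ V κ κ', (φ σ κ' v - ψ σ κ v)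
      ≤ K * (K * ((q * δ₁ + δ₂) * (N * X))) := by
    calc _ ≤ ∑ _κ : Fin K, ∑ _κ' : Fin K, (q * δ₁ + δ₂) * (N * X) :=
          Finset.sum_le_sum fun κ _ => Finset.sum_le_sum fun κ' _ => hdiff κ κ'
      _ = _ := by simp
  have hlb : N * (K * (K * X * (9 / 10 - r)) - K * (K * X * (1 / 10 + r)))
      ≤ ∑ κ, ∑ κ', ∑ σ, 2 ^ s * ∑ v ∈ V κ κ', (φ σ κ' v - ψ σ κ v) := by
    rw [hsplit]
    calc _ = ∑ _σ : Lab (Fin K) (Rest K w) ≃ Fin n, ((∑ _κ' : Fin K, K * X * (9 / 10 - r))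
          - ∑ _κ : Fin K, K * X * (1 / 10 + r)) := by
          simp [hNdef, Finset.card_univ, mul_sub]
      _ ≤ _ := Finset.sum_le_sum fun σ _ => sub_le_sub
          (Finset.sum_le_sum fun κ' _ => hlow σ κ') (Finset.sum_le_sum fun κ _ => hhigh σ κ)
  have h6 := hlb.trans hub
  have h7 : (N * K * K * X) * (8 / 10 - 2 * r) ≤ (N * K * K * X) * (q * δ₁ + δ₂) := by
    linarith
  exact le_of_mul_le_mul_left h7 (by positivity)

end Core

/-! ### Choice of parameters in terms of `A = n^(1/8)` -/

section Parameters

variable {n s q : ℕ}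

open scoped Classical in
/-- With few samples and queries, no tester accepts every `yesSet` function and rejects every
`noSet` function. -/
theorem not_distinguish {K w : ℕ} (hn : 7 * K + w = n) (hw : w < 7)
    (T : NonadaptiveTester n s q) {A : ℝ} (hA8 : A ^ 8 = n) (hA : 5000 ≤ A)
    (hs : (300 : ℝ) ^ s ≤ A) (hq : (q : ℝ) ≤ A)
    (hyes : ∀ (σ : Lab (Fin K) (Rest K w) ≃ Fin n) (κ' : Fin K),
      9 / 10 * ((yesSet (Fin K) (K / 2) (Sum.inl (κ', 0) : Rest K w)).card : ℝ) ^ s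
        ≤ ∑ v ∈ Fintype.piFinset (fun _ : Fin s =>
            yesSet (Fin K) (K / 2) (Sum.inl (κ', 0) : Rest K w)),
          acceptProb T (hiddenFn (yesSet (Fin K) (K / 2) (Sum.inl (κ', 0))) σ)
            (fun t i => v t (σ.symm i)))
    (hno : ∀ (σ : Lab (Fin K) (Rest K w) ≃ Fin n) (κ : Fin K),
      ∑ v ∈ Fintype.piFinset (fun _ : Fin s =>
          noSet (Fin K) (K / 2) (Sum.inl (κ, 1) : Rest K w) (Sum.inl (κ, 2))),
          acceptProb T (hiddenFn (noSet (Fin K) (K / 2) (Sum.inl (κ, 1)) (Sum.inl (κ, 2))) σ)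
            (fun t i => v t (σ.symm i))
        ≤ 1 / 10 * ((noSet (Fin K) (K / 2)
            (Sum.inl (κ, 1) : Rest K w) (Sum.inl (κ, 2))).card : ℝ) ^ s) : False := by
  have hA0 : 0 < A := by linarith
  have hpow : ∀ k : ℕ, (5000 : ℝ) ^ k ≤ A ^ k := fun k => by gcongr
  have hnK : A ^ 8 ≤ 8 * (K : ℝ) := by
    have h1 : (1000 : ℝ) ≤ n := le_trans (by norm_num) (hA8 ▸ hpow 8)
    have h2 : (n : ℝ) = 7 * K + w := by exact_mod_cast hn.symm
    have h3 : (w : ℝ) < 7 := by exact_mod_cast hw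
    rw [hA8]
    linarith
  have hK0 : (0 : ℝ) < K := by have := hpow 8; norm_num at this; linarith
  have hK : 0 < K := by exact_mod_cast hK0
  have h300 : (1 : ℝ) ≤ 300 ^ s := one_le_pow₀ (by norm_num)
  have h2s : (2 : ℝ) ^ s ≤ A := le_trans (by gcongr; norm_num) hs
  have h16s : (16 : ℝ) ^ s ≤ A := le_trans (by gcongr; norm_num) hs
  have hsA : (s : ℝ) ≤ A := by
    have h : (s : ℝ) ≤ 2 ^ s := by exact_mod_cast Nat.lt_two_pow_self.le
    exact h.trans h2s
  have hK150 : 150 ≤ K := by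
    have : (150 : ℝ) ≤ K := by have := hpow 8; norm_num at this; linarith
    exact_mod_cast this
  have h72 : (5000 : ℝ) ^ 7 * A ≤ A ^ 8 := by
    calc (5000 : ℝ) ^ 7 * A ≤ A ^ 7 * A := by gcongr
      _ = A ^ 8 := by ring
  have h2sK : 2 * s ≤ K := by
    have : (2 : ℝ) * s ≤ K := by norm_num at h72; linarith
    exact_mod_cast this
  set Γ : ℝ := K / (2 * 300 ^ s) with hΓ
  have hΓ7 : A ^ 7 / 16 ≤ Γ := by
    rw [hΓ, div_le_div_iff₀ (by norm_num) (by positivity)]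
    calc A ^ 7 * (2 * 300 ^ s) ≤ A ^ 7 * (2 * A) := by gcongr
      _ = 2 * A ^ 8 := by ring
      _ ≤ K * 16 := by linarith
  have hΓ0 : 0 < Γ := lt_of_lt_of_le (by positivity) hΓ7
  have hcardLab : Fintype.card (Lab (Fin K) (Rest K w)) = Fintype.card (Fin n) := by
    simp only [Fintype.card_sum, Fintype.card_prod, Fintype.card_fin, Fintype.card_bool]
    omega
  have hn0 : (0 : ℝ) < n := by rw [← hA8]; positivity
  have h75 : (5000 : ℝ) ^ 2 * A ^ 5 ≤ A ^ 7 := by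
    calc (5000 : ℝ) ^ 2 * A ^ 5 ≤ A ^ 2 * A ^ 5 := by gcongr
      _ = A ^ 7 := by ring
  have h54 : 5000 * A ^ 4 ≤ A ^ 5 := by
    calc 5000 * A ^ 4 ≤ A * A ^ 4 := by gcongr
      _ = A ^ 5 := by ring
  have h86 : (5000 : ℝ) ^ 2 * A ^ 6 ≤ A ^ 8 := by
    calc (5000 : ℝ) ^ 2 * A ^ 6 ≤ A ^ 2 * A ^ 6 := by gcongr
      _ = A ^ 8 := by ring
  have hA4 := hpow 4
  have hA5 := hpow 5
  have hA6 := hpow 6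
  norm_num at h75 h86 hA4 hA5 hA6
  have h2K : 2 * (K / 2) ≤ K := by omega
  -- The exceptional size `P = A^5` lies between `n / Γ`, of order at most `A`, and `Γ`, at least of
  -- order `A^7`. It allows `N = A^4 / 64`, the lower bound of `Γ P / (4n)`. The error per query is
  -- then `O(A^(-2))`, which beats `q ≤ A`; the final contradiction is `6/10 ≤ 2/10`.
  have hadv := core_advantage_le hK T (K / 2) ⟨Fintype.equivOfCardEq hcardLab⟩ hyes hno
    (Γ := Γ) (δ₁ := 1 / √(A ^ 4 / 64) + 16 * n / (A ^ 5 * Γ) + 3 * (A ^ 5 / Γ))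
    (δ₂ := 4 * s / K + 8 * 16 ^ s * 300 ^ s / K) ?_ ?_
  · have hsq : √(A ^ 4 / 64) = A ^ 2 / 8 := by
      rw [show A ^ 4 / 64 = (A ^ 2 / 8) ^ 2 by ring, Real.sqrt_sq (by positivity)]
    have t1 : 16 * n / (A ^ 5 * Γ) ≤ 256 / A ^ 4 := by
      rw [div_le_div_iff₀ (by positivity) (by positivity), ← hA8]
      calc 16 * A ^ 8 * A ^ 4 = 256 * (A ^ 5 * (A ^ 7 / 16)) := by ring
        _ ≤ _ := by gcongr
    have t2 : 3 * (A ^ 5 / Γ) ≤ 48 / A ^ 2 := by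
      rw [← mul_div_assoc, div_le_div_iff₀ (by positivity) (by positivity)]
      calc 3 * A ^ 5 * A ^ 2 = 48 * (A ^ 7 / 16) := by ring
        _ ≤ _ := by gcongr
    have t3 : (q : ℝ) * (1 / √(A ^ 4 / 64) + 16 * n / (A ^ 5 * Γ) + 3 * (A ^ 5 / Γ))
        ≤ 1 / 10 := by
      rw [hsq]
      calc (q : ℝ) * (1 / (A ^ 2 / 8) + 16 * n / (A ^ 5 * Γ) + 3 * (A ^ 5 / Γ))
          ≤ A * (1 / (A ^ 2 / 8) + 256 / A ^ 4 + 48 / A ^ 2) := by gcongr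
        _ = (56 * A ^ 2 + 256) / A ^ 3 := by field_simp; ring
        _ ≤ 1 / 10 := by
          rw [div_le_div_iff₀ (by positivity) (by norm_num)]
          have e1 : 5000 * A ^ 2 ≤ A ^ 3 := by
            calc 5000 * A ^ 2 ≤ A * A ^ 2 := by gcongr
              _ = A ^ 3 := by ring
          have e2 := hpow 2
          norm_num at e2
          linarith
    have t4 : 4 * (s : ℝ) / K + 8 * 16 ^ s * 300 ^ s / K ≤ 1 / 10 := by
      rw [← add_div, div_le_div_iff₀ hK0 (by norm_num)]
      have e1 : (16 : ℝ) ^ s * 300 ^ s ≤ A * A := by gcongr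
      have e2 : A * A ≤ A ^ 6 := by
        calc A * A = 1 * A ^ 2 := by ring
          _ ≤ A ^ 4 * A ^ 2 := by gcongr; linarith
          _ = A ^ 6 := by ring
      norm_num at h72
      linarith
    have t5 : √(2 ^ s / (K : ℝ)) ≤ 1 / 10 := by
      rw [Real.sqrt_le_left (by norm_num), div_le_iff₀ hK0]
      norm_num at h72
      linarith
    linarith
  · intro κ κ' u y
    have := card_bad_le (θ := K / 2) (e := (Sum.inl (κ', 0) : Rest K w)) (c := Sum.inl (κ, 1))
      (d := Sum.inl (κ, 2)) (T := Fin K) (C := Fin n) (s := s) (Γ := Γ) (P := A ^ 5)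
      (N := A ^ 4 / 64) (by linarith) (by positivity) (by positivity) ?_ (by linarith) ?_ u y
    · simpa only [Fintype.card_fin] using this
    · rw [Fintype.card_fin, ← hA8, div_le_div_iff₀ (by norm_num) (by positivity)]
      calc A ^ 4 * (4 * A ^ 8) = A ^ 7 / 16 * A ^ 5 * 64 := by ring
        _ ≤ _ := by gcongr
    · rw [Fintype.card_fin]
      have e1 : (2 : ℝ) ^ s * A ^ 5 ≤ A ^ 6 := by
        calc (2 : ℝ) ^ s * A ^ 5 ≤ A * A ^ 5 := by gcongr
          _ = A ^ 6 := by ring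
      have e2 : (2 : ℝ) * ((K / 2 : ℕ) : ℝ) ≤ K := by exact_mod_cast h2K
      linarith
  · intro κ κ'
    have := card_not_isRich_le (T := Fin K) (s := s) (Sum.inl (κ', 0) : Rest K w)
      (Sum.inl (κ, 1)) (Sum.inl (κ, 2)) (by simpa using hK150) (by simpa using h2sK)
    simp only [Fintype.card_fin] at this
    exact this

end Parameters

/-! ### Membership in, and distance from, the halfspaces -/

section Halfspaces

variable {n : ℕ}

theorem sum_update_true (W : Fin n → ℝ) (x : Cube n) (c : Fin n) (hx : x c = false) :
    ∑ i, W i * (if Function.update x c true i = true then 1 else 0)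
      = ∑ i, W i * (if x i = true then 1 else 0) + W c := by
  rw [← sub_eq_iff_eq_add', ← Finset.sum_sub_distrib, Finset.sum_eq_single c]
  · simp [hx]
  · intro i _ hi
    simp [hi]
  · simp

/-- A halfspace errs somewhere on every square on which `f` is an exclusive-or. -/
theorem card_le_card_symmDiff_of_squares {f g : BoolFn n} (hg : g ∈ halfspaces n) {c d : Fin n}
    (hcd : c ≠ d) (B : Finset (Cube n)) (hc : ∀ x ∈ B, x c = false) (hd : ∀ x ∈ B, x d = false)
    (h1 : ∀ x ∈ B, f (Function.update x c true) = !f x)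
    (h2 : ∀ x ∈ B, f (Function.update x d true) = !f x)
    (h3 : ∀ x ∈ B, f (Function.update (Function.update x c true) d true) = f x) :
    B.card ≤ (satSet f ∆ satSet g).card := by
  have hmem : ∀ x, x ∉ satSet f ∆ satSet g → f x = g x := by
    intro x hx
    simp only [satSet, Finset.mem_symmDiff, Finset.mem_filter, Finset.mem_univ, true_and] at hx
    generalize f x = a at hx ⊢
    generalize g x = b at hx ⊢
    revert a b; decide
  obtain ⟨W, θ, hW⟩ := hg
  -- Clearing the bits `c, d` sends each disagreement to the base of its square, so it suffices that
  -- every base in `B` is reached.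
  refine (Finset.card_le_card (t := (satSet f ∆ satSet g).image fun x =>
    Function.update (Function.update x c false) d false) ?_).trans Finset.card_image_le
  intro x hx
  rw [Finset.mem_image]
  by_contra! hne
  have hx0 : Function.update (Function.update x c false) d false = x := by
    rw [Function.update_eq_self_iff.2, Function.update_eq_self_iff.2 (hc x hx).symm]
    rw [Function.update_eq_self_iff.2 (hc x hx).symm]
    exact (hd x hx).symm
  have e0 := hmem x fun h => hne x h hx0
  have e1 := hmem (Function.update x c true) fun h => hne _ h (by
    rw [Function.update_idem]; exact hx0)
  have e2 := hmem (Function.update x d true) fun h => hne _ h (by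
    rw [Function.update_comm hcd, Function.update_idem, Function.update_comm hcd.symm]; exact hx0)
  have e3 := hmem (Function.update (Function.update x c true) d true) fun h => hne _ h (by
    rw [Function.update_comm hcd, Function.update_idem, Function.update_comm hcd.symm,
      Function.update_idem]; exact hx0)
  rw [h1 x hx] at e1
  rw [h2 x hx] at e2
  rw [h3 x hx] at e3
  have w0 := hW x
  have w1 := hW (Function.update x c true)
  have w2 := hW (Function.update x d true)
  have w3 := hW (Function.update (Function.update x c true) d true)
  rw [sum_update_true W x c (hc x hx)] at w1
  rw [sum_update_true W x d (hd x hx)] at w2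
  rw [sum_update_true W _ d (by rw [Function.update_of_ne hcd.symm]; exact hd x hx),
    sum_update_true W x c (hc x hx)] at w3
  rw [← e0] at w0
  rw [← e1] at w1
  rw [← e2] at w2
  rw [← e3] at w3
  -- The linear form has equal sums on the two diagonals of a square, while an exclusive-or puts one
  -- diagonal at or above the threshold and the other strictly below.
  cases hfx : f x
  · simp only [hfx, Bool.not_false, Bool.false_eq_true, true_iff, false_iff, not_le] at w0 w1 w2 w3
    linarith
  · simp only [hfx, Bool.not_true, Bool.false_eq_true, true_iff, false_iff, not_le] at w0 w1 w2 w3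
    linarith

theorem isRelFar_of_squares {f : BoolFn n} (hf : (satSet f).Nonempty) {c d : Fin n}
    (hcd : c ≠ d) (B : Finset (Cube n)) (hB : (satSet f).card ≤ 8 * B.card)
    (hc : ∀ x ∈ B, x c = false) (hd : ∀ x ∈ B, x d = false)
    (h1 : ∀ x ∈ B, f (Function.update x c true) = !f x)
    (h2 : ∀ x ∈ B, f (Function.update x d true) = !f x)
    (h3 : ∀ x ∈ B, f (Function.update (Function.update x c true) d true) = f x) :
    IsRelFar (1 / 8) f (halfspaces n) := by
  intro g hg
  have h := card_le_card_symmDiff_of_squares hg hcd B hc hd h1 h2 h3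
  have h0 : (0 : ℝ) < (satSet f).card := by exact_mod_cast hf.card_pos
  rw [relDist, div_le_div_iff₀ (by norm_num) h0]
  exact_mod_cast (by omega : 1 * (satSet f).card ≤ (satSet f ∆ satSet g).card * 8)

variable {T Z : Type} [Fintype T] [DecidableEq T] [Fintype Z] [DecidableEq Z]

theorem hiddenFn_yesSet_mem_halfspaces (θ : ℕ) (e : Z) (σ : Lab T Z ≃ Fin n) :
    hiddenFn (yesSet T θ e) σ ∈ halfspaces n := by
  set W : Lab T Z → ℝ := Sum.elim (fun _ => -1) (Sum.elim (fun _ => 0)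
    fun z => if z = e then -1 else 0) with hW
  refine ⟨fun i => W (σ.symm i), -θ, fun x => ?_⟩
  have hsum : ∑ i, W (σ.symm i) * (if x i = true then 1 else 0)
      = -((weight (fun i => x (σ i)) + (x (σ (Sum.inr (Sum.inr e)))).toNat : ℕ) : ℝ) := by
    rw [← Equiv.sum_comp σ]
    simp only [Equiv.symm_apply_apply, hW, Fintype.sum_sum_type, Sum.elim_inl, Sum.elim_inr]
    have hb : ∀ b : Bool, (if b = true then (1 : ℝ) else 0) = (b.toNat : ℝ) := by
      intro b; cases b <;> simp
    simp only [hb, weight]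
    push_cast
    simp
    ring
  rw [hsum, neg_le_neg_iff, Nat.cast_le]
  simp [hiddenFn, yesSet]

/-- Restricting to the core relation halves both sides, which brings in the slices of `coreSet` for
threshold `θ + 1`. The shift by one puts weight `θ` in the range where slices still double. -/
theorem card_weight_le_two_mul {θ : ℕ} (hT : 3 * (θ + 1) ≤ 2 * Fintype.card T) {e c d : Z}
    (hec : e ≠ c) (hcd : c ≠ d) :
    (Finset.univ.filter fun w : Lab T Z → Bool => weight w ≤ θ).card
      ≤ 2 * (Finset.univ.filter fun w : Lab T Z → Bool => weight w = θ).card := by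
  have half : ∀ P : ℕ → Prop, ∀ [DecidablePred P],
      (Finset.univ.filter fun w : Lab T Z → Bool => P (weight w)).card
      = 2 * ((Finset.univ.filter fun w : Lab T Z → Bool => P (weight w)).filter
        (SumRel e c d)).card := by
    intro P _
    refine card_eq_two_mul_filter _ _ (flipBit c) (fun w hw => ?_) (flipBit_flipBit c)
      (sumRel_flipBit_mid hec hcd.symm)
    simpa [weight_flipBit] using hw
  have h1 : (Finset.univ.filter fun w : Lab T Z → Bool => weight w ≤ θ).filter (SumRel e c d)
      = (coreSet T (θ + 1) e c d).filter fun w => weight w ∈ Finset.range (θ + 1) := by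
    ext w
    simp only [coreSet, SumRel, Finset.mem_filter, Finset.mem_univ, true_and, Finset.mem_range]
    have := Bool.toNat_le (w (Sum.inr (Sum.inr e)))
    constructor
    · rintro ⟨a, b⟩; exact ⟨⟨by omega, b⟩, by omega⟩
    · rintro ⟨⟨a, b⟩, f⟩; exact ⟨by omega, b⟩
  have h2 : (Finset.univ.filter fun w : Lab T Z → Bool => weight w = θ).filter (SumRel e c d)
      = coreSlice T (θ + 1) e c d θ := by
    ext w
    simp only [coreSlice, coreSet, SumRel, Finset.mem_filter, Finset.mem_univ, true_and]
    have := Bool.toNat_le (w (Sum.inr (Sum.inr e)))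
    constructor
    · rintro ⟨a, b⟩; exact ⟨⟨by omega, b⟩, by omega⟩
    · rintro ⟨⟨a, b⟩, f⟩; exact ⟨by omega, b⟩
  rw [half (· ≤ θ), half (· = θ), h1, h2, card_coreSet_filter_weight, Finset.sum_range_succ]
  have := sum_card_coreSlice_le (e := e) (c := c) (d := d) hT θ (by omega)
  omega

theorem card_eq_four_mul_filter (θ : ℕ) {c d : Z} (hcd : c ≠ d) :
    (Finset.univ.filter fun w : Lab T Z → Bool => weight w = θ).card
      = 4 * (((Finset.univ.filter fun w : Lab T Z → Bool => weight w = θ).filter fun w =>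
        w (Sum.inr (Sum.inr c)) = false).filter fun w => w (Sum.inr (Sum.inr d)) = false).card := by
  have h1 := card_eq_two_mul_filter (Finset.univ.filter fun w : Lab T Z → Bool => weight w = θ)
    (fun w => w (Sum.inr (Sum.inr c)) = false) (flipBit c)
    (fun w hw => by simpa [weight_flipBit] using hw) (flipBit_flipBit c)
    (fun w => by rw [flipBit_self]; simp)
  have h2 := card_eq_two_mul_filter ((Finset.univ.filter fun w : Lab T Z → Bool =>
      weight w = θ).filter fun w => w (Sum.inr (Sum.inr c)) = false)
    (fun w => w (Sum.inr (Sum.inr d)) = false) (flipBit d)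
    (fun w hw => by simpa [weight_flipBit, flipBit_of_ne hcd] using hw) (flipBit_flipBit d)
    (fun w => by rw [flipBit_self]; simp)
  omega

/-- On the slice of weight `θ` the function is the negated xor of `x_c` and `x_d`. The square bases
are a quarter of that slice, which is at least half of all points of weight at most `θ`; hence the
constant `8`. -/
theorem isRelFar_hiddenFn_noSet {θ : ℕ} (hT : 3 * (θ + 1) ≤ 2 * Fintype.card T) {e c d : Z}
    (hec : e ≠ c) (hcd : c ≠ d) (σ : Lab T Z ≃ Fin n)
    (hf : (satSet (hiddenFn (noSet T θ c d) σ)).Nonempty) :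
    IsRelFar (1 / 8) (hiddenFn (noSet T θ c d) σ) (halfspaces n) := by
  set S := ((Finset.univ.filter fun w : Lab T Z → Bool => weight w = θ).filter fun w =>
        w (Sum.inr (Sum.inr c)) = false).filter fun w => w (Sum.inr (Sum.inr d)) = false with hS
  have hmem : ∀ x, x ∈ satSet (hiddenFn S σ) → weight (fun i => x (σ i)) = θ ∧
      x (σ (Sum.inr (Sum.inr c))) = false ∧ x (σ (Sum.inr (Sum.inr d))) = false := by
    intro x hx
    rw [mem_satSet_hiddenFn] at hx
    simpa [hS, and_assoc] using hx
  have hup : ∀ (x : Cube n) (z : Z) (b : Bool), (fun i => Function.update x (σ (Sum.inr (Sum.inr z))) b (σ i))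
      = Function.update (fun i => x (σ i)) (Sum.inr (Sum.inr z)) b := by
    intro x z b
    funext i
    by_cases h : i = Sum.inr (Sum.inr z)
    · subst h; simp
    · rw [Function.update_of_ne h, Function.update_of_ne (by simpa using h)]
  have hwt : ∀ (w : Lab T Z → Bool) (z : Z) (b : Bool),
      weight (Function.update w (Sum.inr (Sum.inr z)) b) = weight w := by
    intro w z b; simp [weight]
  have hval : ∀ x : Cube n, weight (fun i => x (σ i)) = θ → hiddenFn (noSet T θ c d) σ x
      = !(xor (x (σ (Sum.inr (Sum.inr c)))) (x (σ (Sum.inr (Sum.inr d))))) := by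
    intro x hx
    simp only [hiddenFn, noSet, Finset.mem_filter, Finset.mem_univ, true_and, hx]
    generalize xor (x (σ (Sum.inr (Sum.inr c)))) (x (σ (Sum.inr (Sum.inr d)))) = a
    cases a <;> simp
  have hσcd : σ (Sum.inr (Sum.inr c)) ≠ σ (Sum.inr (Sum.inr d)) := by simpa using hcd
  refine isRelFar_of_squares hf hσcd (satSet (hiddenFn S σ)) ?_
    (fun x hx => (hmem x hx).2.1) (fun x hx => (hmem x hx).2.2) ?_ ?_ ?_
  · rw [card_satSet_hiddenFn, card_satSet_hiddenFn]
    have h1 := card_weight_le_two_mul (Z := Z) hT hec hcd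
    have h2 := card_eq_four_mul_filter (T := T) θ hcd
    rw [← hS] at h2
    have h3 : (noSet T θ c d).card
        ≤ (Finset.univ.filter fun w : Lab T Z → Bool => weight w ≤ θ).card := by
      refine Finset.card_le_card fun w hw => ?_
      simp only [noSet, Finset.mem_filter, Finset.mem_univ, true_and] at hw ⊢
      omega
    omega
  · intro x hx
    obtain ⟨h1, h2, h3⟩ := hmem x hx
    rw [hval x h1, hval _ (by rw [hup, hwt, h1])]
    simp [h2, h3, hσcd.symm]
  · intro x hx
    obtain ⟨h1, h2, h3⟩ := hmem x hx
    rw [hval x h1, hval _ (by rw [hup, hwt, h1])]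
    simp [h2, h3, hσcd]
  · intro x hx
    obtain ⟨h1, h2, h3⟩ := hmem x hx
    rw [hval x h1, hval _ (by rw [hup, hwt, hup, hwt, h1])]
    simp [h2, h3, hσcd]

end Halfspaces

/-! ### Contradictions for large and for small dimension -/

section Tester

variable {n s q : ℕ}

theorem NonadaptiveTester.IsRelErrorTester.false_of_large {T : NonadaptiveTester n s q}
    (hT : T.IsRelErrorTester (1 / 8) (halfspaces n)) {A : ℝ} (hA8 : A ^ 8 = n) (hA : 5000 ≤ A)
    (hs : (300 : ℝ) ^ s ≤ A) (hq : (q : ℝ) ≤ A) : False := by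
  obtain ⟨K, w, hn, hw⟩ : ∃ K w, 7 * K + w = n ∧ w < 7 :=
    ⟨n / 7, n % 7, Nat.div_add_mod n 7, Nat.mod_lt n (by norm_num)⟩
  have hn1 : 100 ≤ n := by
    have h1 : (5000 : ℝ) ^ 8 ≤ A ^ 8 := by gcongr
    have h2 : (100 : ℝ) ≤ n := le_trans (by norm_num) (hA8 ▸ h1)
    exact_mod_cast h2
  refine not_distinguish hn hw T hA8 hA hs hq ?_ ?_
  · intro σ κ'
    have hne : (satSet (hiddenFn (yesSet (Fin K) (K / 2) (Sum.inl (κ', 0) : Rest K w)) σ)).Nonempty :=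
      ⟨fun _ => false, by rw [mem_satSet_hiddenFn, yesSet, Finset.mem_filter]; simp [weight]⟩
    have := hT.le_sum_acceptProb hne (hiddenFn_yesSet_mem_halfspaces _ _ σ)
    rwa [sum_satSet_hiddenFn, card_satSet_hiddenFn] at this
  · intro σ κ
    have hne : (satSet (hiddenFn (noSet (Fin K) (K / 2) (Sum.inl (κ, 1) : Rest K w)
        (Sum.inl (κ, 2))) σ)).Nonempty :=
      ⟨fun _ => false, by rw [mem_satSet_hiddenFn, noSet, Finset.mem_filter]; simp [weight]⟩
    have := hT.sum_acceptProb_le hne (isRelFar_hiddenFn_noSet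
      (by rw [Fintype.card_fin]; omega) (e := (Sum.inl (κ, 0) : Rest K w)) (by simp) (by simp) σ hne)
    rwa [sum_satSet_hiddenFn, card_satSet_hiddenFn] at this

/-- Without samples and with at most one query, a function and its complement together carry no
information. -/
theorem acceptProb_add_acceptProb_not (hq : q ≤ 1) (T : NonadaptiveTester n s q) (f : BoolFn n)
    (u : Fin s → Cube n) : acceptProb T f u + acceptProb T (fun x => !f x) u
      = acceptProb T (fun _ => true) u + acceptProb T (fun _ => false) u := by
  have : Subsingleton (Fin q) := ⟨fun a b => by ext; omega⟩
  simp only [acceptProb, ← Finset.sum_add_distrib, ← mul_add]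
  refine Finset.sum_congr rfl fun y _ => ?_
  congr 1
  rcases isEmpty_or_nonempty (Fin q) with hE | ⟨⟨j⟩⟩
  · have h : ∀ b b' : Fin q → Bool, b = b' := fun b b' => funext fun j => hE.elim j
    rw [h (fun j => f (y j)) fun _ => true, h (fun j => !f (y j)) fun _ => false]
  · have h : ∀ b : Fin q → Bool, b = fun _ => b j :=
      fun b => funext fun i => by rw [Subsingleton.elim i j]
    rw [h fun j => f (y j), h fun j => !f (y j)]
    cases f (y j)
    · rw [add_comm]; rfl
    · rfl

theorem isRelFar_xor (β : Bool) {c d : Fin n} (hcd : c ≠ d)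
    (hf : (satSet fun x : Cube n => xor β (xor (x c) (x d))).Nonempty) :
    IsRelFar (1 / 8) (fun x : Cube n => xor β (xor (x c) (x d))) (halfspaces n) := by
  set V := Finset.univ.filter fun x : Cube n => x c = false with hV
  set B := V.filter fun x => x d = false with hB
  have hmem : ∀ x ∈ B, x c = false ∧ x d = false := by
    intro x hx; simpa [hB, hV] using hx
  have flip_flip : ∀ (c : Fin n) (x : Cube n), Function.update (Function.update x c (!x c)) c
      (!(Function.update x c (!x c)) c) = x := by intro c x; simp
  have h1 : (Finset.univ : Finset (Cube n)).card = 2 * V.card :=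
    card_eq_two_mul_filter Finset.univ (fun x : Cube n => x c = false)
      (fun x => Function.update x c (!x c)) (by simp) (flip_flip c) (by intro x; simp)
  have h2 : V.card = 2 * B.card :=
    card_eq_two_mul_filter V (fun x => x d = false)
      (fun x => Function.update x d (!x d)) (by intro x hx; simpa [hV, hcd] using hx)
      (flip_flip d) (by intro x; simp)
  refine isRelFar_of_squares hf hcd B ?_ (fun x hx => (hmem x hx).1) (fun x hx => (hmem x hx).2)
    ?_ ?_ ?_
  · have := Finset.card_le_univ (satSet fun x : Cube n => xor β (xor (x c) (x d)))
    rw [← Finset.card_univ] at this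
    omega
  all_goals
    intro x hx
    obtain ⟨h1, h2⟩ := hmem x hx
    cases β <;> simp [h1, h2, hcd, hcd.symm]

theorem coord_mem_halfspaces (β : Bool) (c : Fin n) :
    (fun x : Cube n => xor β (x c)) ∈ halfspaces n := by
  cases β
  · refine ⟨fun i => if i = c then 1 else 0, 1, fun x => ?_⟩
    simp only [ite_mul, zero_mul, Finset.sum_ite_eq', Finset.mem_univ, if_true]
    cases x c <;> simp
  · refine ⟨fun i => if i = c then -1 else 0, 0, fun x => ?_⟩
    simp only [ite_mul, zero_mul, Finset.sum_ite_eq', Finset.mem_univ, if_true]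
    cases x c <;> simp

/-- A coordinate and its negation are halfspaces, while the xor of two coordinates and its negation
are far. By `acceptProb_add_acceptProb_not` both pairs have the same total acceptance probability,
which would be at least `18/10` and at most `2/10`. -/
theorem NonadaptiveTester.IsRelErrorTester.false_of_small {T : NonadaptiveTester n s q}
    (hT : T.IsRelErrorTester (1 / 8) (halfspaces n)) (hn : 2 ≤ n) (hs : s = 0) (hq : q ≤ 1) :
    False := by
  subst hs
  set c : Fin n := ⟨0, by omega⟩ with hc
  set d : Fin n := ⟨1, by omega⟩ with hd
  have hcd : c ≠ d := by simp [hc, hd]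
  set u : Fin 0 → Cube n := Fin.elim0 with hu
  have hsum : ∀ f : BoolFn n, ∑ v ∈ Fintype.piFinset (fun _ : Fin 0 => satSet f), acceptProb T f v
      = acceptProb T f u := by
    intro f
    have : Fintype.piFinset (fun _ : Fin 0 => satSet f) = {u} := by
      ext v; simp [eq_iff_true_of_subsingleton]
    rw [this, Finset.sum_singleton]
  have hyes : ∀ β, 9 / 10 ≤ acceptProb T (fun x : Cube n => xor β (x c)) u := by
    intro β
    have hne : (satSet fun x : Cube n => xor β (x c)).Nonempty :=
      ⟨fun _ => !β, by cases β <;> simp [satSet]⟩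
    have := hT.le_sum_acceptProb hne (coord_mem_halfspaces β c)
    rwa [hsum, pow_zero, mul_one] at this
  have hno : ∀ β, acceptProb T (fun x : Cube n => xor β (xor (x c) (x d))) u ≤ 1 / 10 := by
    intro β
    have hne : (satSet fun x : Cube n => xor β (xor (x c) (x d))).Nonempty :=
      ⟨fun i => if i = c then !β else false, by cases β <;> simp [satSet, hcd.symm]⟩
    have := hT.sum_acceptProb_le hne (isRelFar_xor β hcd hne)
    rwa [hsum, pow_zero, mul_one] at this
  have e1 := acceptProb_add_acceptProb_not hq T (fun x : Cube n => x c) u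
  have e2 := acceptProb_add_acceptProb_not hq T (fun x : Cube n => xor (x c) (x d)) u
  have y0 := hyes false
  have y1 := hyes true
  have n0 := hno false
  have n1 := hno true
  simp only [Bool.false_xor, Bool.true_xor] at y0 y1 n0 n1
  linarith

end Tester

/-! ### Numerical estimates -/

section Numerics

theorem log_sixteen : (2.77 : ℝ) ≤ Real.log 16 := by
  rw [show (16 : ℝ) = 2 ^ 4 by norm_num, Real.log_pow]
  have := Real.log_two_gt_d9
  push_cast; linarith

theorem log_thirty_two : (3.46 : ℝ) ≤ Real.log 32 := by
  rw [show (32 : ℝ) = 2 ^ 5 by norm_num, Real.log_pow]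
  have := Real.log_two_gt_d9
  push_cast; linarith

theorem log_sixty_four : (4.15 : ℝ) ≤ Real.log 64 := by
  rw [show (64 : ℝ) = 2 ^ 6 by norm_num, Real.log_pow]
  have := Real.log_two_gt_d9
  push_cast; linarith

/-- Up to `18` the bound `log L ≥ 1 - 1 / L` suffices, the roots of `0.05 L² - L + 1` lying just
outside `[1.09, 18]`. Beyond that `log 16` and `log 32` are large enough. -/
theorem mul_le_log_of_le {L : ℝ} (h1 : 1.09 ≤ L) (h2 : L ≤ 69) : 0.05 * L ≤ Real.log L := by
  rcases le_total L 18 with h | h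
  · refine le_trans ?_ (Real.one_sub_inv_le_log_of_pos (by linarith))
    rw [le_sub_iff_add_le, ← le_sub_iff_add_le', inv_le_comm₀ (by linarith) (by linarith),
      inv_eq_one_div, div_le_iff₀ (by linarith)]
    nlinarith
  rcases le_total L 54 with h' | h'
  · have := Real.log_le_log (by norm_num) (by linarith : (16 : ℝ) ≤ L)
    have := log_sixteen
    linarith
  · have := Real.log_le_log (by norm_num) (by linarith : (32 : ℝ) ≤ L)
    have := log_thirty_two
    linarith

theorem log_three_hundred_le : Real.log 300 ≤ 6.3 := by
  have h1 : Real.log 300 ≤ Real.log (2 ^ 9) := Real.log_le_log (by norm_num) (by norm_num)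
  rw [Real.log_pow] at h1
  have := Real.log_two_lt_d9
  push_cast at h1
  linarith

theorem le_exp_of_le {x : ℝ} (hx : 8.625 ≤ x) : 5000 ≤ Real.exp x := by
  refine le_trans ?_ (Real.exp_le_exp.2 hx)
  rw [show (8.625 : ℝ) = (8 : ℕ) * 1 + 0.625 by norm_num, Real.exp_add, Real.exp_nat_mul]
  have h1 : (2.718 : ℝ) ^ 8 ≤ Real.exp 1 ^ 8 := by
    have := Real.exp_one_gt_d9
    gcongr
    linarith
  have h2 := Real.quadratic_le_exp_of_nonneg (x := 0.625) (by norm_num)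
  calc (5000 : ℝ) ≤ 2.718 ^ 8 * (1 + 0.625 + 0.625 ^ 2 / 2) := by norm_num
    _ ≤ _ := by gcongr

end Numerics

theorem theorem1 :
    ∃ ε₀ : ℝ, 0 < ε₀ ∧
      ∀ n : ℕ, 3 ≤ n → ∀ (s q : ℕ) (T : NonadaptiveTester n s q),
        T.IsRelErrorTester ε₀ (halfspaces n) →
          (0.05 : ℝ) * Real.log (n : ℝ) / Real.log (Real.log (n : ℝ)) ≤ (s : ℝ) ∨
          (n : ℝ) ^ (0.01 : ℝ) ≤ (q : ℝ) := by
  refine ⟨1 / 8, by norm_num, fun n hn s q T hT => ?_⟩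
  by_contra! hcon
  obtain ⟨hs, hq⟩ := hcon
  have hn3 : (3 : ℝ) ≤ n := by exact_mod_cast hn
  have hn0 : (0 : ℝ) < n := by linarith
  set L := Real.log n with hL
  have hL1 : 1.09 ≤ L := by
    have h1 := Real.log_le_log (by norm_num) hn3
    have h2 := Real.log_three_gt_d9
    linarith
  rw [Real.rpow_def_of_pos hn0, ← hL] at hq
  -- At `L = 69` two requirements meet: `0.01 L < log 2` below it forces `q ≤ 1`, and `exp (L / 8) ≥
  -- 5000` above it.
  rcases le_total L 69 with h | h
  · have hlog := mul_le_log_of_le hL1 h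
    have hlog0 : 0 < Real.log L := lt_of_lt_of_le (by linarith) hlog
    have hs1 : (s : ℝ) < 1 := hs.trans_le (by rwa [div_le_one hlog0])
    have hq2 : (q : ℝ) < 2 := by
      refine hq.trans ?_
      rw [← Real.lt_log_iff_exp_lt (by norm_num)]
      have := Real.log_two_gt_d9
      linarith
    have hs1' : s < 1 := by exact_mod_cast hs1
    have hq2' : q < 2 := by exact_mod_cast hq2
    exact hT.false_of_small (by omega) (by omega) (by omega)
  · have hlog : 4.15 ≤ Real.log L :=
      log_sixty_four.trans (Real.log_le_log (by norm_num) (by linarith))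
    -- The sample bound gives `s log 300 ≤ (6.3 · 0.05 / 4.15) L ≤ L / 8`, and `0.01 ≤ 1 / 8`
    -- handles the queries.
    refine hT.false_of_large (A := Real.exp (L / 8)) ?_ (le_exp_of_le (by linarith)) ?_ ?_
    · rw [← Real.exp_nat_mul, show ((8 : ℕ) : ℝ) * (L / 8) = L by push_cast; ring, hL,
        Real.exp_log hn0]
    · rw [← Real.rpow_natCast, Real.rpow_def_of_pos (by norm_num), Real.exp_le_exp]
      have h1 : (s : ℝ) ≤ 0.05 * L / 4.15 :=
        hs.le.trans (by gcongr)
      calc Real.log 300 * s ≤ 6.3 * (0.05 * L / 4.15) :=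
            mul_le_mul log_three_hundred_le h1 (by positivity) (by norm_num)
        _ = 6.3 * 0.05 / 4.15 * L := by ring
        _ ≤ 1 / 8 * L := mul_le_mul_of_nonneg_right (by norm_num) (by linarith)
        _ = L / 8 := by ring
    · refine hq.le.trans (Real.exp_le_exp.2 ?_)
      linarith
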